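/- All vector spaces are complex. A *-algebraic bundle over a discrete group $G$ is a family $\mathcal{A}=(A_t)_{t\in G}$ of vector spaces with bilinear products $A_s\times A_t\to A_{st}$ and conjugate linear involutions $A_t\to A_{t^{-1}}$ such that the product is associative, $(ab)^*=b^*a^*$ and $a^{**}=a$. A $C^*$-norm on $\mathcal{A}$ is a norm on every fiber $A_t$ such that, for all $a,b\in\mathcal{A}$, $\|ab\|\le\|a\|\,\|b\|$, $\|a^*a\|=\|a\|^2$, and $a^*a\ge 0$ in the $C^*$-algebra that is the completion of $A_e$, where $e$ is the unit of $G$. A Fell bundle is a *-algebraic bundle with a $C^*$-norm for which every fiber is complete. If $\mathcal{A}$ has a $C^*$-norm, the completions of the fibers, with the continuous extensions of the operations, form a Fell bundle, called the completion of $\mathcal{A}$. A morphism of Fell bundles over the same group is a family of continuous linear maps $A_t\to B_t$ compatible with products and involutions; it is surjective if each of these maps is. For *-algebraic bundles $\mathcal{A}=(A_t)_{t\in G}$ and $\mathcal{B}=(B_s)_{s\in H}$, the algebraic tensor product $\mathcal{A}\odot\mathcal{B}$ is the *-algebraic bundle $(A_t\odot B_s)_{(t,s)\in G\times H}$ over $G\times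 H$ with $(a\odot b)(a'\odot b')=aa'\odot bb'$ and $(a\odot b)^*=a^*\odot b^*$. For a $C^*$-norm $\alpha$ on $\mathcal{A}\odot\mathcal{B}$, the tensor product $\mathcal{A}\otimes_\alpha\mathcal{B}$ is the completion of $(\mathcal{A}\odot\mathcal{B},\alpha)$. Proposition. Let $\mathcal{A}=(A_t)_{t\in G}$ and $\mathcal{B}=(B_s)_{s\in H}$ be Fell bundles over the discrete groups $G$ and $H$. Let $\|\cdot\|_{\max}$ be the maximal $C^*$-norm on the *-algebra $A_e\odot B_e$ (the supremum of all its $C^*$-seminorms), and let $\|\cdot\|_{\min}$ be the minimal, i.e. spatial, $C^*$-norm on it (the supremum of $\|(\pi\otimes\rho)(x)\|$ over all representations $\pi$ of $A_e$ and $\rho$ of $B_e$ on Hilbert spaces). Then there are $C^*$-norms $\mu$ and $\nu$ on the *-algebraic bundle $\mathcal{A}\odot\mathcal{B}$ whose restrictions to $A_e\odot B_e$ are $\|\cdot\|_{\max}$ and $\|\cdot\|_{\min}$ respectively. Write $\mathcal{A}\otimes_{\max}\mathcal{B}$ and $\mathcal{A}\otimes_{\min}\mathcal{B}$ for the corresponding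 completions. If $\alpha$ is any $C^*$-norm on $\mathcal{A}\odot\mathcal{B}$, then there are surjective morphisms of Fell bundles \[\mathcal{A}\otimes_{\max}\mathcal{B}\longrightarrow\mathcal{A}\otimes_\alpha\mathcal{B}\longrightarrow\mathcal{A}\otimes_{\min}\mathcal{B},\] which are canonical in that they extend the identity map of $\mathcal{A}\odot\mathcal{B}$. -/

import Mathlib

open scoped TensorProduct ComplexConjugate

noncomputable section

/-! ## *-algebraic bundles over discrete groups -/

/-- A `*`-algebraic bundle over a discrete group `G`: a family of complex vector spaces
`(A_t)_{t ∈ G}` with bilinear products `A_s × A_t → A_{st}` and conjugate linear involutions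
`A_s → A_{s⁻¹}` satisfying associativity, `(ab)* = b*a*` and `a** = a`.
The product is indexed by an extra `r` with a proof of `s * t = r` (and the involution by `t` with a
proof of `s⁻¹ = t`), so that the axioms can be written without transporting elements between equal
fibers; this is the same as giving the maps for `r = s * t` and `t = s⁻¹` only. -/
structure StarAlgBundle.{w, v} (G : Type v) [Group G] where
  fiber : G → Type w
  [addCommGroup : ∀ t, AddCommGroup (fiber t)]
  [module : ∀ t, Module ℂ (fiber t)]
  mul : ∀ {s t r : G}, s * t = r → fiber s →ₗ[ℂ] fiber t →ₗ[ℂ] fiber r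
  inv : ∀ {s t : G}, s⁻¹ = t → fiber s →ₗ⋆[ℂ] fiber t
  mul_assoc : ∀ {s t u st tu r : G} (h₁ : s * t = st) (h₂ : st * u = r) (h₃ : t * u = tu)
    (h₄ : s * tu = r) (a : fiber s) (b : fiber t) (c : fiber u),
    mul h₂ (mul h₁ a b) c = mul h₄ a (mul h₃ b c)
  inv_mul : ∀ {s t r s' t' r' : G} (h : s * t = r) (hs : s⁻¹ = s') (ht : t⁻¹ = t') (hr : r⁻¹ = r')
    (h' : t' * s' = r') (a : fiber s) (b : fiber t),
    inv hr (mul h a b) = mul h' (inv ht b) (inv hs a)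
  inv_inv : ∀ {s t : G} (h : s⁻¹ = t) (h' : t⁻¹ = s) (a : fiber s), inv h' (inv h a) = a

attribute [instance] StarAlgBundle.addCommGroup StarAlgBundle.module

namespace StarAlgBundle

variable {G : Type*} [Group G] {H : Type*} [Group H]

/-- The element `a* a` of the unit fiber, for `a` in the fiber over `t`. -/
def invMulSelf (A : StarAlgBundle G) {t : G} (a : A.fiber t) : A.fiber 1 :=
  A.mul (inv_mul_cancel t) (A.inv rfl a) a

theorem invMulSelf_eq (A : StarAlgBundle G) {t u : G} (h : t⁻¹ = u) (h' : u * t = 1)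
    (a : A.fiber t) : A.mul h' (A.inv h a) a = A.invMulSelf a := by
  subst h; rfl

/-- The fiber over the unit element, which is a `*`-algebra. -/
def UnitFiber (A : StarAlgBundle G) : Type _ := A.fiber 1

instance (A : StarAlgBundle G) : AddCommGroup A.UnitFiber := A.addCommGroup 1

instance (A : StarAlgBundle G) : Module ℂ A.UnitFiber := A.module 1

instance (A : StarAlgBundle G) : NonUnitalRing A.UnitFiber where
  mul a b := A.mul (mul_one 1) a b
  left_distrib a b c := map_add (A.mul (mul_one 1) a) b c
  right_distrib a b c := LinearMap.map_add₂ (A.mul (mul_one 1)) a b c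
  zero_mul a := LinearMap.map_zero₂ (A.mul (mul_one 1)) a
  mul_zero a := map_zero (A.mul (mul_one 1) a)
  mul_assoc a b c := A.mul_assoc _ _ _ _ a b c

instance (A : StarAlgBundle G) : StarRing A.UnitFiber where
  star a := A.inv inv_one a
  star_involutive a := A.inv_inv _ _ a
  star_mul a b := A.inv_mul _ _ _ _ _ a b
  star_add a b := map_add (A.inv inv_one) a b

instance (A : StarAlgBundle G) : StarModule ℂ A.UnitFiber where
  star_smul c a := map_smulₛₗ (A.inv inv_one) c a

instance (A : StarAlgBundle G) : IsScalarTower ℂ A.UnitFiber A.UnitFiber where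
  smul_assoc c a b := LinearMap.map_smul₂ (A.mul (mul_one 1)) c a b

instance (A : StarAlgBundle G) : SMulCommClass ℂ A.UnitFiber A.UnitFiber where
  smul_comm c a b := (map_smul (A.mul (mul_one 1) a) c b).symm

/-- The algebraic tensor product of two `*`-algebraic bundles over `G` and `H`: the bundle over
`G × H` with fibers `A_t ⊙ B_s`, with `(a ⊗ b)(a' ⊗ b') = aa' ⊗ bb'` and
`(a ⊗ b)* = a* ⊗ b*`. -/
def tensor (A : StarAlgBundle G) (B : StarAlgBundle H) : StarAlgBundle (G × H) where
  fiber p := A.fiber p.1 ⊗[ℂ] B.fiber p.2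
  mul h := TensorProduct.map₂ (A.mul (congrArg Prod.fst h)) (B.mul (congrArg Prod.snd h))
  inv h := TensorProduct.map (A.inv (congrArg Prod.fst h)) (B.inv (congrArg Prod.snd h))
  mul_assoc h₁ h₂ h₃ h₄ x y z := by
    induction x using TensorProduct.induction_on with
    | zero => simp
    | add x x' hx hx' => simp only [map_add, LinearMap.add_apply, hx, hx']
    | tmul a b =>
      induction y using TensorProduct.induction_on with
      | zero => simp
      | add y y' hy hy' => simp only [map_add, LinearMap.add_apply, hy, hy']
      | tmul a' b' =>
        induction z using TensorProduct.induction_on with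
        | zero => simp
        | add z z' hz hz' => simp only [map_add, hz, hz']
        | tmul a'' b'' =>
          simp only [TensorProduct.map₂_apply_tmul, TensorProduct.map_tmul]
          rw [A.mul_assoc _ _ (congrArg Prod.fst h₃) (congrArg Prod.fst h₄),
            B.mul_assoc _ _ (congrArg Prod.snd h₃) (congrArg Prod.snd h₄)]
  inv_mul h hs ht hr h' x y := by
    induction x using TensorProduct.induction_on with
    | zero => simp
    | add x x' hx hx' => simp only [map_add, LinearMap.add_apply, hx, hx']
    | tmul a b =>
      induction y using TensorProduct.induction_on with
      | zero => simp
      | add y y' hy hy' => simp only [map_add, LinearMap.add_apply, hy, hy']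
      | tmul a' b' =>
        simp only [TensorProduct.map₂_apply_tmul, TensorProduct.map_tmul]
        rw [A.inv_mul _ (congrArg Prod.fst hs) (congrArg Prod.fst ht) _ (congrArg Prod.fst h'),
          B.inv_mul _ (congrArg Prod.snd hs) (congrArg Prod.snd ht) _ (congrArg Prod.snd h')]
  inv_inv h h' x := by
    induction x using TensorProduct.induction_on with
    | zero => simp
    | add x x' hx hx' => simp only [map_add, hx, hx']
    | tmul a b => simp only [TensorProduct.map_tmul, A.inv_inv, B.inv_inv]

/-- A morphism of `*`-algebraic bundles over `G`: fiberwise linear, multiplicative and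
`*`-preserving. -/
structure Hom (A B : StarAlgBundle G) where
  toFun : ∀ t, A.fiber t →ₗ[ℂ] B.fiber t
  map_mul : ∀ {s t r : G} (h : s * t = r) (a : A.fiber s) (b : A.fiber t),
    toFun r (A.mul h a b) = B.mul h (toFun s a) (toFun t b)
  map_inv : ∀ {s t : G} (h : s⁻¹ = t) (a : A.fiber s),
    toFun t (A.inv h a) = B.inv h (toFun s a)

end StarAlgBundle

/-! ## Norms on bundles and completions -/

/-- A norm on every fiber of a `*`-algebraic bundle with `‖ab‖ ≤ ‖a‖‖b‖` and `‖a*a‖ = ‖a‖²`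
(the positivity of `a*a` is added in `CStarNorm`). -/
structure BundleNorm {G : Type*} [Group G] (A : StarAlgBundle G) where
  seminorm : ∀ t, Seminorm ℂ (A.fiber t)
  eq_zero : ∀ {t : G} (a : A.fiber t), seminorm t a = 0 → a = 0
  mul_le : ∀ {s t r : G} (h : s * t = r) (a : A.fiber s) (b : A.fiber t),
    seminorm r (A.mul h a b) ≤ seminorm s a * seminorm t b
  invMulSelf : ∀ {t : G} (a : A.fiber t), seminorm 1 (A.invMulSelf a) = seminorm t a ^ 2

namespace BundleNorm

variable {G : Type*} [Group G] {A : StarAlgBundle G} (N : BundleNorm A)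

/-- The fiber over `t`, as a normed space for the given norm. -/
def Fiber (_ : BundleNorm A) (t : G) : Type _ := A.fiber t

instance (t : G) : AddCommGroup (N.Fiber t) := A.addCommGroup t

instance (t : G) : NormedAddCommGroup (N.Fiber t) :=
  AddGroupNorm.toNormedAddCommGroup
    { toFun := N.seminorm t
      map_zero' := map_zero (N.seminorm t)
      add_le' := map_add_le_add (N.seminorm t)
      neg' := map_neg_eq_map (N.seminorm t)
      eq_zero_of_map_eq_zero' := fun a h => N.eq_zero a h }

instance (t : G) : Module ℂ (N.Fiber t) := A.module t

instance (t : G) : NormedSpace ℂ (N.Fiber t) where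
  norm_smul_le c a := (map_smul_eq_mul (N.seminorm t) c a).le

theorem norm_def {t : G} (a : N.Fiber t) : ‖a‖ = N.seminorm t a := rfl

theorem seminorm_inv {s t : G} (h : s⁻¹ = t) (a : A.fiber s) :
    N.seminorm t (A.inv h a) = N.seminorm s a := by
  have key : ∀ {s t : G} (h : s⁻¹ = t) (a : A.fiber s),
      N.seminorm s a ≤ N.seminorm t (A.inv h a) := by
    rintro s _ rfl a
    have h1 : N.seminorm s a ^ 2 ≤ N.seminorm s⁻¹ (A.inv rfl a) * N.seminorm s a := by
      rw [← N.invMulSelf a]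
      exact N.mul_le _ _ _
    have h2 : 0 ≤ N.seminorm s a := apply_nonneg _ _
    have h3 : 0 ≤ N.seminorm s⁻¹ (A.inv rfl a) := apply_nonneg _ _
    rcases h2.eq_or_lt with h2 | h2
    · rw [← h2]; exact h3
    · rw [sq] at h1
      exact le_of_mul_le_mul_right h1 h2
  have h' : t⁻¹ = s := by rw [← h, inv_inv]
  refine le_antisymm ?_ (key h a)
  have := key h' (A.inv h a)
  rwa [A.inv_inv] at this

/-- The identity map from the fiber over `t` to the same space with its norm. -/
def toFiber (t : G) : A.fiber t ≃ₗ[ℂ] N.Fiber t := LinearEquiv.refl ℂ (A.fiber t)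

theorem norm_toFiber {t : G} (a : A.fiber t) : ‖N.toFiber t a‖ = N.seminorm t a := rfl

/-- The completion of the fiber over `t`. -/
abbrev Compl (t : G) : Type _ := UniformSpace.Completion (N.Fiber t)

/-- The canonical map from the fiber over `t` to its completion. -/
def toCompl (t : G) : A.fiber t →ₗ[ℂ] N.Compl t :=
  (UniformSpace.Completion.toComplL : N.Fiber t →L[ℂ] N.Compl t).toLinearMap ∘ₗ
    (N.toFiber t).toLinearMap

theorem norm_toCompl {t : G} (a : A.fiber t) : ‖N.toCompl t a‖ = N.seminorm t a :=
  UniformSpace.Completion.norm_coe (N.toFiber t a)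

theorem denseRange_toCompl (t : G) : DenseRange (N.toCompl t) :=
  UniformSpace.Completion.denseRange_coe (α := N.Fiber t)

theorem induction₁ {t : G} {p : N.Compl t → Prop} (a : N.Compl t) (hp : IsClosed {a | p a})
    (ih : ∀ a : A.fiber t, p (N.toCompl t a)) : p a :=
  UniformSpace.Completion.induction_on a hp ih

theorem induction₂ {s t : G} {p : N.Compl s → N.Compl t → Prop} (a : N.Compl s) (b : N.Compl t)
    (hp : IsClosed {x : N.Compl s × N.Compl t | p x.1 x.2})
    (ih : ∀ (a : A.fiber s) (b : A.fiber t), p (N.toCompl s a) (N.toCompl t b)) : p a b :=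
  UniformSpace.Completion.induction_on₂ a b hp ih

theorem induction₃ {s t u : G} {p : N.Compl s → N.Compl t → N.Compl u → Prop}
    (a : N.Compl s) (b : N.Compl t) (c : N.Compl u)
    (hp : IsClosed {x : N.Compl s × N.Compl t × N.Compl u | p x.1 x.2.1 x.2.2})
    (ih : ∀ (a : A.fiber s) (b : A.fiber t) (c : A.fiber u),
      p (N.toCompl s a) (N.toCompl t b) (N.toCompl u c)) : p a b c :=
  UniformSpace.Completion.induction_on₃ a b c hp ih

/-- The product as a bounded bilinear map into the completion. -/
def mulL {s t r : G} (h : s * t = r) : N.Fiber s →L[ℂ] N.Fiber t →L[ℂ] N.Compl r :=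
  LinearMap.mkContinuous₂
    (((A.mul h).compr₂ (N.toCompl r)).compl₁₂ (N.toFiber s).symm.toLinearMap
      (N.toFiber t).symm.toLinearMap)
    1 (fun a b => by
      rw [one_mul]
      exact (N.norm_toCompl _).trans_le (N.mul_le h _ _))

/-- The continuous extension of the product to the completions. -/
def mulC {s t r : G} (h : s * t = r) : N.Compl s →L[ℂ] N.Compl t →L[ℂ] N.Compl r :=
  (((N.mulL h).extend UniformSpace.Completion.toComplL).flip.extend
    UniformSpace.Completion.toComplL).flip

/-- The involution as a bounded conjugate linear map into the completion. -/
def invL {s t : G} (h : s⁻¹ = t) : N.Fiber s →L⋆[ℂ] N.Compl t :=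
  LinearMap.mkContinuous
    ((N.toCompl t).comp ((A.inv h).comp (N.toFiber s).symm.toLinearMap))
    1 (fun a => by
      rw [one_mul]
      exact (N.norm_toCompl _).trans_le (N.seminorm_inv h _).le)

/-- The continuous extension of the involution to the completions. -/
def invC {s t : G} (h : s⁻¹ = t) : N.Compl s →L⋆[ℂ] N.Compl t :=
  (N.invL h).extend UniformSpace.Completion.toComplL

theorem mulC_toCompl {s t r : G} (h : s * t = r) (a : A.fiber s) (b : A.fiber t) :
    N.mulC h (N.toCompl s a) (N.toCompl t b) = N.toCompl r (A.mul h a b) := by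
  have h1 := ((N.mulL h).extend UniformSpace.Completion.toComplL).flip.extend_eq
    (e := UniformSpace.Completion.toComplL) UniformSpace.Completion.denseRange_coe
    (UniformSpace.Completion.isUniformInducing_coe _) (N.toFiber t b)
  have h2 := (N.mulL h).extend_eq
    (e := UniformSpace.Completion.toComplL) UniformSpace.Completion.denseRange_coe
    (UniformSpace.Completion.isUniformInducing_coe _) (N.toFiber s a)
  exact (DFunLike.congr_fun h1 _).trans (DFunLike.congr_fun h2 _)

theorem invC_toCompl {s t : G} (h : s⁻¹ = t) (a : A.fiber s) :
    N.invC h (N.toCompl s a) = N.toCompl t (A.inv h a) :=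
  (N.invL h).extend_eq
    (e := UniformSpace.Completion.toComplL) UniformSpace.Completion.denseRange_coe
    (UniformSpace.Completion.isUniformInducing_coe _) (N.toFiber s a)

/-- The `*`-algebraic bundle whose fibers are the completions of the fibers of `A`, with the
continuous extensions of the product and the involution. -/
def complBundle : StarAlgBundle G where
  fiber t := N.Compl t
  mul h := (N.mulC h).toLinearMap₁₂
  inv h := (N.invC h).toLinearMap
  mul_assoc h₁ h₂ h₃ h₄ a b c := by
    change N.mulC h₂ (N.mulC h₁ a b) c = N.mulC h₄ a (N.mulC h₃ b c)
    refine N.induction₃ (p := fun a b c => N.mulC h₂ (N.mulC h₁ a b) c =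
      N.mulC h₄ a (N.mulC h₃ b c)) a b c (isClosed_eq (by fun_prop) (by fun_prop)) ?_
    intro a b c
    simp only [mulC_toCompl, A.mul_assoc h₁ h₂ h₃ h₄]
  inv_mul h hs ht hr h' a b := by
    change N.invC hr (N.mulC h a b) = N.mulC h' (N.invC ht b) (N.invC hs a)
    refine N.induction₂ (p := fun a b => N.invC hr (N.mulC h a b) =
      N.mulC h' (N.invC ht b) (N.invC hs a)) a b (isClosed_eq (by fun_prop) (by fun_prop)) ?_
    intro a b
    simp only [mulC_toCompl, invC_toCompl, A.inv_mul h hs ht hr h']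
  inv_inv h h' a := by
    change N.invC h' (N.invC h a) = a
    refine N.induction₁ (p := fun a => N.invC h' (N.invC h a) = a) a
      (isClosed_eq (by fun_prop) (by fun_prop)) ?_
    intro a
    simp only [invC_toCompl, A.inv_inv h h']

/-- The norm of the completion. -/
def complNorm : BundleNorm N.complBundle where
  seminorm t := normSeminorm ℂ (N.Compl t)
  eq_zero {t} a h := norm_eq_zero (E := N.Compl t) |>.mp h
  mul_le {s t r} h a b := by
    refine N.induction₂ (p := fun a b => ‖N.mulC h a b‖ ≤ ‖a‖ * ‖b‖) a b
      (isClosed_le (by fun_prop) (by fun_prop)) ?_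
    intro a b
    simp only [mulC_toCompl, norm_toCompl]
    exact N.mul_le h a b
  invMulSelf {t} a := by
    refine N.induction₁ (p := fun a => ‖N.mulC (inv_mul_cancel t) (N.invC rfl a) a‖ = ‖a‖ ^ 2) a
      (isClosed_eq (by fun_prop) (by fun_prop)) ?_
    intro a
    simp only [mulC_toCompl, invC_toCompl, norm_toCompl]
    exact N.invMulSelf a

theorem complBundle_invMulSelf_toCompl {t : G} (a : A.fiber t) :
    N.complBundle.invMulSelf (N.toCompl t a : N.complBundle.fiber t) =
      N.toCompl 1 (A.invMulSelf a) := by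
  change N.mulC (inv_mul_cancel t) (N.invC rfl (N.toCompl t a)) (N.toCompl t a) = _
  rw [invC_toCompl, mulC_toCompl]
  rfl

end BundleNorm

/-- A `C*`-norm on a `*`-algebraic bundle: norms on the fibers with `‖ab‖ ≤ ‖a‖‖b‖`,
`‖a*a‖ = ‖a‖²`, and such that `a*a ≥ 0` in the `C*`-algebra that is the completion of the unit
fiber, i.e. `a*a = c*c` for some `c` in that completion. -/
structure CStarNorm {G : Type*} [Group G] (A : StarAlgBundle G) extends BundleNorm A where
  invMulSelf_nonneg : ∀ {t : G} (a : A.fiber t), ∃ c : toBundleNorm.complBundle.fiber 1,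
    toBundleNorm.toCompl 1 (A.invMulSelf a) = toBundleNorm.complBundle.invMulSelf c

/-- A Fell bundle over the discrete group `G`: a `*`-algebraic bundle with a `C*`-norm for which
every fiber is complete. -/
structure FellBundle.{w, v} (G : Type v) [Group G] where
  toBundle : StarAlgBundle.{w, v} G
  cstarNorm : CStarNorm toBundle
  complete : ∀ t, CompleteSpace (cstarNorm.Fiber t)

namespace BundleNorm

variable {G : Type*} [Group G] {A : StarAlgBundle G} (N : BundleNorm A)

instance : NormedAddCommGroup N.complBundle.UnitFiber :=
  inferInstanceAs (NormedAddCommGroup (UniformSpace.Completion (N.Fiber 1)))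

instance : NonUnitalNormedRing N.complBundle.UnitFiber :=
  { (inferInstance : NonUnitalRing N.complBundle.UnitFiber),
    (inferInstance : NormedAddCommGroup N.complBundle.UnitFiber) with
    norm_mul_le := fun a b => N.complNorm.mul_le (mul_one 1) a b }

instance : NonUnitalCStarAlgebra N.complBundle.UnitFiber :=
  { (inferInstance : NonUnitalNormedRing N.complBundle.UnitFiber),
    (inferInstance : StarRing N.complBundle.UnitFiber),
    (inferInstance : Module ℂ N.complBundle.UnitFiber),
    (inferInstance : StarModule ℂ N.complBundle.UnitFiber),
    (inferInstance : IsScalarTower ℂ N.complBundle.UnitFiber N.complBundle.UnitFiber),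
    (inferInstance : SMulCommClass ℂ N.complBundle.UnitFiber N.complBundle.UnitFiber) with
    complete := (UniformSpace.Completion.completeSpace (N.Fiber 1)).complete
    norm_mul_self_le := fun a => by
      have h1 : star a * a = N.complBundle.invMulSelf a :=
        N.complBundle.invMulSelf_eq inv_one (mul_one 1) a
      have h2 := N.complNorm.invMulSelf (t := 1) a
      rw [sq, ← h1] at h2
      exact h2.ge
    norm_smul_le := fun c a => norm_smul_le (β := UniformSpace.Completion (N.Fiber 1)) c a }

theorem isClosed_nonneg_compl :
    IsClosed {y : N.Compl 1 | ∃ c : N.complBundle.fiber 1, y = N.complBundle.invMulSelf c} := by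
  let _ := CStarAlgebra.spectralOrder N.complBundle.UnitFiber
  have := CStarAlgebra.spectralOrderedRing N.complBundle.UnitFiber
  have h := CStarAlgebra.isClosed_nonneg (A := N.complBundle.UnitFiber)
  have e : {a : N.complBundle.UnitFiber | 0 ≤ a} =
      {y | ∃ c : N.complBundle.fiber 1, y = N.complBundle.invMulSelf c} := by
    ext y
    refine (CStarAlgebra.nonneg_iff_eq_star_mul_self (A := N.complBundle.UnitFiber)).trans
      (exists_congr fun c => ?_)
    rw [← N.complBundle.invMulSelf_eq inv_one (mul_one 1) c]
    rfl
  rw [e] at h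
  exact h

theorem completeSpace_compl (t : G) : CompleteSpace (N.complNorm.Fiber t) := by
  let f : N.Compl t →+ N.complNorm.Fiber t :=
    AddMonoidHom.mk' (N.complNorm.toFiber t : N.Compl t → N.complNorm.Fiber t) fun _ _ => rfl
  have e : Isometry f := AddMonoidHomClass.isometry_of_norm f (fun _ => rfl)
  have h := e.isUniformInducing.isComplete_range
  have hf : Function.Surjective f := fun a => ⟨(N.complNorm.toFiber t).symm a, rfl⟩
  rw [hf.range_eq] at h
  exact completeSpace_iff_isComplete_univ.mpr h

end BundleNorm

namespace CStarNorm

variable {G : Type*} [Group G] {A : StarAlgBundle G} (N : CStarNorm A)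

/-- The completion of a pre-Fell bundle. -/
def completion : FellBundle G where
  toBundle := N.complBundle
  cstarNorm :=
    { N.complNorm with
      invMulSelf_nonneg := fun {t} a => by
        have key : ∃ c : N.complBundle.fiber 1,
            N.complBundle.invMulSelf a = N.complBundle.invMulSelf c := by
          refine N.induction₁ (p := fun a => ∃ c : N.complBundle.fiber 1,
            N.mulC (inv_mul_cancel t) (N.invC rfl a) a = N.complBundle.invMulSelf c) a
            (N.isClosed_nonneg_compl.preimage (by fun_prop)) ?_
          intro a
          obtain ⟨c, hc⟩ := N.invMulSelf_nonneg a
          exact ⟨c, (N.complBundle_invMulSelf_toCompl a).trans hc⟩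
        obtain ⟨c, hc⟩ := key
        refine ⟨N.complNorm.toCompl 1 c, ?_⟩
        rw [hc]
        exact (N.complNorm.complBundle_invMulSelf_toCompl c).symm }
  complete := N.completeSpace_compl

end CStarNorm

/-- A morphism of Fell bundles over `G`: a morphism of `*`-algebraic bundles that is continuous on
each fiber. -/
structure FellBundle.Hom {G : Type*} [Group G] (A B : FellBundle G) extends
    StarAlgBundle.Hom A.toBundle B.toBundle where
  continuous : ∀ t, Continuous (X := A.cstarNorm.Fiber t) (Y := B.cstarNorm.Fiber t) (toFun t)

/-! ## The maximal and the minimal `C*`-norm -/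

namespace StarAlgBundle

/-- `C*`-seminorms on the `*`-algebra `D_e`. -/
structure IsCStarSeminorm {G : Type*} [Group G] (D : StarAlgBundle G)
    (p : Seminorm ℂ D.UnitFiber) : Prop where
  mul_le : ∀ x y, p (x * y) ≤ p x * p y
  star_mul_self : ∀ x, p (star x * x) = p x ^ 2

universe u v

variable {G H : Type*} [Group G] [Group H] (A : StarAlgBundle.{u} G) (B : StarAlgBundle.{v} H)

/-- The maximal `C*`-norm on `A_e ⊙ B_e`: the supremum of all `C*`-seminorms. -/
def maxNorm (x : (A.tensor B).UnitFiber) : ℝ :=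
  sSup {r : ℝ | ∃ p : Seminorm ℂ (A.tensor B).UnitFiber,
    (A.tensor B).IsCStarSeminorm p ∧ r = p x}

section Spatial

variable {A B} {E F : Type*}
  [NormedAddCommGroup E] [InnerProductSpace ℂ E] [CompleteSpace E]
  [NormedAddCommGroup F] [InnerProductSpace ℂ F] [CompleteSpace F]

/-- For representations `π` of `A_e` on `E` and `ρ` of `B_e` on `F`, the representation `π ⊗ ρ` of
`A_e ⊙ B_e` by bounded operators on the algebraic tensor product of the Hilbert spaces `E` and `F`
with its inner product: `(π ⊗ ρ)(a ⊗ b) = π(a) ⊗ ρ(b)`. (Its operators have the same norms as their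
extensions to the Hilbert space tensor product, of which this is a dense subspace.) -/
def tensorRep (π : A.UnitFiber →⋆ₙₐ[ℂ] (E →L[ℂ] E)) (ρ : B.UnitFiber →⋆ₙₐ[ℂ] (F →L[ℂ] F)) :
    (A.tensor B).UnitFiber →ₗ[ℂ] (E ⊗[ℂ] F →L[ℂ] E ⊗[ℂ] F) :=
  TensorProduct.lift
    ((LinearMap.mk₂ ℂ (fun (S : E →L[ℂ] E) (T : F →L[ℂ] F) => TensorProduct.mapL S T)
        TensorProduct.mapL_add_left TensorProduct.mapL_smul_left
        TensorProduct.mapL_add_right TensorProduct.mapL_smul_right).compl₁₂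
      (π : A.UnitFiber →ₗ[ℂ] (E →L[ℂ] E)) (ρ : B.UnitFiber →ₗ[ℂ] (F →L[ℂ] F)))

end Spatial

/-- The minimal (spatial) `C*`-norm on `A_e ⊙ B_e`: the supremum of `‖(π ⊗ ρ)(x)‖` over all
representations `π` of `A_e` and `ρ` of `B_e` on Hilbert spaces. (It is enough to take Hilbert
spaces in the universes of `A_e` and `B_e`, which contain the spaces of all cyclic representations
and hence those of faithful ones.) -/
def minNorm (x : (A.tensor B).UnitFiber) : ℝ :=
  sSup {r : ℝ | ∃ (E : Type u) (_ : NormedAddCommGroup E) (_ : InnerProductSpace ℂ E)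
    (_ : CompleteSpace E) (F : Type v) (_ : NormedAddCommGroup F) (_ : InnerProductSpace ℂ F)
    (_ : CompleteSpace F) (π : A.UnitFiber →⋆ₙₐ[ℂ] (E →L[ℂ] E))
    (ρ : B.UnitFiber →⋆ₙₐ[ℂ] (F →L[ℂ] F)), r = ‖tensorRep π ρ x‖}

end StarAlgBundle

end

open scoped TensorProduct ComplexConjugate

noncomputable section

open scoped ComplexOrder

/-! ## States of unital `C*`-algebras -/

/-! A `C*`-norm on `A ⊙ B` is determined by its restriction `p` to `D = A_e ⊙ B_e`, since `‖x‖² =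
p(x*x)`. Two questions remain: whether the maximal and the minimal norm of `D` extend to all fibers
by this formula, and how the `C*`-norms compare on `D`.

Extension. With `⟨x, y⟩ = x*y`, every fiber is an inner product module over `D`. In a Fell bundle
the matrices `(x_i* x_j)` are positive over the unit fiber, so that `x*x` is a sum of squares in `D`
for each `x` in a fiber of `A ⊙ B` (`exists_ip_self_eq_sum`). This yields the positivity axiom and a
Cauchy–Schwarz inequality (`ip_sq_le`), hence the triangle inequality. Since `(xy)*(xy) = y*(x*x)y`,
submultiplicativity reduces to `‖zy‖ ≤ p(z)‖y‖` for `z` in `D` (`IsCStarSeminorm.extend`). For the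
maximal norm this holds because the operator seminorm of `D` acting on a fiber is a `C*`-seminorm
(`isCStarSeminorm_actionSeminorm`). For the minimal norm, product states `f ⊗ g` detect upper bounds
on positive elements (`minSeminorm_le_of_forall_prodState`), and in the tensor product of the GNS
spaces made from `f` on `A_t` and `g` on `B_s` the action of `z` is bounded by its spatial norm.

Comparison. Every `C*`-norm is at most the maximal one by definition. That the minimal one is
smallest is Takesaki's theorem. `A_e` and `B_e` act by commuting multipliers on the completion of
`D` for `α`. A state of the multiplier algebra whose marginal on the unitization of `A_e` is extreme
is a product state; separation arguments and the Krein–Milman theorem then show that all product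
states are contractive for `α` (`norm_tensorFunctional_le`). Their extensions are positive on the
completion, and product states detect the spatial norm.

Morphisms. Comparable norms on `D` give comparable norms on all fibers, so the identity extends to
contractions between the completions. They are onto because images have preimages of no larger norm:
`y` is replaced by `y(1 + k)`, with `k` in the kernel over the unit, by functional calculus in `y*y`
(`exists_complMap_eq`). -/

theorem WeakDual.locallyConvexSpace_real (E : Type*) [AddCommGroup E] [Module ℂ E]
    [TopologicalSpace E] : LocallyConvexSpace ℝ (WeakDual ℂ E) :=
  WeakBilin.locallyConvexSpace (𝕜 := ℂ) (B := topDualPairing ℂ E)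

theorem WeakDual.exists_eq_eval {E : Type*} [AddCommGroup E] [Module ℂ E] [TopologicalSpace E]
    (F : StrongDual ℂ (WeakDual ℂ E)) : ∃ a : E, ∀ f : WeakDual ℂ E, F f = f a := by
  obtain ⟨a, ha⟩ := LinearMap.dualEmbedding_surjective (topDualPairing ℂ E) F
  exact ⟨a, fun f => by rw [← ha]; rfl⟩

/-- Hahn–Banach for the weak topology, whose continuous functionals are the evaluations; separation
is therefore by the real part of one evaluation. -/
theorem WeakDual.exists_separating {E : Type*} [AddCommGroup E] [Module ℂ E] [TopologicalSpace E]
 {K : Set (WeakDual ℂ E)} {g : WeakDual ℂ E} (hK : Convex ℝ K)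
    (hK' : IsClosed K)  (hgK : g ∉ K) : ∃ (a : E) (u : ℝ),
      (∀ k ∈ K, (k a).re < u) ∧ u < (g a).re := by
  obtain ⟨F, u, h1, h2⟩ :=
  @RCLike.geometric_hahn_banach_closed_point ℂ (WeakDual ℂ E) _ _ (WeakDual.instModule' ℝ) K g _ _
    ⟨fun r z f => DFunLike.ext _ _ fun a => smul_assoc r z (f a)⟩ _ _ (WeakDual.locallyConvexSpace_real E) hK hK' hgK
  obtain ⟨a, ha⟩ := WeakDual.exists_eq_eval F
  exact ⟨a, u, fun k hk => ha k ▸ h1 k hk, ha g ▸ h2⟩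

theorem WeakDual.closure_convexHull_extremePoints {E : Type*} [AddCommGroup E] [Module ℂ E] [TopologicalSpace E]
 {K : Set (WeakDual ℂ E)}  (hK : Convex ℝ K)
    (hK' : IsCompact K)  : closure (convexHull ℝ (K.extremePoints ℝ)) = K := 
  @_root_.closure_convexHull_extremePoints (WeakDual ℂ E) _ (WeakDual.instModule' ℝ) _ _ _ _ (WeakDual.locallyConvexSpace_real E) K hK' hK

/-- The states of a unital `C*`-algebra. -/
def states (A : Type*) [CStarAlgebra A] : Set (WeakDual ℂ A) :=
  {f | f 1 = 1 ∧ ∀ a, 0 ≤ f (star a * a)}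

section States

variable {A : Type*} [CStarAlgebra A] {f : WeakDual ℂ A}

/-- Polarization: `f((1 + za)*(1 + za))` is real, which forces `z f(a) + z̄ f(a*)` to be real; `z =
1` and `z = i` give the two parts of the identity. -/
theorem map_star_of_pos (hf : ∀ a, 0 ≤ f (star a * a)) (a : A) : f (star a) = conj (f a) := by
  have key : ∀ z : ℂ, (z * f a + conj z * f (star a)).im = 0 := by
    intro z
    have h := hf (1 + z • a)
    have h0 := hf a
    have h1 := hf 1
    have e : f (star (1 + z • a) * (1 + z • a)) =
        f (star 1 * 1) + (z * f a + conj z * f (star a)) + (conj z * z) * f (star a * a) := by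
      simp only [star_add, star_one, star_smul, add_mul, mul_add, one_mul, mul_one, map_add,
        smul_mul_assoc, mul_smul_comm, map_smul, smul_eq_mul, RCLike.star_def]
      ring
    rw [e] at h
    have h2 := (Complex.nonneg_iff.mp h).2
    have h3 := (Complex.nonneg_iff.mp h0).2
    have h4 := (Complex.nonneg_iff.mp h1).2
    rw [Complex.add_im, Complex.add_im, ← Complex.normSq_eq_conj_mul_self,
      Complex.im_ofReal_mul] at h2
    rw [← h3, ← h4] at h2
    linarith
  have h1 := key 1
  have h2 := key Complex.I
  apply Complex.ext
  · simp at h2 ⊢; linarith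
  · simp at h1 ⊢; linarith

theorem norm_apply_star_mul_sq_le (hf : ∀ a, 0 ≤ f (star a * a)) (a b : A) :
    ‖f (star a * b)‖ ^ 2 ≤ (f (star a * a)).re * (f (star b * b)).re := by
  let c : PreInnerProductSpace.Core ℂ A :=
    { inner := fun a b => f (star a * b)
      conj_inner_symm := fun a b => by
        rw [← map_star_of_pos hf, star_mul, star_star]
      re_inner_nonneg := fun a => (Complex.nonneg_iff.mp (hf a)).1
      add_left := fun a b c => by rw [star_add, add_mul, map_add]
      smul_left := fun a b r => by
        rw [star_smul, smul_mul_assoc, map_smul, smul_eq_mul]; rfl }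
  have h := @InnerProductSpace.Core.inner_mul_inner_self_le ℂ A _ _ _ c a b
  change ‖f (star a * b)‖ * ‖f (star b * a)‖ ≤ _ at h
  have e : f (star b * a) = conj (f (star a * b)) := by
    rw [← map_star_of_pos hf, star_mul, star_star]
  rw [e, RCLike.norm_conj, ← sq] at h
  exact h

/-- Cauchy–Schwarz against the unit gives `|f(a)|² ≤ f(a*a)`, and `a*a ≤ ‖a‖²`. -/
theorem norm_apply_le_of_mem_states (hf : f ∈ states A) (a : A) : ‖f a‖ ≤ ‖a‖ := by
  let _ := CStarAlgebra.spectralOrder A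
  have := CStarAlgebra.spectralOrderedRing A
  have h := norm_apply_star_mul_sq_le hf.2 1 a
  rw [star_one, one_mul, one_mul, hf.1, Complex.one_re, one_mul] at h
  have h1 : star a * a ≤ algebraMap ℝ A (‖a‖ ^ 2) := CStarAlgebra.star_mul_le_algebraMap_norm_sq
  obtain ⟨d, hd⟩ := CStarAlgebra.nonneg_iff_eq_star_mul_self.mp (sub_nonneg.mpr h1)
  have h2 := hf.2 d
  rw [← hd, map_sub, Algebra.algebraMap_eq_smul_one, ← Complex.coe_smul, map_smul, hf.1] at h2
  have h3 := (Complex.nonneg_iff.mp h2).1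
  rw [smul_eq_mul, mul_one, Complex.sub_re, Complex.ofReal_re] at h3
  exact le_of_sq_le_sq (h.trans (by linarith)) (norm_nonneg _)

theorem convex_states : Convex ℝ (states A) := by
  intro f hf g hg s t hs ht hst
  refine ⟨?_, fun a => ?_⟩
  · change (s : ℝ) • f 1 + (t : ℝ) • g 1 = 1
    rw [hf.1, hg.1, ← add_smul, hst, one_smul]
  · change 0 ≤ (s : ℝ) • f (star a * a) + (t : ℝ) • g (star a * a)
    exact add_nonneg (smul_nonneg hs (hf.2 a)) (smul_nonneg ht (hg.2 a))

theorem isClosed_states : IsClosed (states A) := by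
  refine IsClosed.inter (isClosed_eq (WeakDual.eval_continuous _) continuous_const) ?_
  have e : {f : WeakDual ℂ A | ∀ a, 0 ≤ f (star a * a)} = ⋂ a, {f | 0 ≤ f (star a * a)} := by
    ext f; simp
  change IsClosed {f : WeakDual ℂ A | ∀ a, 0 ≤ f (star a * a)}
  rw [e]
  exact isClosed_iInter fun a => isClosed_le continuous_const (WeakDual.eval_continuous _)

theorem isCompact_states : IsCompact (states A) := by
  refine (WeakDual.isCompact_closedBall (0 : StrongDual ℂ A) 1).of_isClosed_subset
    isClosed_states fun f hf => ?_
  rw [Set.mem_preimage, mem_closedBall_zero_iff]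
  exact ContinuousLinearMap.opNorm_le_bound _ zero_le_one fun a => by
    rw [one_mul]; exact norm_apply_le_of_mem_states hf a

/-- Testing on `a + it` for real `t`: the imaginary part of the value is shifted by `t`, while the
norm squared is at most `‖a‖² + t²`. The terms `t²` cancel and leave a linear bound in `t`,
impossible unless its slope vanishes. -/
theorem im_apply_eq_zero_of_norm_le {g : WeakDual ℂ A} (h1 : g 1 = 1) (hg : ∀ a, ‖g a‖ ≤ ‖a‖)
    {a : A} (ha : IsSelfAdjoint a) : (g a).im = 0 := by
  have key : ∀ t : ℝ, ((g a).im + t) ^ 2 ≤ ‖a‖ ^ 2 + t ^ 2 * ‖(1 : A)‖ := by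
    intro t
    have e1 : g (a + (t * Complex.I) • (1 : A)) = g a + t * Complex.I := by
      rw [map_add, map_smul, h1, smul_eq_mul, mul_one]
    have e2 : star (a + (t * Complex.I) • (1 : A)) * (a + (t * Complex.I) • (1 : A)) =
        a * a + ((t ^ 2 : ℝ) : ℂ) • 1 := by
      have hI : -((t : ℂ) * Complex.I * (t * Complex.I)) = (t : ℂ) ^ 2 := by
        rw [mul_mul_mul_comm, Complex.I_mul_I]; ring
      rw [Complex.ofReal_pow, ← hI]
      simp only [star_add, ha.star_eq, star_smul, star_one, add_mul, mul_add, smul_mul_assoc,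
        mul_smul_comm, one_mul, mul_one, RCLike.star_def, map_mul, Complex.conj_ofReal,
        Complex.conj_I, mul_neg, neg_smul, neg_mul, smul_add, smul_neg, smul_smul]
      abel
    have h2 := hg (a + (t * Complex.I) • (1 : A))
    rw [e1] at h2
    have h3 : ‖g a + t * Complex.I‖ ^ 2 ≤ ‖a * a + ((t ^ 2 : ℝ) : ℂ) • (1 : A)‖ := by
      rw [← e2, CStarRing.norm_star_mul_self, ← sq]
      exact pow_le_pow_left₀ (norm_nonneg _) h2 2
    have h4 : ‖a * a + ((t ^ 2 : ℝ) : ℂ) • (1 : A)‖ ≤ ‖a‖ ^ 2 + t ^ 2 * ‖(1 : A)‖ := by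
      refine (norm_add_le _ _).trans (add_le_add ((norm_mul_le _ _).trans_eq (sq _).symm) ?_)
      rw [norm_smul, Complex.norm_real, Real.norm_of_nonneg (sq_nonneg t)]
    have h5 : ((g a).im + t) ^ 2 ≤ ‖g a + t * Complex.I‖ ^ 2 := by
      rw [← Complex.normSq_eq_norm_sq, Complex.normSq_apply]
      simp only [Complex.add_im, Complex.mul_im, Complex.ofReal_re, Complex.I_im, mul_one,
        Complex.ofReal_im, Complex.I_re, mul_zero, add_zero]
      nlinarith [mul_self_nonneg ((g a) + t * Complex.I).re]
    exact h5.trans (h3.trans h4)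
  have hn : ‖(1 : A)‖ = 1 := by
    have : Nontrivial A := by
      refine ⟨1, 0, fun h => ?_⟩
      rw [h, map_zero] at h1
      exact zero_ne_one h1
    exact CStarRing.norm_one
  rw [hn] at key
  by_contra hne
  -- This `t` makes the cross term `2t · im g(a)` equal to `‖a‖² + 1`, more than the bound allows.
  have := key ((‖a‖ ^ 2 + 1) / (2 * (g a).im))
  have e : 2 * (g a).im * ((‖a‖ ^ 2 + 1) / (2 * (g a).im)) = ‖a‖ ^ 2 + 1 := by
    field_simp
  nlinarith [sq_nonneg (g a).im]

/-- For `b = a*a` one has `‖ ‖b‖·1 - b ‖ ≤ ‖b‖`, so `g(b)` lies in the disc of radius `‖b‖` about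
`‖b‖` and has nonnegative real part. -/
theorem mem_states_of_norm_le {g : WeakDual ℂ A} (h1 : g 1 = 1) (hg : ∀ a, ‖g a‖ ≤ ‖a‖) :
    g ∈ states A := by
  let _ := CStarAlgebra.spectralOrder A
  have := CStarAlgebra.spectralOrderedRing A
  refine ⟨h1, fun a => ?_⟩
  have hsa : IsSelfAdjoint (star a * a) := IsSelfAdjoint.star_mul_self a
  refine Complex.nonneg_iff.mpr ⟨?_, (im_apply_eq_zero_of_norm_le h1 hg hsa).symm⟩
  set b := star a * a with hb
  have hb0 : 0 ≤ b := star_mul_self_nonneg a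
  have h2 : ‖algebraMap ℝ A ‖b‖ - b‖ ≤ ‖b‖ := by
    have h3 : b ≤ algebraMap ℝ A ‖b‖ := hsa.le_algebraMap_norm_self
    refine (CStarAlgebra.norm_le_norm_of_nonneg_of_le (sub_nonneg.mpr h3)
      (sub_le_self _ hb0)).trans ?_
    rw [norm_algebraMap]
    have : Nontrivial A := by
      refine ⟨1, 0, fun h => ?_⟩
      rw [h, map_zero] at h1
      exact zero_ne_one h1
    rw [CStarRing.norm_one, mul_one, norm_norm]
  have h4 := (hg _).trans h2
  rw [map_sub, Algebra.algebraMap_eq_smul_one, ← Complex.coe_smul, map_smul, h1, smul_eq_mul,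
    mul_one] at h4
  have h5 := (Complex.re_le_norm _).trans h4
  rw [Complex.sub_re, Complex.ofReal_re] at h5
  linarith

/-- A norming functional `g` of `c` is already a state. By `mem_states_of_norm_le` only `g(1) = 1`
is needed, and this follows from `‖c + z(1 - c)‖ ≤ 1` for all `|z| = 1`, a bound that holds
pointwise on the spectrum in `[0, 1]`. -/
theorem exists_state_apply_eq_norm [Nontrivial A] {c : A} (hc : ∃ d, c = star d * d)
    (h1 : ‖c‖ = 1) : ∃ h ∈ states A, h c = 1 := by
  let _ := CStarAlgebra.spectralOrder A
  have := CStarAlgebra.spectralOrderedRing A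
  have hc0 : 0 ≤ c := CStarAlgebra.nonneg_iff_eq_star_mul_self.mpr hc
  have hc1 : c ≤ 1 := (CStarAlgebra.norm_le_one_iff_of_nonneg c).mp h1.le
  obtain ⟨g, hg, hgc⟩ := exists_dual_vector ℂ c (by rw [h1]; exact one_ne_zero)
  rw [h1] at hgc
  have hgle : ∀ a, ‖g a‖ ≤ ‖a‖ := fun a => by
    have := g.le_opNorm a
    rwa [hg, one_mul] at this
  have key : ∀ z : ℂ, ‖z‖ = 1 → ‖1 + z * g (1 - c)‖ ≤ 1 := by
    intro z hz
    have hcfc : c + z • (1 - c) = cfc (fun t : ℂ => t + z * (1 - t)) c := by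
      have : IsStarNormal c := hc0.isSelfAdjoint.isStarNormal
      rw [cfc_add (a := c) (fun t : ℂ => t) (fun t => z * (1 - t)),
        cfc_const_mul z (fun t : ℂ => 1 - t) c,
        cfc_sub (a := c) (fun _ : ℂ => (1 : ℂ)) (fun t => t), cfc_id' ℂ c, cfc_const_one ℂ c]
    have hn : ‖c + z • (1 - c)‖ ≤ 1 := by
      rw [hcfc]
      refine norm_cfc_le zero_le_one fun t ht => ?_
      have ht' := (spectrum_nonneg_of_nonneg hc0 : ∀ ⦃x : ℂ⦄, x ∈ spectrum ℂ c → 0 ≤ x) ht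
      obtain ⟨r, hr⟩ : ∃ r : ℝ, t = r := ⟨t.re, by
        apply Complex.ext <;> simp [(Complex.nonneg_iff.mp ht').2]⟩
      have hr0 : 0 ≤ r := by rw [hr] at ht'; exact_mod_cast ht'
      have hr1 : r ≤ 1 := by
        have := (spectrum.norm_le_norm_of_mem ht).trans_eq h1
        rw [hr, Complex.norm_real] at this
        exact (le_abs_self r).trans this
      rw [hr]
      calc ‖(r : ℂ) + z * (1 - r)‖ ≤ ‖(r : ℂ)‖ + ‖z * (1 - r)‖ := norm_add_le _ _
        _ = r + (1 - r) := by
          rw [norm_mul, hz, one_mul, Complex.norm_real, Real.norm_of_nonneg hr0,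
            ← Complex.ofReal_one, ← Complex.ofReal_sub, Complex.norm_real,
            Real.norm_of_nonneg (by linarith)]
        _ = 1 := by ring
    have := (hgle (c + z • (1 - c))).trans hn
    rwa [map_add, hgc, map_smul, smul_eq_mul, RCLike.ofReal_one] at this
  have hzero : g (1 - c) = 0 := by
    by_contra hne
    -- The phase `z` is chosen to make `z g(1 - c) = |g(1 - c)|`, so that the bound reads `1 + |g(1
    -- - c)| ≤ 1`.
    have h2 := key (conj (g (1 - c)) / ‖g (1 - c)‖) (by
      rw [norm_div, RCLike.norm_conj, Complex.norm_real, norm_norm]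
      exact div_self (norm_ne_zero_iff.mpr hne))
    have h3 : conj (g (1 - c)) / ‖g (1 - c)‖ * g (1 - c) = (‖g (1 - c)‖ : ℂ) := by
      rw [div_mul_eq_mul_div, ← Complex.normSq_eq_conj_mul_self, Complex.normSq_eq_norm_sq,
        Complex.ofReal_pow, sq, mul_div_assoc, div_self (by exact_mod_cast norm_ne_zero_iff.mpr hne),
        mul_one]
    rw [h3] at h2
    have h4 : ‖(1 : ℂ) + (‖g (1 - c)‖ : ℂ)‖ = 1 + ‖g (1 - c)‖ := by
      rw [← Complex.ofReal_one, ← Complex.ofReal_add, Complex.norm_real,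
        Real.norm_of_nonneg (by positivity)]
    rw [h4] at h2
    have := norm_pos_iff.mpr hne
    linarith
  have hg1 : g 1 = 1 := by
    rw [map_sub, sub_eq_zero] at hzero
    rw [hzero, hgc, RCLike.ofReal_one]
  refine ⟨StrongDual.toWeakDual g, mem_states_of_norm_le hg1 hgle, ?_⟩
  rw [StrongDual.toWeakDual_apply, hgc, RCLike.ofReal_one]

/-- A state that is maximal on a self-adjoint contraction `e` does not see the difference between
`e` and the unit. -/
theorem apply_mul_eq_of_apply_eq_one (hf : f ∈ states A) {e : A} (he : IsSelfAdjoint e)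
    (h1 : ‖e‖ ≤ 1) (hfe : f e = 1) (y : A) : f (e * y) = f y := by
  have hs : star (1 - e) = 1 - e := by rw [star_sub, star_one, he.star_eq]
  have h2 := norm_apply_star_mul_sq_le hf.2 (1 - e) y
  -- `f((1 - e)²) = f(e²) - 1 ≤ 0`; Cauchy–Schwarz then annihilates `f((1 - e)y)`.
  have h3 : (f (star (1 - e) * (1 - e))).re ≤ 0 := by
    have h4 : ‖f (e * e)‖ ≤ 1 := (norm_apply_le_of_mem_states hf _).trans
      ((norm_mul_le _ _).trans (mul_le_one₀ h1 (norm_nonneg _) h1))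
    rw [hs, mul_sub, mul_one, sub_mul, one_mul, map_sub, map_sub, map_sub, hf.1, hfe]
    simp only [sub_self, zero_sub, Complex.neg_re, Complex.sub_re, Complex.one_re]
    have := (Complex.re_le_norm _).trans h4
    linarith
  have h5 : 0 ≤ (f (star y * y)).re := (Complex.nonneg_iff.mp (hf.2 y)).1
  have h6 : ‖f (star (1 - e) * y)‖ ^ 2 ≤ 0 := h2.trans (mul_nonpos_of_nonpos_of_nonneg h3 h5)
  have h7 : f (star (1 - e) * y) = 0 := by
    rw [← norm_eq_zero]
    exact pow_eq_zero_iff two_ne_zero |>.mp (le_antisymm h6 (sq_nonneg _))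
  rw [hs, sub_mul, one_mul, map_sub, sub_eq_zero] at h7
  exact h7.symm

/-- States are hermitian, so an element separating a state from `K` may be replaced by its real
part. It is thus enough that `K` reaches the values of all states on self-adjoint elements. -/
theorem states_subset_of_forall_exists_le {K : Set (WeakDual ℂ A)} (hK : Convex ℝ K)
    (hK' : IsClosed K) (hKs : K ⊆ states A)
    (h : ∀ a, IsSelfAdjoint a → ∀ g ∈ states A, ∃ k ∈ K, (g a).re ≤ (k a).re) :
    states A ⊆ K := by
  intro g hg
  by_contra hgK
  obtain ⟨a, u, h1, h2⟩ := WeakDual.exists_separating hK hK' hgK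
  have key : ∀ k ∈ states A, (k ((realPart a : selfAdjoint A) : A)).re = (k a).re := by
    intro k hk
    rw [realPart_apply_coe, ← Complex.coe_smul, map_smul, map_add, map_star_of_pos hk.2]
    simp
    ring
  obtain ⟨k, hk, hle⟩ := h _ (realPart a).2 g hg
  rw [key g hg, key k (hKs hk)] at hle
  exact absurd (h2.trans_le hle) (not_lt.mpr (h1 k hk).le)

end States

/-! ## States of unitizations -/

theorem exists_star_mul_self_of_nonneg {A : Type*} [NonUnitalCStarAlgebra A] [PartialOrder A]
    [StarOrderedRing A] {a : A} (ha : 0 ≤ a) : ∃ d, a = star d * d :=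
  CStarAlgebra.nonneg_iff_eq_star_mul_self.mp ha

section Pullback

variable {A M : Type*} [CStarAlgebra A] [CStarAlgebra M]

/-- A `*`-homomorphism of `C*`-algebras as a continuous linear map. -/
def StarAlgHom.toCLM (φ : A →⋆ₐ[ℂ] M) : A →L[ℂ] M :=
  φ.toAlgHom.toLinearMap.mkContinuous 1 fun a => by
    rw [one_mul]; exact NonUnitalStarAlgHom.norm_apply_le φ a

/-- The composition of a functional with a `*`-homomorphism. -/
def WeakDual.pullback (φ : A →⋆ₐ[ℂ] M) (h : WeakDual ℂ M) : WeakDual ℂ A :=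
  StrongDual.toWeakDual ((WeakDual.toStrongDual h).comp φ.toCLM)

@[simp]
theorem WeakDual.pullback_apply (φ : A →⋆ₐ[ℂ] M) (h : WeakDual ℂ M) (a : A) :
    WeakDual.pullback φ h a = h (φ a) := rfl

theorem WeakDual.continuous_pullback (φ : A →⋆ₐ[ℂ] M) : Continuous (WeakDual.pullback φ) :=
  WeakDual.continuous_of_continuous_eval fun a => WeakDual.eval_continuous (φ a)

theorem pullback_mem_states (φ : A →⋆ₐ[ℂ] M) {h : WeakDual ℂ M} (hh : h ∈ states M) :
    WeakDual.pullback φ h ∈ states A :=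
  ⟨by rw [WeakDual.pullback_apply, map_one, hh.1], fun a => by
    rw [WeakDual.pullback_apply, map_mul, map_star]; exact hh.2 _⟩

end Pullback

section Unitization

/-- The unitization of a `C*`-algebra, as a unital `C*`-algebra. -/
def CStarUnitization (A : Type*) [NonUnitalCStarAlgebra A] : Type _ := Unitization ℂ A

namespace CStarUnitization

instance (A : Type*) [NonUnitalCStarAlgebra A] : CStarAlgebra (CStarUnitization A) :=
  inferInstanceAs (CStarAlgebra (Unitization ℂ A))

variable {A : Type*} [NonUnitalCStarAlgebra A]

/-- The inclusion of the algebra in its unitization. -/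
def inr : A →⋆ₙₐ[ℂ] CStarUnitization A := Unitization.inrNonUnitalStarAlgHom ℂ A

/-- The unital extension of a `*`-homomorphism into a unital algebra. -/
def lift {M : Type*} [CStarAlgebra M] (φ : A →⋆ₙₐ[ℂ] M) : CStarUnitization A →⋆ₐ[ℂ] M :=
  Unitization.starLift φ

/-- The projection to the scalar part. -/
def scalar : CStarUnitization A →⋆ₐ[ℂ] ℂ := lift 0

/-- The component in the algebra. -/
def snd (z : CStarUnitization A) : A := (z : Unitization ℂ A).toProd.2

theorem norm_inr (a : A) : ‖inr a‖ = ‖a‖ := Unitization.norm_inr (𝕜 := ℂ) a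

theorem lift_apply {M : Type*} [CStarAlgebra M] (φ : A →⋆ₙₐ[ℂ] M) (z : CStarUnitization A) :
    lift φ z = (z : Unitization ℂ A).toProd.1 • (1 : M) + φ z.snd :=
  congrArg (· + φ z.snd) (Algebra.algebraMap_eq_smul_one _)

theorem scalar_apply (z : CStarUnitization A) : scalar z = (z : Unitization ℂ A).toProd.1 := by
  rw [scalar, lift_apply, smul_eq_mul, mul_one]
  exact add_zero _

@[simp]
theorem snd_inr (a : A) : snd (inr a) = a := rfl

@[simp]
theorem scalar_inr (a : A) : scalar (inr a) = 0 := by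
  rw [scalar_apply]; rfl

theorem eq_smul_one_add_inr (z : CStarUnitization A) : z = scalar z • 1 + inr z.snd := by
  rw [scalar_apply]
  have h : algebraMap ℂ (Unitization ℂ A) (z : Unitization ℂ A).toProd.1 =
      (z : Unitization ℂ A).toProd.1 • (1 : Unitization ℂ A) := Algebra.algebraMap_eq_smul_one _
  exact (Unitization.inl_fst_add_inr_snd_eq (z : Unitization ℂ A)).symm.trans
    (congrArg (· + (Unitization.inr z.snd : Unitization ℂ A)) h)

@[simp]
theorem lift_inr {M : Type*} [CStarAlgebra M] (φ : A →⋆ₙₐ[ℂ] M) (a : A) :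
    lift φ (inr a) = φ a := by
  rw [lift_apply, ← scalar_apply, scalar_inr, zero_smul, zero_add, snd_inr]

theorem lift_eq {M : Type*} [CStarAlgebra M] (φ : A →⋆ₙₐ[ℂ] M) (z : CStarUnitization A) :
    lift φ z = scalar z • 1 + φ z.snd := by
  rw [lift_apply, scalar_apply]

theorem snd_star (z : CStarUnitization A) : snd (star z) = star z.snd :=
  Unitization.snd_star (z : Unitization ℂ A)

end CStarUnitization

open CStarUnitization

variable {A : Type*} [NonUnitalCStarAlgebra A]

/-- The state at infinity of the unitization, which vanishes on `A`. -/
def infState (A : Type*) [NonUnitalCStarAlgebra A] : WeakDual ℂ (CStarUnitization A) :=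
  StrongDual.toWeakDual (StarAlgHom.toCLM scalar)

theorem infState_apply (a : CStarUnitization A) : infState A a = scalar a := rfl

theorem infState_mem : infState A ∈ states (CStarUnitization A) := by
  refine ⟨by rw [infState_apply, map_one], fun a => ?_⟩
  rw [infState_apply, map_mul, map_star]
  exact star_mul_self_nonneg _

/-- Scalars play no role, so the task is to exceed `g(a)` for self-adjoint `a` in `A`. If `a⁺ = 0`,
the state at infinity does it, with value `0`. Otherwise a state `k` with value `1` on `a⁺/‖a⁺‖`
does it: it kills `a⁻`, because `a⁺a⁻ = 0`, and takes the value `‖a⁺‖ ≥ g(a⁺) ≥ g(a)` on `a`. -/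
theorem states_unitization_subset {K : Set (WeakDual ℂ (CStarUnitization A))} (hK : Convex ℝ K)
    (hK' : IsClosed K) (hKs : K ⊆ states (CStarUnitization A)) (hinf : infState A ∈ K)
    (h : ∀ a : A, (∃ d, a = star d * d) → ‖a‖ = 1 → ∃ k ∈ K, k (inr a) = 1) :
    states (CStarUnitization A) ⊆ K := by
  let _ := CStarAlgebra.spectralOrder A
  have := CStarAlgebra.spectralOrderedRing A
  refine states_subset_of_forall_exists_le hK hK' hKs fun z hz g hg => ?_
  set a := snd z with ha
  have haS : IsSelfAdjoint a := by
    rw [ha, isSelfAdjoint_iff, ← snd_star, hz.star_eq]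
  have hval : ∀ k ∈ states (CStarUnitization A), k z = scalar z + k (inr a) := by
    intro k hk
    conv_lhs => rw [eq_smul_one_add_inr z]
    rw [map_add, map_smul, hk.1, smul_eq_mul, mul_one]
  have hpos : ∀ k ∈ states (CStarUnitization A), ∀ b : A, 0 ≤ b →
      0 ≤ (k (inr b)).re := by
    intro k hk b hb
    obtain ⟨d, rfl⟩ := exists_star_mul_self_of_nonneg hb
    rw [map_mul, map_star]
    exact (Complex.nonneg_iff.mp (hk.2 _)).1
  have hsub : ∀ k : WeakDual ℂ (CStarUnitization A), k (inr a) =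
      k (inr (a⁺)) - k (inr (a⁻)) := by
    intro k
    rw [← map_sub, ← map_sub, CFC.posPart_sub_negPart a haS]
  have hgn := hpos g hg _ (CFC.negPart_nonneg a)
  rcases eq_or_ne (a⁺) 0 with h0 | h0
  · refine ⟨infState A, hinf, ?_⟩
    rw [hval g hg, infState_apply, hsub, h0, map_zero, map_zero, zero_sub,
      Complex.add_re, Complex.neg_re]
    linarith
  · set e := ‖a⁺‖⁻¹ • a⁺ with he
    have hn : ‖a⁺‖ ≠ 0 := norm_ne_zero_iff.mpr h0
    have he0 : 0 ≤ e := smul_nonneg (inv_nonneg.mpr (norm_nonneg _)) (CFC.posPart_nonneg a)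
    have he1 : ‖e‖ = 1 := by
      rw [he, norm_smul, norm_inv, norm_norm, inv_mul_cancel₀ hn]
    obtain ⟨k, hk, hke⟩ := h e (exists_star_mul_self_of_nonneg he0) he1
    refine ⟨k, hk, ?_⟩
    have h1 : k (inr (a⁻)) = 0 := by
      rw [← apply_mul_eq_of_apply_eq_one (hKs hk) (e := (inr e))
        (he0.isSelfAdjoint.map inr) (by rw [norm_inr, he1]) hke, ← map_mul,
        he, smul_mul_assoc, CFC.posPart_mul_negPart, smul_zero, map_zero, map_zero]
    have h2 : k (inr (a⁺)) = ‖a⁺‖ := by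
      have : a⁺ = (‖a⁺‖ : ℂ) • e := by
        rw [he, Complex.coe_smul, smul_smul, mul_inv_cancel₀ hn, one_smul]
      rw [this, map_smul, map_smul, hke, smul_eq_mul, mul_one, ← this]
    have h3 : (g (inr (a⁺))).re ≤ ‖a⁺‖ :=
      (Complex.re_le_norm _).trans ((norm_apply_le_of_mem_states hg _).trans_eq
        (norm_inr _))
    rw [hval g hg, hval k (hKs hk), hsub g, hsub k, h1, h2, sub_zero, Complex.add_re,
      Complex.sub_re, Complex.add_re, Complex.ofReal_re]
    linarith

end Unitization

/-! ## Commuting representations of two `C*`-algebras -/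

section Cross

variable {A B M : Type*} [NonUnitalCStarAlgebra A] [NonUnitalCStarAlgebra B] [CStarAlgebra M]

/-- A spectral cutoff: `b = (a - r)⁺` is supported where `a ≥ r`, and is nonzero because `1` is in
the spectrum of `a`. -/
theorem exists_ne_zero_mul_ge {A : Type*} [NonUnitalCStarAlgebra A] [PartialOrder A]
    [StarOrderedRing A] {a : A} (ha : 0 ≤ a) (h1 : ‖a‖ = 1) {r : ℝ} (hr0 : 0 ≤ r) (hr : r < 1) :
    ∃ b : A, 0 ≤ b ∧ b ≠ 0 ∧ 0 ≤ a * b - r • b := by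
  have hc : Continuous fun t : ℝ => max (t - r) 0 := by fun_prop
  have h0 : max ((0 : ℝ) - r) 0 = 0 := max_eq_right (by linarith)
  refine ⟨cfcₙ (fun t : ℝ => max (t - r) 0) a, cfcₙ_nonneg fun t _ => le_max_right _ _, ?_, ?_⟩
  · have hmem : (1 : ℝ) ∈ quasispectrum ℝ a := by
      rw [Unitization.quasispectrum_eq_spectrum_inr' ℝ ℂ]
      have := CStarAlgebra.norm_mem_spectrum_of_nonneg (A := Unitization ℂ A)
        (Unitization.inr_nonneg_iff.mpr ha)
      rwa [Unitization.norm_inr, h1] at this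
    have h2 := norm_apply_le_norm_cfcₙ (fun t : ℝ => max (t - r) 0) a hmem hc.continuousOn h0
    intro h3
    rw [h3, norm_zero] at h2
    have h4 : max (1 - r) 0 = 1 - r := max_eq_left (by linarith)
    rw [h4, Real.norm_of_nonneg (by linarith)] at h2
    linarith
  · have e : a * cfcₙ (fun t : ℝ => max (t - r) 0) a - r • cfcₙ (fun t : ℝ => max (t - r) 0) a =
        cfcₙ (fun t : ℝ => t * max (t - r) 0 - r * max (t - r) 0) a := by
      rw [cfcₙ_sub (a := a) (fun t : ℝ => t * max (t - r) 0) (fun t => r * max (t - r) 0)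
          (by fun_prop) (by simp) (by fun_prop) (by rw [h0, mul_zero]),
        cfcₙ_mul (a := a) (fun t : ℝ => t) (fun t => max (t - r) 0) (by fun_prop) rfl
          hc.continuousOn h0,
        cfcₙ_id' ℝ a, cfcₙ_const_mul (a := a) r (fun t => max (t - r) 0) hc.continuousOn h0]
    rw [e]
    refine cfcₙ_nonneg fun t _ => ?_
    rw [← sub_mul]
    rcases le_total t r with h | h
    · rw [max_eq_right (by linarith), mul_zero]
    · rw [max_eq_left (by linarith)]
      exact mul_self_nonneg _

variable {iA : A →⋆ₙₐ[ℂ] M} {iB : B →⋆ₙₐ[ℂ] M}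

/-- For `r < 1`, cutoffs `a'` of `a` and `b'` of `b` at level `r` give a nonzero positive `w = a'b'`
with `ab·w ≥ r²w`, whence `‖ab‖ ≥ r²`. Injectivity is needed only on elementary products, to have `w
≠ 0`. -/
theorem norm_mul_eq_one_of_commute (hcomm : ∀ a b, Commute (iA a) (iB b))
    (hinj : ∀ a b, iA a * iB b = 0 → a = 0 ∨ b = 0) {a : A} {b : B}
    (ha : ∃ d, a = star d * d) (ha1 : ‖a‖ = 1) (hb : ∃ d, b = star d * d) (hb1 : ‖b‖ = 1) :
    ‖iA a * iB b‖ = 1 := by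
  let _ := CStarAlgebra.spectralOrder A
  have := CStarAlgebra.spectralOrderedRing A
  let _ := CStarAlgebra.spectralOrder B
  have := CStarAlgebra.spectralOrderedRing B
  let _ := CStarAlgebra.spectralOrder M
  have := CStarAlgebra.spectralOrderedRing M
  have ha0 : 0 ≤ a := CStarAlgebra.nonneg_iff_eq_star_mul_self.mpr ha
  have hb0 : 0 ≤ b := CStarAlgebra.nonneg_iff_eq_star_mul_self.mpr hb
  refine le_antisymm ((norm_mul_le _ _).trans (mul_le_one₀
    ((NonUnitalStarAlgHom.norm_apply_le iA a).trans_eq ha1) (norm_nonneg _)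
    ((NonUnitalStarAlgHom.norm_apply_le iB b).trans_eq hb1))) ?_
  have pA : ∀ {x : A}, 0 ≤ x → 0 ≤ iA x := fun hx => by
    obtain ⟨d, rfl⟩ := exists_star_mul_self_of_nonneg hx
    rw [map_mul, map_star]; exact star_mul_self_nonneg _
  have pB : ∀ {x : B}, 0 ≤ x → 0 ≤ iB x := fun hx => by
    obtain ⟨d, rfl⟩ := exists_star_mul_self_of_nonneg hx
    rw [map_mul, map_star]; exact star_mul_self_nonneg _
  have key : ∀ r : ℝ, 0 ≤ r → r < 1 → r * r ≤ ‖iA a * iB b‖ := by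
    intro r hr0 hr1
    obtain ⟨a', ha'0, ha'n, ha'⟩ := exists_ne_zero_mul_ge ha0 ha1 hr0 hr1
    obtain ⟨b', hb'0, hb'n, hb'⟩ := exists_ne_zero_mul_ge hb0 hb1 hr0 hr1
    have hw0 : 0 ≤ iA a' * iB b' := (hcomm a' b').mul_nonneg (pA ha'0) (pB hb'0)
    have hwn : iA a' * iB b' ≠ 0 := fun h => (hinj a' b' h).elim ha'n hb'n
    have hbb : 0 ≤ b * b' := by
      have := add_nonneg hb' (smul_nonneg hr0 hb'0)
      rwa [sub_add_cancel] at this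
    have e : iA a * iB b * (iA a' * iB b') - (r * r) • (iA a' * iB b') =
        iA (a * a' - r • a') * iB (b * b') + r • (iA a' * iB (b * b' - r • b')) := by
      have hr : ∀ x : A, iA (r • x) = r • iA x := fun x => by
        rw [← Complex.coe_smul, map_smul, Complex.coe_smul]
      have hr' : ∀ x : B, iB (r • x) = r • iB x := fun x => by
        rw [← Complex.coe_smul, map_smul, Complex.coe_smul]
      have hc : iA a * iB b * (iA a' * iB b') = iA a * iA a' * (iB b * iB b') := by
        rw [mul_assoc, ← mul_assoc (iB b), ← (hcomm a' b).eq, mul_assoc, mul_assoc]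
      rw [hc, map_sub, map_sub, map_mul, map_mul, hr, hr', sub_mul, mul_sub, smul_sub,
        smul_mul_assoc, mul_smul_comm, smul_smul]
      abel
    have hle : (r * r) • (iA a' * iB b') ≤ iA a * iB b * (iA a' * iB b') := by
      rw [← sub_nonneg, e]
      exact add_nonneg ((hcomm _ _).mul_nonneg (pA ha') (pB hbb))
        (smul_nonneg hr0 ((hcomm _ _).mul_nonneg (pA ha'0) (pB hb')))
    have h2 := CStarAlgebra.norm_le_norm_of_nonneg_of_le
      (smul_nonneg (mul_nonneg hr0 hr0) hw0) hle
    rw [norm_smul, Real.norm_of_nonneg (mul_nonneg hr0 hr0)] at h2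
    exact le_of_mul_le_mul_right (h2.trans (norm_mul_le _ _)) (norm_pos_iff.mpr hwn)
  by_contra hlt
  push Not at hlt
  -- One value of `r` replaces the limit `r → 1`: its square is the midpoint of `‖ab‖` and `1`.
  have h1 := key (√((‖iA a * iB b‖ + 1) / 2)) (Real.sqrt_nonneg _) (by
    rw [Real.sqrt_lt' one_pos]; linarith)
  rw [Real.mul_self_sqrt (by positivity)] at h1
  linarith

/-- A state with value `1` on the product `ab` has it on both factors, because `ab ≤ a ≤ 1` and `ab
≤ b ≤ 1` for commuting positive contractions. -/
theorem exists_state_apply_eq_one (hcomm : ∀ a b, Commute (iA a) (iB b))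
    (hinj : ∀ a b, iA a * iB b = 0 → a = 0 ∨ b = 0) {a : A} {b : B}
    (ha : ∃ d, a = star d * d) (ha1 : ‖a‖ = 1) (hb : ∃ d, b = star d * d) (hb1 : ‖b‖ = 1) :
    ∃ h ∈ states M, h (iA a) = 1 ∧ h (iB b) = 1 := by
  let _ := CStarAlgebra.spectralOrder M
  have := CStarAlgebra.spectralOrderedRing M
  have hn := norm_mul_eq_one_of_commute hcomm hinj ha ha1 hb hb1
  have hM : Nontrivial M := ⟨iA a * iB b, 0, fun h => by rw [h, norm_zero] at hn; exact zero_ne_one hn⟩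
  have pA : 0 ≤ iA a := by
    obtain ⟨d, rfl⟩ := ha
    rw [map_mul, map_star]; exact star_mul_self_nonneg _
  have pB : 0 ≤ iB b := by
    obtain ⟨d, rfl⟩ := hb
    rw [map_mul, map_star]; exact star_mul_self_nonneg _
  have nA : iA a ≤ 1 := (CStarAlgebra.norm_le_one_iff_of_nonneg _).mp
    ((NonUnitalStarAlgHom.norm_apply_le iA a).trans_eq ha1)
  have nB : iB b ≤ 1 := (CStarAlgebra.norm_le_one_iff_of_nonneg _).mp
    ((NonUnitalStarAlgHom.norm_apply_le iB b).trans_eq hb1)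
  obtain ⟨h, hh, h1⟩ := exists_state_apply_eq_norm
    (exists_star_mul_self_of_nonneg ((hcomm a b).mul_nonneg pA pB)) hn
  have hmono : ∀ x : M, 0 ≤ x → 0 ≤ h x := fun x hx => by
    obtain ⟨d, rfl⟩ := exists_star_mul_self_of_nonneg hx
    exact hh.2 d
  refine ⟨h, hh, le_antisymm ?_ ?_, le_antisymm ?_ ?_⟩
  · have := hmono _ (sub_nonneg.mpr nA)
    rwa [map_sub, hh.1, sub_nonneg] at this
  · have e : iA a - iA a * iB b = iA a * (1 - iB b) := by rw [mul_sub, mul_one]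
    have := hmono _ (e ▸ Commute.mul_nonneg pA (sub_nonneg.mpr nB)
      ((Commute.one_right _).sub_right (hcomm a b)))
    rwa [map_sub, h1, sub_nonneg] at this
  · have := hmono _ (sub_nonneg.mpr nB)
    rwa [map_sub, hh.1, sub_nonneg] at this
  · have e : iB b - iA a * iB b = (1 - iA a) * iB b := by rw [sub_mul, one_mul]
    have := hmono _ (e ▸ Commute.mul_nonneg (sub_nonneg.mpr nA) pB
      ((Commute.one_left _).sub_left (hcomm a b)))
    rwa [map_sub, h1, sub_nonneg] at this

end Cross

/-! ## Product functionals are bounded for every `C*`-norm -/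

/-- The hull is the continuous image of `S × [0, 1]`. Having it compact, hence closed, makes it
unnecessary to pass to a closed hull when extreme points are located. -/
theorem isCompact_convexHull_insert {E : Type*} [AddCommGroup E] [Module ℝ E]
    [TopologicalSpace E] [ContinuousAdd E] [ContinuousSMul ℝ E] (p : E) {S : Set E}
    (hS : IsCompact S) (hS' : Convex ℝ S) : IsCompact (convexHull ℝ (insert p S)) := by
  rcases S.eq_empty_or_nonempty with rfl | hne
  · rw [insert_empty_eq, convexHull_singleton]
    exact isCompact_singleton
  · have e : convexHull ℝ (insert p S) =
        (fun q : E × ℝ => (1 - q.2) • p + q.2 • q.1) '' (S ×ˢ Set.Icc 0 1) := by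
      rw [convexHull_insert hne, hS'.convexHull_eq]
      ext k
      rw [mem_convexJoin]
      constructor
      · rintro ⟨_, rfl, s, hs, a, b, ha, hb, hab, rfl⟩
        refine ⟨⟨s, b⟩, ⟨hs, hb, by linarith⟩, ?_⟩
        change (1 - b) • _ + b • s = _
        rw [← hab, add_sub_cancel_right]
      · rintro ⟨⟨s, t⟩, ⟨hs, ht⟩, rfl⟩
        exact ⟨p, rfl, s, hs, 1 - t, t, by linarith [ht.2], ht.1, by ring, rfl⟩
    rw [e]
    exact (hS.prod isCompact_Icc).image (by fun_prop)

theorem WeakDual.isCompact_convexHull_insert {E : Type*} [AddCommGroup E] [Module ℂ E]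
    [TopologicalSpace E] (p : WeakDual ℂ E) {S : Set (WeakDual ℂ E)}
    (hS : IsCompact S) (hS' : Convex ℝ S) : IsCompact (convexHull ℝ (insert p S)) :=
  @_root_.isCompact_convexHull_insert (WeakDual ℂ E) _ (WeakDual.instModule' ℝ) _ _
    (WeakDual.instContinuousSMul ℝ) p S hS hS'

/-! ### States with an extreme marginal -/

section PureMarginal

variable {A B M : Type*} [CStarAlgebra A] [CStarAlgebra B] [CStarAlgebra M]

/-- A state of which the marginal is extreme is a product state. -/
theorem apply_mul_eq_of_extreme {φ : A →⋆ₐ[ℂ] M} {ψ : B →⋆ₐ[ℂ] M}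
    (hcomm : ∀ a b, Commute (φ a) (ψ b)) {h : WeakDual ℂ M} (hh : h ∈ states M)
    (hext : WeakDual.pullback φ h ∈ (states A).extremePoints ℝ) (a : A) (b : B) :
    h (φ a * ψ b) = h (φ a) * h (ψ b) := by
  let _ := CStarAlgebra.spectralOrder B
  have := CStarAlgebra.spectralOrderedRing B
  -- The case `0 ≤ c ≤ 1` with `0 < h(ψ c) < 1`, where both weights of the convex decomposition
  -- below are positive.
  have key : ∀ c e e' : B, c = star e * e → 1 - c = star e' * e' → (h (ψ c)).re ∈ Set.Ioo 0 1 →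
      ∀ a, h (φ a * ψ c) = h (φ a) * h (ψ c) := by
    intro c e e' he he' ht a
    have hpos : ∀ (d : B) (x : A), 0 ≤ h (φ (star x * x) * ψ (star d * d)) := by
      intro d x
      have : φ (star x * x) * ψ (star d * d) = star (φ x * ψ d) * (φ x * ψ d) := by
        have c1 : φ x * star (ψ d) = star (ψ d) * φ x := by
          rw [← map_star]; exact hcomm x (star d)
        have c2 : star (φ x) * star (ψ d) = star (ψ d) * star (φ x) := by
          rw [← map_star, ← map_star]; exact hcomm (star x) (star d)
        rw [map_mul, map_mul, map_star, map_star, star_mul, mul_assoc, ← mul_assoc (φ x), c1,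
          ← mul_assoc, ← mul_assoc, c2]
        simp only [mul_assoc]
      rw [this]
      exact hh.2 _
    set t := (h (ψ c)).re with htdef
    have htc : h (ψ c) = t := by
      have h1 := (Complex.nonneg_iff.mp (by have := hpos e 1; rwa [star_one, one_mul, map_one,
        one_mul, ← he] at this : 0 ≤ h (ψ c))).2
      apply Complex.ext
      · rw [Complex.ofReal_re]
      · rw [Complex.ofReal_im, h1]
    let L : B → WeakDual ℂ A := fun d => StrongDual.toWeakDual
      (((WeakDual.toStrongDual h).comp ((ContinuousLinearMap.mul ℂ M).flip (ψ d))).comp φ.toCLM)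
    have hL : ∀ d x, L d x = h (φ x * ψ d) := fun d x => rfl
    have hmem : ∀ (d d' : B) (s : ℝ), d = star d' * d' → 0 < s → h (ψ d) = s →
        s⁻¹ • L d ∈ states A := by
      intro d d' s hd hs hds
      refine ⟨?_, fun x => ?_⟩
      · change s⁻¹ • L d 1 = 1
        rw [hL, map_one, one_mul, hds, Complex.real_smul, ← Complex.ofReal_mul,
          inv_mul_cancel₀ hs.ne', Complex.ofReal_one]
      · change 0 ≤ s⁻¹ • L d (star x * x)
        rw [hL, hd]
        exact smul_nonneg (inv_nonneg.mpr hs.le) (hpos d' x)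
    have h1t : h (ψ (1 - c)) = ((1 - t : ℝ) : ℂ) := by
      rw [map_sub, map_sub, map_one, hh.1, htc, Complex.ofReal_sub, Complex.ofReal_one]
    have m1 := hmem c e t he ht.1 htc
    have m2 := hmem (1 - c) e' (1 - t) he' (by linarith [ht.2]) h1t
    -- Writing `1 = c + (1 - c)` splits the marginal into a convex combination of the states `x ↦
    -- h(φ x ψ c)/t` and `x ↦ h(φ x ψ(1 - c))/(1 - t)`; by extremality both equal the marginal.
    have hseg : WeakDual.pullback φ h ∈ openSegment ℝ (t⁻¹ • L c) ((1 - t)⁻¹ • L (1 - c)) := by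
      refine ⟨t, 1 - t, ht.1, by linarith [ht.2], by ring, ?_⟩
      refine DFunLike.ext _ _ fun x => ?_
      change t • (t⁻¹ • L c x) + (1 - t) • ((1 - t)⁻¹ • L (1 - c) x) = h (φ x)
      rw [smul_smul, smul_smul, mul_inv_cancel₀ ht.1.ne', mul_inv_cancel₀ (by linarith [ht.2]),
        one_smul, one_smul, hL, hL, ← map_add, ← mul_add, map_sub, map_one, add_sub_cancel, mul_one]
    have := (mem_extremePoints.mp hext).2 _ m1 _ m2 hseg
    have h3 := DFunLike.congr_fun this.1 a
    change t⁻¹ • L c a = h (φ a) at h3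
    rw [hL, inv_smul_eq_iff₀ ht.1.ne', Complex.real_smul] at h3
    rw [h3, htc, mul_comm]
  have hnn : ∀ c : B, 0 ≤ c → ∀ a, h (φ a * ψ c) = h (φ a) * h (ψ c) := by
    intro c hc a
    -- The claim is affine in `c`. Passing to `1/3 + c/s` puts the value of `h` in `[1/3, 2/3]`,
    -- away from the degenerate weights `0` and `1`.
    set s : ℝ := 3 * (‖c‖ + 1) with hs
    have hs0 : 0 < s := by positivity
    set c' : B := (3⁻¹ : ℝ) • 1 + s⁻¹ • c with hc'
    have h1 : c ≤ algebraMap ℝ B ‖c‖ := hc.isSelfAdjoint.le_algebraMap_norm_self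
    have h2 : 0 ≤ c' := add_nonneg (smul_nonneg (by positivity) zero_le_one)
      (smul_nonneg (by positivity) hc)
    have h3 : 0 ≤ 1 - c' := by
      have e : 1 - c' = s⁻¹ • (algebraMap ℝ B ‖c‖ - c) + ((1 : ℝ) - 3⁻¹ - s⁻¹ * ‖c‖) • 1 := by
        rw [hc', Algebra.algebraMap_eq_smul_one]
        module
      rw [e]
      refine add_nonneg (smul_nonneg (by positivity) (sub_nonneg.mpr h1))
        (smul_nonneg ?_ zero_le_one)
      have : s⁻¹ * ‖c‖ ≤ 3⁻¹ := by
        rw [inv_mul_le_iff₀ hs0, hs]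
        linarith
      linarith
    obtain ⟨e, he⟩ := exists_star_mul_self_of_nonneg h2
    obtain ⟨e', he'⟩ := exists_star_mul_self_of_nonneg h3
    have hval : ∀ x : M, h (x * ψ c') = (3⁻¹ : ℝ) • h x + s⁻¹ • h (x * ψ c) := by
      intro x
      rw [hc', ← Complex.coe_smul, ← Complex.coe_smul s⁻¹, map_add, map_smul, map_smul, map_one,
        mul_add, mul_smul_comm, mul_smul_comm, mul_one, map_add, map_smul, map_smul,
        Complex.coe_smul, Complex.coe_smul]
    have hval1 := hval 1
    rw [one_mul, one_mul, hh.1] at hval1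
    have hpos : 0 ≤ (h (ψ c)).re := by
      obtain ⟨d, rfl⟩ := exists_star_mul_self_of_nonneg hc
      rw [map_mul, map_star]
      exact (Complex.nonneg_iff.mp (hh.2 _)).1
    have hle : (h (ψ c)).re ≤ ‖c‖ := (Complex.re_le_norm _).trans
      ((norm_apply_le_of_mem_states hh _).trans (NonUnitalStarAlgHom.norm_apply_le ψ c))
    have hre : (h (ψ c')).re = 3⁻¹ + s⁻¹ * (h (ψ c)).re := by
      rw [hval1]
      simp [Complex.real_smul]
    have h5 : s⁻¹ * (h (ψ c)).re ≤ 3⁻¹ := by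
      rw [inv_mul_le_iff₀ hs0, hs]
      linarith
    have h4 := key c' e e' he he' ⟨by rw [hre]; positivity, by rw [hre]; linarith⟩ a
    rw [hval1, hval, mul_add, mul_smul_comm, mul_smul_comm, mul_one, add_right_inj] at h4
    exact smul_right_injective ℂ (inv_ne_zero hs0.ne') h4
  obtain ⟨y, hy, -, hb⟩ := CStarAlgebra.exists_sum_four_nonneg b
  rw [hb]
  simp only [map_sum, map_smul, Finset.mul_sum, mul_smul_comm, hnn _ (hy _)]

end PureMarginal

/-! ### Takesaki's theorem on product states -/

section Takesaki

open CStarUnitization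

variable {A B M : Type*} [NonUnitalCStarAlgebra A] [NonUnitalCStarAlgebra B] [CStarAlgebra M]
  {iA : A →⋆ₙₐ[ℂ] M} {iB : B →⋆ₙₐ[ℂ] M}

/-- The tensor product of two functionals on the unitizations, restricted to the algebraic tensor
product. -/
def tensorFunctional (f : WeakDual ℂ (CStarUnitization A)) (g : WeakDual ℂ (CStarUnitization B)) :
    A ⊗[ℂ] B →ₗ[ℂ] ℂ :=
  TensorProduct.lift ((LinearMap.mul ℂ ℂ).compl₁₂
    ((f : CStarUnitization A →ₗ[ℂ] ℂ) ∘ₗ ((inr : A →⋆ₙₐ[ℂ] CStarUnitization A) : A →ₗ[ℂ] CStarUnitization A))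
    ((g : CStarUnitization B →ₗ[ℂ] ℂ) ∘ₗ ((inr : B →⋆ₙₐ[ℂ] CStarUnitization B) : B →ₗ[ℂ] CStarUnitization B)))

@[simp]
theorem tensorFunctional_tmul (f : WeakDual ℂ (CStarUnitization A))
    (g : WeakDual ℂ (CStarUnitization B)) (a : A) (b : B) :
    tensorFunctional f g (a ⊗ₜ b) = f (inr a) * g (inr b) := rfl

/-- The linear map on the algebraic tensor product given by two representations. -/
def productMap (iA : A →⋆ₙₐ[ℂ] M) (iB : B →⋆ₙₐ[ℂ] M) : A ⊗[ℂ] B →ₗ[ℂ] M :=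
  TensorProduct.lift ((LinearMap.mul ℂ M).compl₁₂ (iA : A →ₗ[ℂ] M) (iB : B →ₗ[ℂ] M))

@[simp]
theorem productMap_tmul (a : A) (b : B) : productMap iA iB (a ⊗ₜ b) = iA a * iB b := rfl

theorem continuous_tensorFunctional (x : A ⊗[ℂ] B) : Continuous
    fun p : WeakDual ℂ (CStarUnitization A) × WeakDual ℂ (CStarUnitization B) =>
      tensorFunctional p.1 p.2 x := by
  induction x using TensorProduct.induction_on with
  | zero => simp only [map_zero]; exact continuous_const
  | tmul a b =>
    simp only [tensorFunctional_tmul]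
    exact ((WeakDual.eval_continuous _).comp continuous_fst).mul
      ((WeakDual.eval_continuous _).comp continuous_snd)
  | add x y hx hy => simp only [map_add]; exact hx.add hy

theorem tensorFunctional_add_smul_left (f f' : WeakDual ℂ (CStarUnitization A))
    (g : WeakDual ℂ (CStarUnitization B)) (s t : ℝ) (x : A ⊗[ℂ] B) :
    tensorFunctional (s • f + t • f') g x =
      s • tensorFunctional f g x + t • tensorFunctional f' g x := by
  induction x using TensorProduct.induction_on with
  | zero => simp
  | tmul a b =>
    simp only [tensorFunctional_tmul]
    change (s • f (inr a) + t • f' (inr a)) * g (inr b) = _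
    rw [add_mul, smul_mul_assoc, smul_mul_assoc]
  | add x y hx hy => simp only [map_add, hx, hy, smul_add]; abel

theorem tensorFunctional_add_smul_right (f : WeakDual ℂ (CStarUnitization A))
    (g g' : WeakDual ℂ (CStarUnitization B)) (s t : ℝ) (x : A ⊗[ℂ] B) :
    tensorFunctional f (s • g + t • g') x =
      s • tensorFunctional f g x + t • tensorFunctional f g' x := by
  induction x using TensorProduct.induction_on with
  | zero => simp
  | tmul a b =>
    simp only [tensorFunctional_tmul]
    change f (inr a) * (s • g (inr b) + t • g' (inr b)) = _
    rw [mul_add, mul_smul_comm, mul_smul_comm]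
  | add x y hx hy => simp only [map_add, hx, hy, smul_add]; abel

theorem norm_convex_combination_le {u v : ℂ} {c s t : ℝ} (hs : 0 ≤ s) (ht : 0 ≤ t)
    (hst : s + t = 1) (hu : ‖u‖ ≤ c) (hv : ‖v‖ ≤ c) : ‖s • u + t • v‖ ≤ c := by
  refine (norm_add_le _ _).trans ?_
  rw [norm_smul, norm_smul, Real.norm_of_nonneg hs, Real.norm_of_nonneg ht]
  calc s * ‖u‖ + t * ‖v‖ ≤ s * c + t * c := by gcongr
    _ = c := by rw [← add_mul, hst, one_mul]

theorem commute_starLift (hcomm : ∀ a b, Commute (iA a) (iB b)) (x : CStarUnitization A)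
    (y : CStarUnitization B) :
    Commute (lift iA x) (lift iB y) := by
  rw [lift_eq, lift_eq]
  exact (((Commute.one_left _).smul_left _).add_left
    ((((Commute.one_right _).smul_right _).add_right (hcomm _ _))))

/-- Extreme states other than the state at infinity extend to states that are maximal on a given
positive element of the other algebra. -/
theorem exists_extension_of_extreme (hcomm : ∀ a b, Commute (iA a) (iB b))
    (hinj : ∀ a b, iA a * iB b = 0 → a = 0 ∨ b = 0) {f : WeakDual ℂ (CStarUnitization A)}
    (hf : f ∈ (states (CStarUnitization A)).extremePoints ℝ) (hfi : f ≠ infState A) {b : B}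
    (hb : ∃ d, b = star d * d) (hb1 : ‖b‖ = 1) :
    ∃ h ∈ states M, WeakDual.pullback (lift iA) h = f ∧ h (iB b) = 1 := by
  -- The marginals of the states in `S`, together with the state at infinity, have all states in
  -- their convex hull: the separation criterion applies because some state has value `1` on `a` and
  -- on `b` simultaneously.
  set S : Set (WeakDual ℂ M) := states M ∩ {h | h (iB b) = 1} with hS
  set P := WeakDual.pullback (lift iA) with hP
  have hScl : IsClosed {h : WeakDual ℂ M | h (iB b) = 1} :=
    isClosed_eq (WeakDual.eval_continuous _) continuous_const
  have hSc : IsCompact S := isCompact_states.inter_right hScl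
  have hSconv : Convex ℝ S := by
    refine convex_states.inter fun h hh k hk s t hs ht hst => ?_
    change s • h (iB b) + t • k (iB b) = 1
    rw [show h (iB b) = 1 from hh, show k (iB b) = 1 from hk, ← add_smul, hst, one_smul]
  have hPS : ∀ h ∈ S, P h ∈ states (CStarUnitization A) := fun h hh => pullback_mem_states _ hh.1
  have hPconv : Convex ℝ (P '' S) := by
    rintro _ ⟨h, hh, rfl⟩ _ ⟨k, hk, rfl⟩ s t hs ht hst
    exact ⟨s • h + t • k, hSconv hh hk hs ht hst, rfl⟩
  have hKc := WeakDual.isCompact_convexHull_insert (infState A)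
    (hSc.image (WeakDual.continuous_pullback _)) hPconv
  have hKs : convexHull ℝ (insert (infState A) (P '' S)) ⊆ states (CStarUnitization A) := by
    refine convexHull_min ?_ convex_states
    rintro _ (rfl | ⟨h, hh, rfl⟩)
    · exact infState_mem
    · exact hPS h hh
  have hsub := states_unitization_subset (K := convexHull ℝ (insert (infState A) (P '' S)))
    (convex_convexHull ℝ _) hKc.isClosed hKs
    (subset_convexHull ℝ _ (Set.mem_insert _ _)) (fun a ha ha1 => by
      obtain ⟨h, hh, h1, h2⟩ := exists_state_apply_eq_one hcomm hinj ha ha1 hb hb1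
      refine ⟨P h, subset_convexHull ℝ _ (Or.inr ⟨h, ⟨hh, h2⟩, rfl⟩), ?_⟩
      rw [hP, WeakDual.pullback_apply, lift_inr, h1])
  -- An extreme point of a convex hull belongs to the generating set, so `f` is itself such a
  -- marginal.
  rw [← Set.Subset.antisymm hKs hsub] at hf
  rcases extremePoints_convexHull_subset hf with h0 | ⟨h, hh, hhf⟩
  · exact absurd h0 hfi
  · exact ⟨h, hh.1, hhf, hh.2⟩

theorem isClosed_setOf_norm_tensorFunctional_le (f : WeakDual ℂ (CStarUnitization A)) :
    IsClosed {g : WeakDual ℂ (CStarUnitization B) |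
      ∀ x : A ⊗[ℂ] B, ‖tensorFunctional f g x‖ ≤ ‖productMap iA iB x‖} := by
  have e : {g : WeakDual ℂ (CStarUnitization B) |
      ∀ x : A ⊗[ℂ] B, ‖tensorFunctional f g x‖ ≤ ‖productMap iA iB x‖} =
      ⋂ x : A ⊗[ℂ] B, {g | ‖tensorFunctional f g x‖ ≤ ‖productMap iA iB x‖} := by
    ext g; simp
  rw [e]
  exact isClosed_iInter fun x => isClosed_le
    ((continuous_tensorFunctional x).comp (Continuous.prodMk_right f)).norm continuous_const

theorem convex_setOf_norm_tensorFunctional_le (f : WeakDual ℂ (CStarUnitization A)) :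
    Convex ℝ {g : WeakDual ℂ (CStarUnitization B) |
      ∀ x : A ⊗[ℂ] B, ‖tensorFunctional f g x‖ ≤ ‖productMap iA iB x‖} := by
  intro g hg k hk s t hs ht hst x
  rw [tensorFunctional_add_smul_right]
  exact norm_convex_combination_le hs ht hst (hg x) (hk x)

theorem tensorFunctional_infState_left (g : WeakDual ℂ (CStarUnitization B)) (x : A ⊗[ℂ] B) :
    tensorFunctional (infState A) g x = 0 := by
  induction x using TensorProduct.induction_on with
  | zero => rw [map_zero]
  | tmul a b => rw [tensorFunctional_tmul, infState_apply, scalar_inr, zero_mul]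
  | add x y hx hy => rw [map_add, hx, hy, add_zero]

theorem tensorFunctional_infState_right (f : WeakDual ℂ (CStarUnitization A)) (x : A ⊗[ℂ] B) :
    tensorFunctional f (infState B) x = 0 := by
  induction x using TensorProduct.induction_on with
  | zero => rw [map_zero]
  | tmul a b => rw [tensorFunctional_tmul, infState_apply, scalar_inr, mul_zero]
  | add x y hx hy => rw [map_add, hx, hy, add_zero]

theorem tensorFunctional_pullback_eq (hcomm : ∀ a b, Commute (iA a) (iB b)) {h : WeakDual ℂ M}
    (hh : h ∈ states M)
    (hext : WeakDual.pullback (lift iA) h ∈ (states (CStarUnitization A)).extremePoints ℝ)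
    (x : A ⊗[ℂ] B) :
    tensorFunctional (WeakDual.pullback (lift iA) h) (WeakDual.pullback (lift iB) h) x =
      h (productMap iA iB x) := by
  induction x using TensorProduct.induction_on with
  | zero => simp only [map_zero]
  | tmul a b =>
    rw [tensorFunctional_tmul, productMap_tmul, WeakDual.pullback_apply,
      WeakDual.pullback_apply, ← apply_mul_eq_of_extreme (commute_starLift hcomm) hh
        hext, lift_inr, lift_inr]
  | add x y hx hy => simp only [map_add, hx, hy]

/-- For fixed `f`, the states `g` that satisfy the bound form a closed convex set. It contains the
state at infinity, and for each positive `b` of norm one a state with value `1` on `b`: the marginal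
of an extension `h` of `f`. Indeed `h` is a product state, so `f ⊗ g` is `h` composed with the
product map. By the separation criterion the set contains every state. -/
theorem norm_tensorFunctional_le_of_extreme (hcomm : ∀ a b, Commute (iA a) (iB b))
    (hinj : ∀ a b, iA a * iB b = 0 → a = 0 ∨ b = 0) {f : WeakDual ℂ (CStarUnitization A)}
    (hf : f ∈ (states (CStarUnitization A)).extremePoints ℝ)
    {g : WeakDual ℂ (CStarUnitization B)}
    (hg : g ∈ states (CStarUnitization B)) (x : A ⊗[ℂ] B) :
    ‖tensorFunctional f g x‖ ≤ ‖productMap iA iB x‖ := by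
  by_cases hfi : f = infState A
  · rw [hfi, tensorFunctional_infState_left, norm_zero]
    exact norm_nonneg _
  have hsub := states_unitization_subset (K := states (CStarUnitization B) ∩
      {g | ∀ x : A ⊗[ℂ] B, ‖tensorFunctional f g x‖ ≤ ‖productMap iA iB x‖})
    (convex_states.inter (convex_setOf_norm_tensorFunctional_le f))
    (isClosed_states.inter (isClosed_setOf_norm_tensorFunctional_le f)) Set.inter_subset_left
    ⟨infState_mem, fun x => by
      rw [tensorFunctional_infState_right, norm_zero]; exact norm_nonneg _⟩
    (fun b hb hb1 => by
      obtain ⟨h, hh, hhf, hhb⟩ := exists_extension_of_extreme hcomm hinj hf hfi hb hb1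
      refine ⟨WeakDual.pullback (lift iB) h, ⟨pullback_mem_states _ hh, fun x => ?_⟩, ?_⟩
      · subst hhf
        rw [tensorFunctional_pullback_eq hcomm hh hf]
        exact norm_apply_le_of_mem_states hh _
      · rw [WeakDual.pullback_apply, lift_inr, hhb])
  exact (hsub hg).2 x

/-- Products of states are contractive for every `C*`-norm on the algebraic tensor product. -/
theorem norm_tensorFunctional_le (hcomm : ∀ a b, Commute (iA a) (iB b))
    (hinj : ∀ a b, iA a * iB b = 0 → a = 0 ∨ b = 0) {f : WeakDual ℂ (CStarUnitization A)}
    (hf : f ∈ states (CStarUnitization A)) {g : WeakDual ℂ (CStarUnitization B)}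
    (hg : g ∈ states (CStarUnitization B)) (x : A ⊗[ℂ] B) :
    ‖tensorFunctional f g x‖ ≤ ‖productMap iA iB x‖ := by
  have hKcl : IsClosed {f : WeakDual ℂ (CStarUnitization A) |
      ‖tensorFunctional f g x‖ ≤ ‖productMap iA iB x‖} := isClosed_le
    ((continuous_tensorFunctional x).comp (Continuous.prodMk_left g)).norm continuous_const
  have hKconv : Convex ℝ {f : WeakDual ℂ (CStarUnitization A) |
      ‖tensorFunctional f g x‖ ≤ ‖productMap iA iB x‖} := by
    intro f hf k hk s t hs ht hst
    change ‖tensorFunctional (s • f + t • k) g x‖ ≤ _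
    rw [tensorFunctional_add_smul_left]
    exact norm_convex_combination_le hs ht hst hf hk
  -- Krein–Milman in the first variable; the bound is a closed convex condition on `f`.
  have hKM := WeakDual.closure_convexHull_extremePoints (convex_states (A := CStarUnitization A))
    isCompact_states
  have hsub : convexHull ℝ ((states (CStarUnitization A)).extremePoints ℝ) ⊆
      {f : WeakDual ℂ (CStarUnitization A) |
        ‖tensorFunctional f g x‖ ≤ ‖productMap iA iB x‖} :=
    convexHull_min (fun f hf => norm_tensorFunctional_le_of_extreme hcomm hinj hf hg x) hKconv
  rw [← hKM] at hf
  exact closure_minimal hsub hKcl hf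

end Takesaki

/-! ## Positive matrices over a `C*`-algebra -/

/-- The Jordan decomposition, phrased by squares so that no order on the algebra enters the
statement. -/
theorem IsSelfAdjoint.exists_eq_sub {R : Type*} [NonUnitalCStarAlgebra R] {T : R}
    (hT : IsSelfAdjoint T) : ∃ P N : R, T = star P * P - star N * N ∧
      star N * N * (star P * P) = 0 := by
  let _ := CStarAlgebra.spectralOrder R
  have := CStarAlgebra.spectralOrderedRing R
  obtain ⟨P, hP⟩ := exists_star_mul_self_of_nonneg (CFC.posPart_nonneg T)
  obtain ⟨N, hN⟩ := exists_star_mul_self_of_nonneg (CFC.negPart_nonneg T)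
  refine ⟨P, N, ?_, ?_⟩
  · rw [← hP, ← hN, CFC.posPart_sub_negPart T hT]
  · rw [← hP, ← hN, CFC.negPart_mul_posPart]

/-- Let `N` be the negative part of `T`. Then `NTN = -N³`. The hypothesis, tested on the columns of
`N`, makes the diagonal entries of `NTN` positive, while those of `N³` are positive too; this forces
`N = 0`, so `T` is a square in the matrix algebra. -/
theorem CStarMatrix.exists_star_mul_self {R : Type*} [NonUnitalCStarAlgebra R] {ι : Type*}
    [Fintype ι] (T : ι → ι → R) (hT : ∀ i j, star (T i j) = T j i)
    (hpos : ∀ v : ι → R, ∃ d, ∑ i, ∑ j, star (v i) * T i j * v j = star d * d) :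
    ∃ S : ι → ι → R, ∀ i j, T i j = ∑ k, star (S k i) * S k j := by
  let _ := CStarAlgebra.spectralOrder R
  have := CStarAlgebra.spectralOrderedRing R
  let T' : CStarMatrix ι ι R := CStarMatrix.ofMatrix T
  have hsa : IsSelfAdjoint T' := by
    refine CStarMatrix.ext fun i j => ?_
    rw [CStarMatrix.star_apply]
    exact hT j i
  obtain ⟨P, Q, hT', hPQ⟩ := hsa.exists_eq_sub
  set N := star Q * Q with hQ
  set Z := Q * N with hZ
  have hNsa : star N = N := (IsSelfAdjoint.star_mul_self Q).star_eq
  have hZZ : star Z * Z = N * N * N := by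
    rw [hZ, star_mul, hNsa, mul_assoc, ← mul_assoc (star Q), ← hQ, ← mul_assoc]
  have hNTN : N * T' * N = -(star Z * Z) := by
    rw [hZZ]
    rw [hT', mul_sub, hPQ, zero_sub, neg_mul]
  -- `N³ = Z*Z`, so its diagonal entries are sums of squares of the entries of `Z` in a column.
  -- Being of both signs they vanish, and with them every entry.
  have hZ0 : Z = 0 := by
    refine CStarMatrix.ext fun i k => ?_
    obtain ⟨d, hd⟩ := hpos fun i => N i k
    have h1 : ∑ i, ∑ j, star (N i k) * T i j * N j k = (N * T' * N) k k := by
      rw [CStarMatrix.mul_apply, Finset.sum_comm]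
      refine Finset.sum_congr rfl fun j _ => ?_
      rw [CStarMatrix.mul_apply, Finset.sum_mul]
      refine Finset.sum_congr rfl fun i _ => ?_
      rw [← CStarMatrix.star_apply, hNsa]
      rfl
    have h2 : (star Z * Z) k k = ∑ i, star (Z i k) * Z i k := by
      rw [CStarMatrix.mul_apply]
      exact Finset.sum_congr rfl fun i _ => by rw [CStarMatrix.star_apply]
    have h3 : ∑ i, star (Z i k) * Z i k = 0 := by
      refine le_antisymm ?_ (Finset.sum_nonneg fun i _ => star_mul_self_nonneg _)
      rw [← h2, ← neg_nonneg]
      have : -(star Z * Z) k k = star d * d := by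
        rw [← hd, h1, hNTN]; rfl
      rw [this]
      exact star_mul_self_nonneg d
    have h4 := (Finset.sum_eq_zero_iff_of_nonneg fun i _ => star_mul_self_nonneg (Z i k)).mp h3 i
      (Finset.mem_univ i)
    exact CStarRing.star_mul_self_eq_zero_iff _ |>.mp h4
  have hN' : N = 0 := by
    have h3 : N * N * N = 0 := by rw [← hZZ, hZ0, mul_zero]
    have h2 : N * N = 0 := by
      rw [← CStarRing.star_mul_self_eq_zero_iff, star_mul, hNsa, ← mul_assoc, h3, zero_mul]
    rw [← CStarRing.star_mul_self_eq_zero_iff, hNsa, h2]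
  refine ⟨P, fun i j => ?_⟩
  change T' i j = _
  rw [hT', hN', sub_zero, CStarMatrix.mul_apply]
  exact Finset.sum_congr rfl fun k _ => by rw [CStarMatrix.star_apply]

/-! ## The unit fiber acting on the fibers -/

namespace StarAlgBundle

section Inner

variable {G : Type*} [Group G] (D : StarAlgBundle G) {t : G}

/-- The inner product `x* y` of two elements of a fiber, with values in the unit fiber. -/
def ip (x y : D.fiber t) : D.UnitFiber := D.mul (inv_mul_cancel t) (D.inv rfl x) y

/-- The left action of the unit fiber. -/
def lact (z : D.UnitFiber) : D.fiber t →ₗ[ℂ] D.fiber t := D.mul (one_mul t) z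

/-- The right action of the unit fiber. -/
def ract (y : D.fiber t) (z : D.UnitFiber) : D.fiber t := D.mul (mul_one t) y z

theorem ip_self (x : D.fiber t) : D.ip x x = D.invMulSelf x := rfl

theorem ip_add_left (x x' y : D.fiber t) : D.ip (x + x') y = D.ip x y + D.ip x' y :=
  (congrArg (fun w => D.mul (inv_mul_cancel t) w y) (map_add _ x x')).trans
    (LinearMap.map_add₂ _ _ _ _)

theorem ip_add_right (x y y' : D.fiber t) : D.ip x (y + y') = D.ip x y + D.ip x y' :=
  map_add _ _ _

theorem ip_smul_left (c : ℂ) (x y : D.fiber t) : D.ip (c • x) y = conj c • D.ip x y :=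
  (congrArg (fun w => D.mul (inv_mul_cancel t) w y) (map_smulₛₗ _ c x)).trans
    (LinearMap.map_smul₂ _ _ _ _)

theorem ip_smul_right (c : ℂ) (x y : D.fiber t) : D.ip x (c • y) = c • D.ip x y :=
  map_smul _ _ _

theorem ip_zero_left (y : D.fiber t) : D.ip 0 y = 0 :=
  (congrArg (fun w => D.mul (inv_mul_cancel t) w y) (map_zero _)).trans
    (LinearMap.map_zero₂ _ _)

theorem ip_zero_right (x : D.fiber t) : D.ip x 0 = 0 := map_zero _

theorem ip_sum_left {ι : Type*} (s : Finset ι) (x : ι → D.fiber t) (y : D.fiber t) :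
    D.ip (∑ i ∈ s, x i) y = ∑ i ∈ s, D.ip (x i) y := by
  classical
  induction s using Finset.induction_on with
  | empty => simp [ip_zero_left]
  | insert a s ha ih => rw [Finset.sum_insert ha, Finset.sum_insert ha, ip_add_left, ih]

theorem ip_sum_right {ι : Type*} (s : Finset ι) (x : D.fiber t) (y : ι → D.fiber t) :
    D.ip x (∑ i ∈ s, y i) = ∑ i ∈ s, D.ip x (y i) := by
  classical
  induction s using Finset.induction_on with
  | empty => simp [ip_zero_right]
  | insert a s ha ih => rw [Finset.sum_insert ha, Finset.sum_insert ha, ip_add_right, ih]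

theorem star_ip (x y : D.fiber t) : star (D.ip x y) = D.ip y x :=
  (D.inv_mul (inv_mul_cancel t) (_root_.inv_inv t) rfl inv_one (inv_mul_cancel t)
    (D.inv rfl x) y).trans
    (congrArg (fun w => D.mul (inv_mul_cancel t) (D.inv rfl y) w) (D.inv_inv rfl _ x))

theorem ip_lact_left (z : D.UnitFiber) (x y : D.fiber t) :
    D.ip (D.lact z x) y = D.ip x (D.lact (star z) y) :=
  (congrArg (fun w => D.mul (inv_mul_cancel t) w y)
    (D.inv_mul (one_mul t) inv_one rfl rfl (mul_one _) z x)).trans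
    (D.mul_assoc (mul_one _) (inv_mul_cancel t) (one_mul t) (inv_mul_cancel t) _ _ _)

theorem ip_ract_right (x y : D.fiber t) (z : D.UnitFiber) :
    D.ip x (D.ract y z) = D.ip x y * z :=
  (D.mul_assoc (inv_mul_cancel t) (mul_one 1) (mul_one t) (inv_mul_cancel t) _ _ _).symm

theorem ip_ract_left (x y : D.fiber t) (z : D.UnitFiber) :
    D.ip (D.ract x z) y = star z * D.ip x y := by
  rw [← star_ip, ip_ract_right, star_mul, star_ip]

theorem lact_mul (z w : D.UnitFiber) (y : D.fiber t) :
    D.lact (z * w) y = D.lact z (D.lact w y) :=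
  D.mul_assoc (mul_one 1) (one_mul t) (one_mul t) (one_mul t) _ _ _

theorem lact_add (z w : D.UnitFiber) (y : D.fiber t) :
    D.lact (z + w) y = D.lact z y + D.lact w y :=
  LinearMap.map_add₂ (D.mul (one_mul t)) z w y

theorem lact_smul (c : ℂ) (z : D.UnitFiber) (y : D.fiber t) :
    D.lact (c • z) y = c • D.lact z y :=
  LinearMap.map_smul₂ (D.mul (one_mul t)) c z y

theorem lact_ract (z : D.UnitFiber) (y : D.fiber t) (w : D.UnitFiber) :
    D.lact z (D.ract y w) = D.ract (D.lact z y) w :=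
  (D.mul_assoc (one_mul t) (mul_one t) (mul_one t) (one_mul t) _ _ _).symm

theorem ip_unit (z w : D.UnitFiber) : D.ip (t := 1) z w = star z * w := by
  have key : ∀ (u : G) (h : (1 : G)⁻¹ = u) (h' : u * 1 = 1),
      D.mul h' (D.inv h z) w = D.mul (inv_mul_cancel 1) (D.inv rfl z) w := by
    rintro _ rfl h'; rfl
  exact (key 1 inv_one (mul_one 1)).symm

theorem lact_unit (z w : D.UnitFiber) : D.lact (t := 1) z w = z * w := rfl

/-- `(xy)*(x'y') = y*(x*x')y'`. This reduces the norm of a product to the action of the unit fiber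
on one fiber. -/
theorem ip_mul_mul {s t r : G} (h : s * t = r) (x x' : D.fiber s) (y y' : D.fiber t) :
    D.ip (D.mul h x y) (D.mul h x' y') = D.ip y (D.lact (D.ip x x') y') := by
  subst h
  change D.mul _ (D.inv rfl (D.mul rfl x y)) (D.mul rfl x' y') =
    D.mul _ (D.inv rfl y) (D.mul _ (D.mul _ (D.inv rfl x) x') y')
  rw [D.inv_mul rfl rfl rfl rfl (mul_inv_rev s t).symm,
    D.mul_assoc (mul_inv_rev s t).symm (inv_mul_cancel _) (inv_mul_cancel_left s t)
      (inv_mul_cancel t), D.mul_assoc (inv_mul_cancel s) (one_mul t) rfl (inv_mul_cancel_left s t)]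

end Inner

end StarAlgBundle

/-! ## The unit fiber of a Fell bundle -/

namespace FellBundle

variable {G : Type*} [Group G] (A : FellBundle G)

instance : NormedAddCommGroup A.toBundle.UnitFiber :=
  inferInstanceAs (NormedAddCommGroup (A.cstarNorm.Fiber 1))

instance : NonUnitalNormedRing A.toBundle.UnitFiber :=
  { (inferInstance : NonUnitalRing A.toBundle.UnitFiber),
    (inferInstance : NormedAddCommGroup A.toBundle.UnitFiber) with
    norm_mul_le := fun a b => A.cstarNorm.mul_le (mul_one 1) a b }

instance : NonUnitalCStarAlgebra A.toBundle.UnitFiber :=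
  { (inferInstance : NonUnitalNormedRing A.toBundle.UnitFiber),
    (inferInstance : StarRing A.toBundle.UnitFiber),
    (inferInstance : Module ℂ A.toBundle.UnitFiber),
    (inferInstance : StarModule ℂ A.toBundle.UnitFiber),
    (inferInstance : IsScalarTower ℂ A.toBundle.UnitFiber A.toBundle.UnitFiber),
    (inferInstance : SMulCommClass ℂ A.toBundle.UnitFiber A.toBundle.UnitFiber) with
    complete := (A.complete 1).complete
    norm_mul_self_le := fun a => by
      have h2 := A.cstarNorm.invMulSelf (t := 1) a
      have h1 : star a * a = A.toBundle.invMulSelf a :=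
        A.toBundle.invMulSelf_eq inv_one (mul_one 1) a
      rw [sq, ← h1] at h2
      exact h2.ge
    norm_smul_le := fun c a => norm_smul_le (β := A.cstarNorm.Fiber 1) c a }

/-- The square root granted by the positivity axiom lies in the completion of the unit fiber, which
is the unit fiber itself by completeness. -/
theorem exists_ip_self_eq {t : G} (a : A.toBundle.fiber t) :
    ∃ c : A.toBundle.UnitFiber, A.toBundle.ip a a = star c * c := by
  obtain ⟨c, hc⟩ := A.cstarNorm.invMulSelf_nonneg a
  have := A.complete 1
  obtain ⟨c', hc'⟩ : ∃ c' : A.toBundle.fiber 1, A.cstarNorm.toCompl 1 c' = c := by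
    have h1 := (UniformSpace.Completion.isUniformInducing_coe
      (A.cstarNorm.Fiber 1)).isComplete_range.isClosed.closure_eq
    rw [UniformSpace.Completion.denseRange_coe.closure_range] at h1
    obtain ⟨c', h⟩ := (h1 ▸ Set.mem_univ c : c ∈ Set.range _)
    exact ⟨c', h⟩
  rw [← hc', A.cstarNorm.complBundle_invMulSelf_toCompl] at hc
  refine ⟨c', ?_⟩
  refine Eq.trans ?_ (A.toBundle.ip_unit c' c')
  have hinj : Function.Injective (A.cstarNorm.toCompl 1) :=
    UniformSpace.Completion.coe_injective (A.cstarNorm.Fiber 1)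
  exact hinj hc

/-- Matrices of inner products are positive. -/
theorem exists_ip_eq_sum {t : G} {ι : Type*} [Fintype ι] (x : ι → A.toBundle.fiber t) :
    ∃ S : ι → ι → A.toBundle.UnitFiber,
      ∀ i j, A.toBundle.ip (x i) (x j) = ∑ k, star (S k i) * S k j := by
  refine CStarMatrix.exists_star_mul_self _ (fun i j => A.toBundle.star_ip _ _) fun v => ?_
  -- `Σ v_i* ⟨x_i, x_j⟩ v_j` is the inner square of `Σ x_i v_i`, hence positive.
  obtain ⟨d, hd⟩ := A.exists_ip_self_eq (∑ i, A.toBundle.ract (x i) (v i))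
  refine ⟨d, ?_⟩
  rw [← hd, A.toBundle.ip_sum_left]
  refine Finset.sum_congr rfl fun i _ => ?_
  rw [A.toBundle.ip_sum_right]
  refine Finset.sum_congr rfl fun j _ => ?_
  rw [A.toBundle.ip_ract_right, A.toBundle.ip_ract_left]

theorem eq_zero_of_ip_self_eq_zero {t : G} {a : A.toBundle.fiber t}
    (h : A.toBundle.ip a a = 0) : a = 0 := by
  have h2 := A.cstarNorm.invMulSelf a
  rw [← A.toBundle.ip_self, h] at h2
  refine A.cstarNorm.eq_zero a ?_
  have h3 : A.cstarNorm.seminorm t a ^ 2 = 0 := h2.symm.trans (map_zero _)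
  exact pow_eq_zero_iff two_ne_zero |>.mp h3

end FellBundle

/-! ## Algebraic tensor products -/

namespace StarAlgBundle

variable {G H : Type*} [Group G] [Group H] {A : StarAlgBundle G} {B : StarAlgBundle H}

/-- Elementary tensors in the algebraic tensor product. -/
def tm {t : G × H} (a : A.fiber t.1) (b : B.fiber t.2) : (A.tensor B).fiber t := a ⊗ₜ[ℂ] b

/-- Elementary tensors in the unit fiber of the algebraic tensor product, as a bilinear map. -/
def utm : A.UnitFiber →ₗ[ℂ] B.UnitFiber →ₗ[ℂ] (A.tensor B).UnitFiber :=
  TensorProduct.mk ℂ (A.fiber 1) (B.fiber 1)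

/-- The unit fiber of the tensor product is the tensor product of the unit fibers. -/
def unitEquiv (A : StarAlgBundle G) (B : StarAlgBundle H) :
    (A.tensor B).UnitFiber ≃ₗ[ℂ] A.UnitFiber ⊗[ℂ] B.UnitFiber :=
  LinearEquiv.refl ℂ (A.fiber 1 ⊗[ℂ] B.fiber 1)

@[simp] theorem unitEquiv_utm (a : A.UnitFiber) (b : B.UnitFiber) :
    unitEquiv A B (utm a b) = a ⊗ₜ[ℂ] b := rfl

theorem unit_induction {p : (A.tensor B).UnitFiber → Prop} (x : (A.tensor B).UnitFiber)
    (h0 : p 0) (h1 : ∀ a b, p (utm a b)) (h2 : ∀ x y, p x → p y → p (x + y)) : p x :=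
  TensorProduct.induction_on (R := ℂ) (M := A.fiber 1) (N := B.fiber 1) (motive := p) x h0 h1 h2

theorem ip_tm {t : G × H} (a a' : A.fiber t.1) (b b' : B.fiber t.2) :
    (A.tensor B).ip (tm a b) (tm a' b') = utm (A.ip a a') (B.ip b b') := rfl

theorem utm_mul (a a' : A.UnitFiber) (b b' : B.UnitFiber) :
    utm a b * utm a' b' = utm (a * a') (b * b') := rfl

theorem star_utm (a : A.UnitFiber) (b : B.UnitFiber) :
    star (utm a b) = utm (star a) (star b) := rfl

theorem lact_utm_tm {t : G × H} (a : A.UnitFiber) (b : B.UnitFiber) (x : A.fiber t.1)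
    (y : B.fiber t.2) : (A.tensor B).lact (utm a b) (tm x y) = tm (A.lact a x) (B.lact b y) := rfl

theorem exists_eq_sum_tm {t : G × H} (x : (A.tensor B).fiber t) :
    ∃ S : Finset (A.fiber t.1 × B.fiber t.2), x = ∑ i : S, tm i.1.1 i.1.2 := by
  obtain ⟨S, hS⟩ := TensorProduct.exists_finset x
  refine ⟨S, ?_⟩
  rw [hS]
  exact (Finset.sum_coe_sort S fun i => i.1 ⊗ₜ[ℂ] i.2).symm

end StarAlgBundle

namespace FellBundle

open StarAlgBundle

variable {G H : Type*} [Group G] [Group H] (A : FellBundle G) (B : FellBundle H)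

/-- The inner squares of elements of the algebraic tensor product are sums of squares. -/
theorem exists_ip_self_eq_sum {t : G × H} (x : (A.toBundle.tensor B.toBundle).fiber t) :
    ∃ (n : ℕ) (z : Fin n → (A.toBundle.tensor B.toBundle).UnitFiber),
      (A.toBundle.tensor B.toBundle).ip x x = ∑ k, star (z k) * z k := by
  obtain ⟨S, rfl⟩ := exists_eq_sum_tm x
  obtain ⟨c, hc⟩ := A.exists_ip_eq_sum fun i : S => i.1.1
  obtain ⟨d, hd⟩ := B.exists_ip_eq_sum fun i : S => i.1.2
  -- Expanding both matrices of inner products gives `x*x = Σ_{i,j} Σ_{k,l} c_ki* c_kj ⊗ d_li*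
  -- d_lj`; the terms with fixed `(k, l)` form the square of `Σ_i c_ki ⊗ d_li`.
  let z : S × S → (A.toBundle.tensor B.toBundle).UnitFiber :=
    fun p => ∑ i : S, utm (c p.1 i) (d p.2 i)
  have key : (A.toBundle.tensor B.toBundle).ip (∑ i : S, tm i.1.1 i.1.2) (∑ i : S, tm i.1.1 i.1.2)
      = ∑ p, star (z p) * z p := by
    rw [StarAlgBundle.ip_sum_left]
    have h1 : ∀ p, star (z p) * z p = ∑ i, ∑ j,
        utm (star (c p.1 i) * c p.1 j) (star (d p.2 i) * d p.2 j) := by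
      intro p
      rw [star_sum, Finset.sum_mul]
      refine Finset.sum_congr rfl fun i _ => ?_
      rw [Finset.mul_sum]
      rfl
    simp_rw [h1]
    rw [Finset.sum_comm]
    refine Finset.sum_congr rfl fun i _ => ?_
    rw [StarAlgBundle.ip_sum_right, Finset.sum_comm]
    refine Finset.sum_congr rfl fun j _ => ?_
    rw [ip_tm, hc, hd, Fintype.sum_prod_type]
    simp only [map_sum, LinearMap.sum_apply]
    rw [Finset.sum_comm]
  let e := Fintype.equivFin (S × S)
  refine ⟨Fintype.card (S × S), fun k => z (e.symm k), ?_⟩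
  rw [key]
  exact (Equiv.sum_comp e.symm fun p => star (z p) * z p).symm

end FellBundle

/-! ## Sums of squares -/

/-- The sums of squares `s* s` in a `*`-ring. -/
def sumSq (R : Type*) [NonUnitalRing R] [StarRing R] : AddSubmonoid R :=
  AddSubmonoid.closure (Set.range fun s : R => star s * s)

section SumSq

variable {R : Type*} [NonUnitalRing R] [StarRing R]

theorem star_mul_self_mem_sumSq (s : R) : star s * s ∈ sumSq R :=
  AddSubmonoid.subset_closure ⟨s, rfl⟩

theorem sumSq_star_eq {u : R} (hu : u ∈ sumSq R) : star u = u := by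
  induction hu using AddSubmonoid.closure_induction with
  | mem x hx => obtain ⟨s, rfl⟩ := hx; exact (IsSelfAdjoint.star_mul_self s).star_eq
  | zero => exact star_zero _
  | add x y _ _ hx hy => rw [star_add, hx, hy]

theorem map_mem_sumSq {S : Type*} [NonUnitalRing S] [StarRing S] [Module ℂ R] [Module ℂ S]
    (j : R →⋆ₙₐ[ℂ] S) {u : R} (hu : u ∈ sumSq R) : j u ∈ sumSq S := by
  induction hu using AddSubmonoid.closure_induction with
  | mem x hx =>
    obtain ⟨s, rfl⟩ := hx
    dsimp only
    rw [map_mul, map_star]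
    exact star_mul_self_mem_sumSq _
  | zero => rw [map_zero]; exact zero_mem _
  | add x y _ _ hx hy => rw [map_add]; exact add_mem hx hy

end SumSq

/-- The positive cone of a `C*`-algebra is closed under addition. Sums of squares serve as the
notion of positivity in the incomplete `*`-algebras, where this fails to be available. -/
theorem exists_star_mul_self_of_mem_sumSq {C : Type*} [NonUnitalCStarAlgebra C] {u : C}
    (hu : u ∈ sumSq C) : ∃ c, u = star c * c := by
  let _ := CStarAlgebra.spectralOrder C
  have := CStarAlgebra.spectralOrderedRing C
  refine exists_star_mul_self_of_nonneg ?_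
  induction hu using AddSubmonoid.closure_induction with
  | mem x hx => obtain ⟨s, rfl⟩ := hx; exact star_mul_self_nonneg s
  | zero => exact le_rfl
  | add x y _ _ hx hy => exact add_nonneg hx hy

theorem norm_le_norm_add_of_mem_sumSq {C : Type*} [NonUnitalCStarAlgebra C] {u v : C}
    (hu : u ∈ sumSq C) (hv : v ∈ sumSq C) : ‖u‖ ≤ ‖u + v‖ := by
  let _ := CStarAlgebra.spectralOrder C
  have := CStarAlgebra.spectralOrderedRing C
  obtain ⟨c, rfl⟩ := exists_star_mul_self_of_mem_sumSq hu
  obtain ⟨d, rfl⟩ := exists_star_mul_self_of_mem_sumSq hv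
  exact CStarAlgebra.norm_le_norm_of_nonneg_of_le (star_mul_self_nonneg c)
    (le_add_of_nonneg_right (star_mul_self_nonneg d))

theorem smul_sub_conj_mem_sumSq {C : Type*} [NonUnitalCStarAlgebra C] {a : C}
    (ha : star a = a) {r : ℝ} (hr : ‖a‖ ≤ r) (c : C) :
    (r : ℂ) • (star c * c) - star c * (a * c) ∈ sumSq C := by
  let _ := CStarAlgebra.spectralOrder C
  have := CStarAlgebra.spectralOrderedRing C
  have h1 : star c * a * c ≤ ‖a‖ • (star c * c) :=
    CStarAlgebra.star_left_conjugate_le_norm_smul (hb := ha)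
  have h2 : ‖a‖ • (star c * c) ≤ r • (star c * c) :=
    smul_le_smul_of_nonneg_right hr (star_mul_self_nonneg c)
  have h3 := sub_nonneg.mpr (h1.trans h2)
  obtain ⟨d, hd⟩ := exists_star_mul_self_of_nonneg h3
  rw [Complex.coe_smul, ← mul_assoc, hd]
  exact star_mul_self_mem_sumSq d

/-- In the unitization `‖a‖² - a*a = c*c` with `c = l + d`; these are the scalar and the algebra
component of that equation. The result is an algebraic certificate for `a*a ≤ ‖a‖²` that survives in
any `*`-representation, even one on a space without a norm. -/
theorem exists_star_mul_self_eq_norm_sq_sub {A : Type*} [NonUnitalCStarAlgebra A] (a : A) :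
    ∃ (l : ℂ) (d : A), conj l * l = (‖a‖ : ℂ) ^ 2 ∧
      conj l • d + l • star d + star d * d = -(star a * a) := by
  open CStarUnitization in
  let _ := CStarAlgebra.spectralOrder (CStarUnitization A)
  have := CStarAlgebra.spectralOrderedRing (CStarUnitization A)
  have h1 : (0 : CStarUnitization A) ≤
      algebraMap ℝ _ (‖inr a‖ ^ 2) - star (inr a) * inr a :=
    sub_nonneg.mpr CStarAlgebra.star_mul_le_algebraMap_norm_sq
  obtain ⟨c, hc⟩ := exists_star_mul_self_of_nonneg h1
  rw [norm_inr, Algebra.algebraMap_eq_smul_one, ← Complex.coe_smul] at hc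
  have h2 := congrArg scalar hc
  rw [map_sub, map_smul, map_mul, map_mul, map_star, map_star, map_one, scalar_inr] at h2
  have h3 : conj (scalar c) * scalar c = (‖a‖ : ℂ) ^ 2 := by
    simpa using h2.symm
  refine ⟨scalar c, c.snd, h3, ?_⟩
  have hinj : Function.Injective (inr : A → CStarUnitization A) := by
    intro x y hxy
    rw [← sub_eq_zero, ← norm_eq_zero, ← norm_inr, map_sub, hxy, sub_self, norm_zero]
  apply hinj
  have h4 := eq_smul_one_add_inr c
  have h5 : star c * c = (conj (scalar c) * scalar c) • 1 +
      inr (conj (scalar c) • c.snd + scalar c • star c.snd + star c.snd * c.snd) := by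
    conv_lhs => rw [h4]
    rw [star_add, star_smul, star_one, map_add, map_add, map_mul, map_smul, map_smul,
      add_mul, mul_add, mul_add, smul_mul_smul_comm, one_mul, smul_one_mul, mul_smul_one]
    simp only [RCLike.star_def, map_star]
    abel
  rw [h5, h3] at hc
  have h6 : ((‖a‖ ^ 2 : ℝ) : ℂ) = (‖a‖ : ℂ) ^ 2 := by push_cast; rfl
  rw [h6, sub_eq_add_neg] at hc
  rw [← add_left_cancel hc, map_neg, map_mul, map_star]

/-! ## `C*`-norms on the unit fiber -/

namespace BundleNorm

variable {K : Type*} [Group K] {D : StarAlgBundle K}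

/-- The inclusion of the unit fiber in its completion, as a `*`-homomorphism. -/
def unitHom (N : BundleNorm D) : D.UnitFiber →⋆ₙₐ[ℂ] N.complBundle.UnitFiber where
  toFun x := N.toCompl 1 x
  map_smul' c x := map_smul (N.toCompl 1) c x
  map_zero' := map_zero (N.toCompl 1)
  map_add' := map_add (N.toCompl 1)
  map_mul' x y := (N.mulC_toCompl (mul_one 1) x y).symm
  map_star' x := (N.invC_toCompl inv_one x).symm

theorem norm_unitHom (N : BundleNorm D) (x : D.UnitFiber) : ‖N.unitHom x‖ = N.seminorm 1 x :=
  N.norm_toCompl (t := 1) x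

end BundleNorm

namespace StarAlgBundle

universe w

variable {K : Type*} [Group K] (D : StarAlgBundle.{w} K)

/-- The unit fiber as a bundle over the trivial group. -/
def unitBundle : StarAlgBundle Unit where
  fiber _ := D.UnitFiber
  mul _ := LinearMap.mul ℂ D.UnitFiber
  inv _ := (starLinearEquiv ℂ : D.UnitFiber ≃ₗ⋆[ℂ] D.UnitFiber).toLinearMap
  mul_assoc _ _ _ _ a b c := _root_.mul_assoc (G := D.UnitFiber) a b c
  inv_mul _ _ _ _ _ a b := star_mul (R := D.UnitFiber) a b
  inv_inv _ _ a := star_star (R := D.UnitFiber) a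

variable {D}

/-- The completion of bundles, applied over the trivial group, embeds the unit fiber isometrically
in a `C*`-algebra, where order arguments are available. -/
theorem exists_completion {p : Seminorm ℂ D.UnitFiber} (hp : D.IsCStarSeminorm p)
    (hp0 : ∀ x, p x = 0 → x = 0) :
    ∃ (C : Type w) (_ : NonUnitalCStarAlgebra C) (j : D.UnitFiber →⋆ₙₐ[ℂ] C),
      ∀ x, ‖j x‖ = p x := by
  let N : BundleNorm D.unitBundle :=
    { seminorm := fun _ => p
      eq_zero := fun a h => hp0 a h
      mul_le := fun _ a b => hp.mul_le a b
      invMulSelf := fun a => hp.star_mul_self a }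
  exact ⟨N.complBundle.UnitFiber, inferInstance, N.unitHom, N.norm_unitHom⟩

namespace IsCStarSeminorm

variable {p : Seminorm ℂ D.UnitFiber} (hp : D.IsCStarSeminorm p)
include hp

theorem star_eq (x : D.UnitFiber) : p (star x) = p x := by
  have key : ∀ x, p x ≤ p (star x) := by
    intro x
    rcases (apply_nonneg p x).eq_or_lt with h | h
    · rw [← h]; exact apply_nonneg _ _
    · have := hp.mul_le (star x) x
      rw [hp.star_mul_self, sq] at this
      exact le_of_mul_le_mul_right this h
  exact le_antisymm ((key _).trans_eq (by rw [star_star])) (key x)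

variable (hp0 : ∀ x, p x = 0 → x = 0)
include hp0

theorem le_add {u v : D.UnitFiber} (hu : u ∈ sumSq D.UnitFiber) (hv : v ∈ sumSq D.UnitFiber) :
    p u ≤ p (u + v) := by
  obtain ⟨C, _, j, hj⟩ := exists_completion hp hp0
  rw [← hj, ← hj, map_add]
  exact norm_le_norm_add_of_mem_sumSq (map_mem_sumSq j hu) (map_mem_sumSq j hv)

variable (hS : ∀ {t : K} (x : D.fiber t), D.ip x x ∈ sumSq D.UnitFiber) {t : K}
include hS

/-- Cauchy–Schwarz for modules. With `a = ⟨x, x⟩`, `b = ⟨y, y⟩`, `c = ⟨x, y⟩`, expanding the inner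
square of `xc - ry` gives `c*ac + r²b - 2r c*c ≥ 0`. For `r ≥ p(a)` also `c*ac ≤ r c*c`, hence `r
c*c ≤ r²b`, and the norm of this is the claim. -/
theorem ip_sq_le (x y : D.fiber t) : p (D.ip x y) ^ 2 ≤ p (D.ip x x) * p (D.ip y y) := by
  obtain ⟨C, _, j, hj⟩ := exists_completion hp hp0
  -- The proof divides by `r`, so `p(a)` is approached from above to include `p(a) = 0`.
  have key : ∀ r : ℝ, 0 < r → p (D.ip x x) ≤ r → p (D.ip x y) ^ 2 ≤ r * p (D.ip y y) := by
    intro r hr hxr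
    set c := D.ip x y with hc
    set a := D.ip x x with ha
    set b := D.ip y y with hb
    have h1 := hS (D.ract x c + (-(r : ℂ)) • y)
    have h2 : D.ip (D.ract x c + (-(r : ℂ)) • y) (D.ract x c + (-(r : ℂ)) • y) =
        star c * (a * c) + ((r : ℂ) ^ 2 • b - (2 * r : ℂ) • (star c * c)) := by
      rw [ip_add_left, ip_add_right, ip_add_right, ip_smul_left, ip_smul_left, ip_smul_right,
        ip_smul_right, ip_ract_left, ip_ract_right, ip_ract_right, ip_ract_left, ← D.star_ip x y,
        ← hc, ← ha, ← hb, smul_smul]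
      simp only [map_neg, Complex.conj_ofReal]
      module
    rw [h2] at h1
    have h3 := map_mem_sumSq j h1
    have h4 : star a = a := D.star_ip x x
    have h5 := smul_sub_conj_mem_sumSq (a := j a) (by rw [← map_star, h4])
      ((hj a).trans_le hxr) (j c)
    have h6 := add_mem h3 h5
    have h7 : (r : ℂ) • (star (j c) * j c) ∈ sumSq C := by
      obtain ⟨d, hd⟩ := exists_star_mul_self_of_mem_sumSq
        (star_mul_self_mem_sumSq ((Real.sqrt r : ℂ) • j c))
      have : (r : ℂ) • (star (j c) * j c) =
          star ((Real.sqrt r : ℂ) • j c) * ((Real.sqrt r : ℂ) • j c) := by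
        rw [star_smul, smul_mul_smul_comm, RCLike.star_def, Complex.conj_ofReal,
          ← Complex.ofReal_mul, Real.mul_self_sqrt hr.le]
      rw [this]
      exact star_mul_self_mem_sumSq _
    have h8 := norm_le_norm_add_of_mem_sumSq h7 h6
    have h9 : (r : ℂ) • (star (j c) * j c) + (j (star c * (a * c) + ((r : ℂ) ^ 2 • b -
        (2 * r : ℂ) • (star c * c))) + ((r : ℂ) • (star (j c) * j c) - star (j c) * (j a * j c)))
        = (r : ℂ) ^ 2 • j b := by
      simp only [map_add, map_sub, map_smul, map_mul, map_star]
      module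
    rw [h9, norm_smul, norm_smul, CStarRing.norm_star_mul_self, hj, hj, norm_pow,
      Complex.norm_real, Real.norm_of_nonneg hr.le] at h8
    have h10 : r * (p c * p c) ≤ r * (r * p b) := by nlinarith
    rw [sq]
    exact le_of_mul_le_mul_left h10 hr
  refine le_of_forall_pos_le_add fun ε hε => ?_
  have hb : 0 ≤ p (D.ip y y) := apply_nonneg _ _
  have ha : 0 ≤ p (D.ip x x) := apply_nonneg _ _
  have hδ : 0 < ε / (p (D.ip y y) + 1) := by positivity
  refine (key (p (D.ip x x) + ε / (p (D.ip y y) + 1)) (by linarith) (by linarith)).trans ?_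
  rw [add_mul]
  have : ε / (p (D.ip y y) + 1) * p (D.ip y y) ≤ ε := by
    rw [div_mul_eq_mul_div, div_le_iff₀ (by linarith)]
    nlinarith
  linarith

omit hp hp0 hS

end IsCStarSeminorm

end StarAlgBundle

/-! ## Norms on the fibers from a norm on the unit fiber -/

namespace StarAlgBundle

universe w

variable {K : Type*} [Group K] {D : StarAlgBundle.{w} K}

theorem ip_smul_smul {t : K} (c : ℂ) (x : D.fiber t) :
    D.ip (c • x) (c • x) = (conj c * c) • D.ip x x := by
  rw [ip_smul_left, ip_smul_right, smul_smul]

namespace IsCStarSeminorm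

variable {p : Seminorm ℂ D.UnitFiber} (hp : D.IsCStarSeminorm p) (hp0 : ∀ x, p x = 0 → x = 0)
  (hS : ∀ {t : K} (x : D.fiber t), D.ip x x ∈ sumSq D.UnitFiber) {t : K}
include hp hp0 hS

theorem norm_ip_le (x y : D.fiber t) :
    p (D.ip x y) ≤ √(p (D.ip x x)) * √(p (D.ip y y)) := by
  rw [← Real.sqrt_mul (apply_nonneg _ _)]
  exact Real.le_sqrt_of_sq_le (hp.ip_sq_le hp0 hS x y)

/-- The seminorm on a fiber given by the inner product and a `C*`-norm on the unit fiber. -/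
def ipSeminorm (t : K) : Seminorm ℂ (D.fiber t) :=
  Seminorm.of (fun x => √(p (D.ip x x)))
    (fun x y => by
      have h1 := hp.norm_ip_le hp0 hS x y
      have h2 : p (D.ip y x) = p (D.ip x y) := by rw [← D.star_ip, hp.star_eq]
      have hx := Real.sq_sqrt (apply_nonneg p (D.ip x x))
      have hy := Real.sq_sqrt (apply_nonneg p (D.ip y y))
      refine Real.sqrt_le_iff.mpr ⟨by positivity, ?_⟩
      rw [ip_add_left, ip_add_right, ip_add_right]
      have h3 := map_add_le_add p (D.ip x x + D.ip x y) (D.ip y x + D.ip y y)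
      have h4 := map_add_le_add p (D.ip x x) (D.ip x y)
      have h5 := map_add_le_add p (D.ip y x) (D.ip y y)
      nlinarith)
    (fun c x => by
      have : ‖conj c * c‖ = ‖c‖ ^ 2 := by rw [norm_mul, RCLike.norm_conj, sq]
      rw [ip_smul_smul, map_smul_eq_mul, this, Real.sqrt_mul (by positivity),
        Real.sqrt_sq (norm_nonneg c)])

theorem ipSeminorm_apply (x : D.fiber t) : hp.ipSeminorm hp0 hS t x = √(p (D.ip x x)) := rfl

theorem ipSeminorm_sq (x : D.fiber t) : hp.ipSeminorm hp0 hS t x ^ 2 = p (D.ip x x) :=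
  Real.sq_sqrt (apply_nonneg p _)

theorem ipSeminorm_unit (x : D.UnitFiber) : hp.ipSeminorm hp0 hS 1 x = p x := by
  refine (congrArg (fun w => √(p w)) (D.ip_unit x x)).trans ?_
  rw [hp.star_mul_self, Real.sqrt_sq (apply_nonneg _ _)]

variable (hD : ∀ {t : K} (x : D.fiber t), D.ip x x = 0 → x = 0)
  (hinv : ∀ {t : K} (z : D.UnitFiber) (y : D.fiber t),
    hp.ipSeminorm hp0 hS t (D.lact z y) ≤ p z * hp.ipSeminorm hp0 hS t y)
include hD hinv

/-- The `C*`-norm on a bundle with a given restriction to the unit fiber. -/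
def extend : CStarNorm D :=
  let N : BundleNorm D :=
    { seminorm := hp.ipSeminorm hp0 hS
      eq_zero := fun x hx => hD x <| hp0 _ <| by
        rw [← hp.ipSeminorm_sq hp0 hS, hx, zero_pow two_ne_zero]
      mul_le := fun {s t r} h x y => by
        -- `‖xy‖² = p(⟨y, ⟨x, x⟩y⟩) ≤ ‖y‖ ‖⟨x, x⟩y‖ ≤ ‖y‖ p(⟨x, x⟩) ‖y‖ = ‖x‖²‖y‖²`.
        refine le_of_sq_le_sq ?_ (mul_nonneg (apply_nonneg _ _) (apply_nonneg _ _))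
        rw [hp.ipSeminorm_sq, ip_mul_mul]
        refine (hp.norm_ip_le hp0 hS _ _).trans ?_
        have h1 := hinv (D.ip x x) y
        rw [← hp.ipSeminorm_sq hp0 hS x] at h1
        have h2 : 0 ≤ hp.ipSeminorm hp0 hS t y := apply_nonneg _ _
        have h3 := mul_le_mul_of_nonneg_left h1 h2
        calc _ ≤ _ := h3
          _ = _ := by ring
      invMulSelf := fun {t} x => by
        rw [hp.ipSeminorm_sq]
        exact hp.ipSeminorm_unit hp0 hS (D.ip x x) }
  { N with
    invMulSelf_nonneg := fun {t} x => by
      -- `x*x` is only a sum of squares in the unit fiber; in the `C*`-completion it becomes a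
      -- single square.
      obtain ⟨c, hc⟩ := exists_star_mul_self_of_mem_sumSq (map_mem_sumSq N.unitHom (hS x))
      exact ⟨c, hc.trans (N.complBundle.invMulSelf_eq inv_one (mul_one 1) c)⟩ }

theorem extend_seminorm_one (x : D.UnitFiber) :
    (hp.extend hp0 hS hD hinv).seminorm 1 x = p x := hp.ipSeminorm_unit hp0 hS x

end IsCStarSeminorm

/-! ## Actions of `C*`-algebras on the fibers -/

/-- A `*`-representation of a `C*`-algebra on a fiber by operators that are adjointable for the
inner product with values in the unit fiber. -/
structure IsAdjointable {R : Type*} [NonUnitalCStarAlgebra R] {t : K}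
    (L : R →ₗ[ℂ] D.fiber t →ₗ[ℂ] D.fiber t) : Prop where
  map_mul : ∀ a b x, L (a * b) x = L a (L b x)
  ip_left : ∀ a x y, D.ip (L a x) y = D.ip x (L (star a) y)

/-- With `‖a‖² - a*a = c*c` and `c = l + d` in the unitization, the element `y'` is `c` applied to
`y`. Thus `⟨ay, ay⟩ ≤ ‖a‖²⟨y, y⟩` holds algebraically, and adjointable actions of `C*`-algebras are
bounded for every norm or state that is monotone on sums of squares. -/
theorem IsAdjointable.exists_add_eq {R : Type*} [NonUnitalCStarAlgebra R] {t : K}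
    {L : R →ₗ[ℂ] D.fiber t →ₗ[ℂ] D.fiber t} (hL : IsAdjointable L) (a : R) (y : D.fiber t) :
    ∃ y' : D.fiber t, D.ip (L a y) (L a y) + D.ip y' y' = ((‖a‖ : ℂ) ^ 2) • D.ip y y := by
  obtain ⟨l, d, hl, hd⟩ := exists_star_mul_self_eq_norm_sq_sub a
  refine ⟨l • y + L d y, ?_⟩
  have h1 : D.ip (l • y + L d y) (l • y + L d y) = (conj l * l) • D.ip y y +
      D.ip y (L (conj l • d + l • star d + star d * d) y) := by
    rw [map_add, map_add, map_smul, map_smul, LinearMap.add_apply, LinearMap.add_apply,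
      LinearMap.smul_apply, LinearMap.smul_apply, hL.map_mul, ip_add_left, ip_add_right,
      ip_add_right, hL.ip_left, hL.ip_left, ip_smul_smul, ip_add_right, ip_add_right,
      ip_smul_left, ip_smul_right, map_smul, ip_smul_right]
    abel
  rw [h1, hd, hl, map_neg, LinearMap.neg_apply, hL.map_mul, ← neg_one_smul ℂ, ip_smul_right,
    hL.ip_left, neg_one_smul]
  abel

theorem IsAdjointable.ipSeminorm_le {R : Type*} [NonUnitalCStarAlgebra R] {t : K}
    {L : R →ₗ[ℂ] D.fiber t →ₗ[ℂ] D.fiber t} (hL : IsAdjointable L)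
    {p : Seminorm ℂ D.UnitFiber} (hp : D.IsCStarSeminorm p) (hp0 : ∀ x, p x = 0 → x = 0)
    (hS : ∀ {t : K} (x : D.fiber t), D.ip x x ∈ sumSq D.UnitFiber) (a : R) (y : D.fiber t) :
    hp.ipSeminorm hp0 hS t (L a y) ≤ ‖a‖ * hp.ipSeminorm hp0 hS t y := by
  obtain ⟨y', h⟩ := hL.exists_add_eq a y
  have h1 := hp.le_add hp0 (hS (L a y)) (hS y')
  rw [h, map_smul_eq_mul, norm_pow, Complex.norm_real, norm_norm, ← hp.ipSeminorm_sq hp0 hS,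
    ← hp.ipSeminorm_sq hp0 hS y, ← mul_pow] at h1
  exact le_of_sq_le_sq h1 (mul_nonneg (norm_nonneg _) (apply_nonneg _ _))

/-- The left action as a bilinear map. -/
def lactL (t : K) : D.UnitFiber →ₗ[ℂ] D.fiber t →ₗ[ℂ] D.fiber t := D.mul (one_mul t)

end StarAlgBundle

/-! ### The two unit fibers acting on the tensor product bundle -/

namespace FellBundle

open StarAlgBundle

variable {G H : Type*} [Group G] [Group H] (A : FellBundle G) (B : FellBundle H)

/-- The algebraic tensor product of Fell bundles. -/
abbrev tensor : StarAlgBundle (G × H) := A.toBundle.tensor B.toBundle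

theorem tensor_ip_self_mem_sumSq {t : G × H} (x : (A.tensor B).fiber t) :
    (A.tensor B).ip x x ∈ sumSq (A.tensor B).UnitFiber := by
  obtain ⟨n, z, h⟩ := A.exists_ip_self_eq_sum B x
  rw [h]
  exact sum_mem fun k _ => star_mul_self_mem_sumSq (z k)

theorem isAdjointable_lactL (t : G) :
    IsAdjointable (D := A.toBundle) (lactL t : A.toBundle.UnitFiber →ₗ[ℂ] _) where
  map_mul := A.toBundle.lact_mul
  ip_left := A.toBundle.ip_lact_left

/-- The action of the unit fiber of the left factor on the fibers of the tensor product. -/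
def lactLeft (t : G × H) :
    A.toBundle.UnitFiber →ₗ[ℂ] (A.tensor B).fiber t →ₗ[ℂ] (A.tensor B).fiber t :=
  LinearMap.rTensorHom (B.toBundle.fiber t.2) ∘ₗ lactL t.1

/-- The action of the unit fiber of the right factor on the fibers of the tensor product. -/
def lactRight (t : G × H) :
    B.toBundle.UnitFiber →ₗ[ℂ] (A.tensor B).fiber t →ₗ[ℂ] (A.tensor B).fiber t :=
  LinearMap.lTensorHom (A.toBundle.fiber t.1) ∘ₗ lactL t.2

theorem lactLeft_tm {t : G × H} (a : A.toBundle.UnitFiber) (x : A.toBundle.fiber t.1)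
    (y : B.toBundle.fiber t.2) : A.lactLeft B t a (tm x y) = tm (A.toBundle.lact a x) y := rfl

theorem lactRight_tm {t : G × H} (b : B.toBundle.UnitFiber) (x : A.toBundle.fiber t.1)
    (y : B.toBundle.fiber t.2) : A.lactRight B t b (tm x y) = tm x (B.toBundle.lact b y) := rfl

theorem tensor_induction {t : G × H} {q : (A.tensor B).fiber t → Prop} (x : (A.tensor B).fiber t)
    (h0 : q 0) (h1 : ∀ a b, q (tm a b)) (h2 : ∀ x y, q x → q y → q (x + y)) : q x :=
  TensorProduct.induction_on (R := ℂ) (M := A.toBundle.fiber t.1) (N := B.toBundle.fiber t.2)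
    (motive := q) x h0 h1 h2

theorem lact_utm {t : G × H} (a : A.toBundle.UnitFiber) (b : B.toBundle.UnitFiber)
    (x : (A.tensor B).fiber t) :
    (A.tensor B).lact (utm a b) x = A.lactLeft B t a (A.lactRight B t b x) := by
  induction x using A.tensor_induction B with
  | h0 => simp
  | h1 x y => rfl
  | h2 x y hx hy => simp only [map_add, hx, hy]

theorem isAdjointable_lactLeft (t : G × H) : IsAdjointable (A.lactLeft B t) where
  map_mul a b x := by
    induction x using A.tensor_induction B with
    | h0 => simp
    | h1 x y => rw [lactLeft_tm, lactLeft_tm, lactLeft_tm, A.toBundle.lact_mul]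
    | h2 x y hx hy => simp only [map_add, hx, hy]
  ip_left a x y := by
    induction x using A.tensor_induction B with
    | h0 => rw [map_zero, ip_zero_left, ip_zero_left]
    | h2 x x' hx hx' => rw [map_add, ip_add_left, ip_add_left, hx, hx']
    | h1 x x' =>
      induction y using A.tensor_induction B with
      | h0 => rw [map_zero, ip_zero_right, ip_zero_right]
      | h2 y y' hy hy' => rw [map_add, ip_add_right, ip_add_right, hy, hy']
      | h1 y y' => rw [lactLeft_tm, lactLeft_tm, ip_tm, ip_tm, A.toBundle.ip_lact_left]

theorem isAdjointable_lactRight (t : G × H) : IsAdjointable (A.lactRight B t) where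
  map_mul a b x := by
    induction x using A.tensor_induction B with
    | h0 => simp
    | h1 x y => rw [lactRight_tm, lactRight_tm, lactRight_tm, B.toBundle.lact_mul]
    | h2 x y hx hy => simp only [map_add, hx, hy]
  ip_left a x y := by
    induction x using A.tensor_induction B with
    | h0 => rw [map_zero, ip_zero_left, ip_zero_left]
    | h2 x x' hx hx' => rw [map_add, ip_add_left, ip_add_left, hx, hx']
    | h1 x x' =>
      induction y using A.tensor_induction B with
      | h0 => rw [map_zero, ip_zero_right, ip_zero_right]
      | h2 y y' hy hy' => rw [map_add, ip_add_right, ip_add_right, hy, hy']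
      | h1 y y' => rw [lactRight_tm, lactRight_tm, ip_tm, ip_tm, B.toBundle.ip_lact_left]

section Bounds

variable {p : Seminorm ℂ (A.tensor B).UnitFiber} (hp : (A.tensor B).IsCStarSeminorm p)
  (hp0 : ∀ x, p x = 0 → x = 0)
include hp hp0

theorem ipSeminorm_lact_utm_le {t : G × H} (a : A.toBundle.UnitFiber) (b : B.toBundle.UnitFiber)
    (y : (A.tensor B).fiber t) :
    hp.ipSeminorm hp0 (A.tensor_ip_self_mem_sumSq B) t ((A.tensor B).lact (utm a b) y) ≤
      ‖a‖ * ‖b‖ * hp.ipSeminorm hp0 (A.tensor_ip_self_mem_sumSq B) t y := by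
  rw [lact_utm, _root_.mul_assoc]
  exact ((A.isAdjointable_lactLeft B t).ipSeminorm_le hp hp0 _ a _).trans
    (mul_le_mul_of_nonneg_left ((A.isAdjointable_lactRight B t).ipSeminorm_le hp hp0 _ b y)
      (norm_nonneg a))

/-- For `z = a ⊗ b`, the bound for the action of `z` on `z*` reads `p(zz*) ≤ ‖a‖ ‖b‖ p(z*)`, and
`p(zz*) = p(z)²`. Being uniform in `p`, it makes the supremum that defines the maximal norm finite.
-/
theorem cstarNorm_utm_le (a : A.toBundle.UnitFiber) (b : B.toBundle.UnitFiber) :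
    p (utm a b) ≤ ‖a‖ * ‖b‖ := by
  have h1 := A.ipSeminorm_lact_utm_le B hp hp0 (t := 1) a b
    (star (utm a b) : (A.tensor B).UnitFiber)
  rw [lact_unit, hp.ipSeminorm_unit, hp.ipSeminorm_unit, ← star_star (utm a b * star (utm a b)),
    hp.star_eq, star_mul, star_star] at h1
  have h2 := hp.star_mul_self (star (utm a b))
  rw [star_star] at h2
  rw [h2, hp.star_eq, sq] at h1
  rcases (apply_nonneg p (utm a b)).eq_or_lt with h | h
  · rw [← h]; positivity
  · exact le_of_mul_le_mul_right h1 h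

end Bounds

end FellBundle

/-! ## Hilbert spaces from states -/

theorem UniformSpace.Completion.clm_ext {V : Type*} [SeminormedAddCommGroup V]
    [InnerProductSpace ℂ V]
    {S T : UniformSpace.Completion V →L[ℂ] UniformSpace.Completion V}
    (h : ∀ x : V, S x = T x) : S = T :=
  ContinuousLinearMap.ext fun x =>
    congrFun (UniformSpace.Completion.ext S.continuous T.continuous h) x

/-- The completion step of the GNS construction, separated from the choice of the positive form. -/
theorem exists_representation_completion.{u} {V : Type u} [SeminormedAddCommGroup V]
    [InnerProductSpace ℂ V] {R : Type*} [NonUnitalCStarAlgebra R] (L : R →ₗ[ℂ] V →ₗ[ℂ] V)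
    (hmul : ∀ a b x, L (a * b) x = L a (L b x))
    (hadj : ∀ a x y, inner ℂ (L a x) y = inner ℂ x (L (star a) y))
    (hb : ∀ a x, ‖L a x‖ ≤ ‖a‖ * ‖x‖) :
    ∃ (E : Type u) (_ : NormedAddCommGroup E) (_ : InnerProductSpace ℂ E) (_ : CompleteSpace E)
      (π : R →⋆ₙₐ[ℂ] (E →L[ℂ] E)) (i : V →ₗ[ℂ] E),
      (∀ x y, inner ℂ (i x) (i y) = inner ℂ x y) ∧ ∀ a x, π a (i x) = i (L a x) := by
  let T : R → UniformSpace.Completion V →L[ℂ] UniformSpace.Completion V :=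
    fun a => ((L a).mkContinuous ‖a‖ (hb a)).completion
  have hT : ∀ a (x : V), T a x = (L a x : V) := fun a x =>
    ContinuousLinearMap.completion_apply_coe _ _
  have hsmul : ∀ (c : ℂ) a, T (c • a) = c • T a := fun c a =>
    UniformSpace.Completion.clm_ext fun x => by
      rw [smul_apply, hT, hT, map_smul, LinearMap.smul_apply, UniformSpace.Completion.coe_smul]
  let π : R →⋆ₙₐ[ℂ] (UniformSpace.Completion V →L[ℂ] UniformSpace.Completion V) :=
    { toFun := T
      map_smul' := hsmul
      map_zero' := by
        have := hsmul 0 0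
        rwa [zero_smul, zero_smul] at this
      map_add' := fun a b => UniformSpace.Completion.clm_ext fun x => by
        rw [add_apply, hT, hT, hT, map_add, LinearMap.add_apply, UniformSpace.Completion.coe_add]
      map_mul' := fun a b => UniformSpace.Completion.clm_ext fun x => by
        rw [mul_apply_eq_comp, hT, hT, hT, hmul]
      map_star' := fun a => by
        refine (ContinuousLinearMap.eq_adjoint_iff (T (star a)) (T a)).mpr fun x y => ?_
        induction x, y using UniformSpace.Completion.induction_on₂ with
        | hp => exact isClosed_eq (((T (star a)).continuous.comp continuous_fst).inner
            continuous_snd) (continuous_fst.inner ((T a).continuous.comp continuous_snd))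
        | ih x y =>
          rw [hT, hT, UniformSpace.Completion.inner_coe, UniformSpace.Completion.inner_coe, hadj,
            star_star] }
  exact ⟨UniformSpace.Completion V, inferInstance, inferInstance, inferInstance, π,
    (UniformSpace.Completion.toComplL : V →L[ℂ] UniformSpace.Completion V).toLinearMap,
    fun x y => UniformSpace.Completion.inner_coe x y, hT⟩

namespace FellBundle

open StarAlgBundle CStarUnitization

universe u v

variable {G H : Type*} [Group G] [Group H] (A : FellBundle.{u} G) (B : FellBundle.{v} H)

theorem state_ip_self_nonneg {t : G} {f : WeakDual ℂ (CStarUnitization A.toBundle.UnitFiber)}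
    (hf : f ∈ states (CStarUnitization A.toBundle.UnitFiber)) (x : A.toBundle.fiber t) :
    0 ≤ f (inr (A.toBundle.ip x x)) := by
  obtain ⟨c, hc⟩ := A.exists_ip_self_eq x
  rw [hc, map_mul, map_star]
  exact hf.2 _

/-- The Hilbert space constructed from a state and a fiber, with the representation of the unit
fiber. -/
theorem exists_gns (t : G) {f : WeakDual ℂ (CStarUnitization A.toBundle.UnitFiber)}
    (hf : f ∈ states (CStarUnitization A.toBundle.UnitFiber)) :
    ∃ (E : Type u) (_ : NormedAddCommGroup E) (_ : InnerProductSpace ℂ E) (_ : CompleteSpace E)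
      (π : A.toBundle.UnitFiber →⋆ₙₐ[ℂ] (E →L[ℂ] E)) (i : A.toBundle.fiber t →ₗ[ℂ] E),
      (∀ x y, inner ℂ (i x) (i y) = f (inr (A.toBundle.ip x y))) ∧
      ∀ a x, π a (i x) = i (A.toBundle.lact a x) := by
  let c : PreInnerProductSpace.Core ℂ (A.toBundle.fiber t) :=
    { inner := fun x y => f (inr (A.toBundle.ip x y))
      conj_inner_symm := fun x y => by
        have h := map_star_of_pos hf.2 (inr (A.toBundle.ip y x))
        rw [← map_star, A.toBundle.star_ip] at h
        exact h.symm
      re_inner_nonneg := fun x => (Complex.nonneg_iff.mp (A.state_ip_self_nonneg hf x)).1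
      add_left := fun x y z => by rw [A.toBundle.ip_add_left, map_add, map_add]
      smul_left := fun x y r => by rw [A.toBundle.ip_smul_left, map_smul, map_smul]; rfl }
  let _ : SeminormedAddCommGroup (A.toBundle.fiber t) :=
    InnerProductSpace.Core.toSeminormedAddCommGroup (c := c)
  let _ : InnerProductSpace ℂ (A.toBundle.fiber t) := InnerProductSpace.ofCore c
  have hin : ∀ x y : A.toBundle.fiber t, inner ℂ x y = f (inr (A.toBundle.ip x y)) :=
    fun _ _ => rfl
  have hL := A.isAdjointable_lactL t
  refine exists_representation_completion (lactL t : A.toBundle.UnitFiber →ₗ[ℂ] _) hL.map_mul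
    (fun a x y => by rw [hin, hin, hL.ip_left]) fun a x => ?_
  -- Applying `f` to `⟨ax, ax⟩ + ⟨y, y⟩ = ‖a‖²⟨x, x⟩` bounds the operator of `a`, since `f(⟨y, y⟩) ≥
  -- 0`.
  obtain ⟨y, hy⟩ := hL.exists_add_eq a x
  have h1 : ∀ x : A.toBundle.fiber t, ‖x‖ ^ 2 = (f (inr (A.toBundle.ip x x))).re := by
    intro x
    rw [← hin, ← inner_self_eq_norm_sq (𝕜 := ℂ)]
    rfl
  refine le_of_sq_le_sq ?_ (by positivity)
  rw [mul_pow, h1, h1]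
  have h2 := congrArg (fun w => (f (inr w)).re) hy
  simp only [map_add, map_smul, smul_eq_mul, Complex.add_re] at h2
  rw [← Complex.ofReal_pow, Complex.re_ofReal_mul] at h2
  rw [← h2]
  exact le_add_of_nonneg_right (Complex.nonneg_iff.mp (A.state_ip_self_nonneg hf y)).1

/-! ## Tensor products of representations -/

section TensorRep

variable {A B} {E F : Type*}
  [NormedAddCommGroup E] [InnerProductSpace ℂ E] [CompleteSpace E]
  [NormedAddCommGroup F] [InnerProductSpace ℂ F] [CompleteSpace F]
  (π : A.toBundle.UnitFiber →⋆ₙₐ[ℂ] (E →L[ℂ] E)) (ρ : B.toBundle.UnitFiber →⋆ₙₐ[ℂ] (F →L[ℂ] F))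

theorem tensorRep_utm_tmul (a : A.toBundle.UnitFiber) (b : B.toBundle.UnitFiber) (ξ : E) (η : F) :
    tensorRep π ρ (utm a b) (ξ ⊗ₜ η) = π a ξ ⊗ₜ ρ b η := rfl

theorem tensorRep_mul (x y : (A.tensor B).UnitFiber) :
    tensorRep π ρ (x * y) = tensorRep π ρ x * tensorRep π ρ y := by
  induction x using unit_induction with
  | h0 => rw [zero_mul, map_zero, zero_mul]
  | h2 x x' hx hx' => rw [add_mul, map_add, map_add, hx, hx', add_mul]
  | h1 a b =>
    induction y using unit_induction with
    | h0 => rw [mul_zero, map_zero, mul_zero]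
    | h2 y y' hy hy' => rw [mul_add, map_add, map_add, hy, hy', mul_add]
    | h1 a' b' =>
      ext ζ
      induction ζ using TensorProduct.induction_on with
      | zero => simp
      | add ζ ζ' h h' => simp only [map_add, h, h']
      | tmul ξ η =>
        rw [utm_mul, mul_apply_eq_comp]
        simp only [tensorRep_utm_tmul, map_mul, mul_apply_eq_comp]

theorem inner_tensorRep_left (x : (A.tensor B).UnitFiber) (ζ ω : E ⊗[ℂ] F) :
    inner ℂ (tensorRep π ρ x ζ) ω = inner ℂ ζ (tensorRep π ρ (star x) ω) := by
  induction x using unit_induction with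
  | h0 => simp
  | h2 x x' hx hx' =>
    rw [star_add, map_add, map_add, add_apply, add_apply,
      inner_add_left, inner_add_right, hx, hx']
  | h1 a b =>
    rw [star_utm]
    induction ζ using TensorProduct.induction_on with
    | zero => simp
    | add ζ ζ' h h' => rw [map_add, inner_add_left, inner_add_left, h, h']
    | tmul ξ η =>
      induction ω using TensorProduct.induction_on with
      | zero => simp
      | add ω ω' h h' => rw [map_add, inner_add_right, inner_add_right, h, h']
      | tmul ξ' η' =>
        rw [tensorRep_utm_tmul, tensorRep_utm_tmul, TensorProduct.inner_tmul,
          TensorProduct.inner_tmul, map_star, map_star, ContinuousLinearMap.star_eq_adjoint,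
          ContinuousLinearMap.star_eq_adjoint, ContinuousLinearMap.adjoint_inner_right,
          ContinuousLinearMap.adjoint_inner_right]

theorem norm_tensorRep_apply_sq (x : (A.tensor B).UnitFiber) (ζ : E ⊗[ℂ] F) :
    ‖tensorRep π ρ x ζ‖ ^ 2 = (inner ℂ ζ (tensorRep π ρ (star x * x) ζ)).re := by
  rw [← inner_self_eq_norm_sq (𝕜 := ℂ), inner_tensorRep_left, tensorRep_mul]
  rfl

theorem norm_tensorRep_nonneg (x : (A.tensor B).UnitFiber) : 0 ≤ ‖tensorRep π ρ x‖ :=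
  (tensorRep π ρ x).opNorm_nonneg

theorem norm_tensorRep_mul_le (x y : (A.tensor B).UnitFiber) :
    ‖tensorRep π ρ (x * y)‖ ≤ ‖tensorRep π ρ x‖ * ‖tensorRep π ρ y‖ := by
  rw [tensorRep_mul]
  exact (tensorRep π ρ x).opNorm_comp_le (tensorRep π ρ y)

theorem norm_tensorRep_sq_le (x : (A.tensor B).UnitFiber) :
    ‖tensorRep π ρ x‖ ^ 2 ≤ ‖tensorRep π ρ (star x * x)‖ := by
  have h0 := norm_tensorRep_nonneg π ρ (star x * x)
  have h : ‖tensorRep π ρ x‖ ≤ √‖tensorRep π ρ (star x * x)‖ := by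
    refine ContinuousLinearMap.opNorm_le_bound _ (Real.sqrt_nonneg _) fun ζ => ?_
    refine le_of_sq_le_sq ?_ (by positivity)
    rw [norm_tensorRep_apply_sq, mul_pow, Real.sq_sqrt h0]
    refine (Complex.re_le_norm _).trans ((norm_inner_le_norm (𝕜 := ℂ) (E := E ⊗[ℂ] F) _ _).trans ?_)
    have := (tensorRep π ρ (star x * x)).le_opNorm ζ
    nlinarith [norm_nonneg ζ]
  exact (Real.le_sqrt (norm_tensorRep_nonneg π ρ x) h0).mp h

theorem norm_tensorRep_star_mul_self (x : (A.tensor B).UnitFiber) :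
    ‖tensorRep π ρ (star x * x)‖ = ‖tensorRep π ρ x‖ ^ 2 := by
  have key : ∀ x : (A.tensor B).UnitFiber, ‖tensorRep π ρ x‖ ≤ ‖tensorRep π ρ (star x)‖ := by
    intro x
    rcases (norm_tensorRep_nonneg π ρ x).eq_or_lt with h | h
    · rw [← h]; exact norm_tensorRep_nonneg _ _ _
    · have h1 := (norm_tensorRep_sq_le π ρ x).trans (norm_tensorRep_mul_le π ρ _ _)
      rw [sq] at h1
      exact le_of_mul_le_mul_right h1 h
  refine le_antisymm ?_ (norm_tensorRep_sq_le π ρ x)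
  have h2 := key (star x)
  rw [star_star] at h2
  rw [sq]
  exact (norm_tensorRep_mul_le π ρ _ _).trans
    (mul_le_mul_of_nonneg_right h2 (norm_tensorRep_nonneg π ρ x))

theorem norm_tensorRep_utm_le (a : A.toBundle.UnitFiber) (b : B.toBundle.UnitFiber) :
    ‖tensorRep π ρ (utm a b)‖ ≤ ‖a‖ * ‖b‖ :=
  (TensorProduct.norm_mapL_le (π a) (ρ b)).trans (mul_le_mul
    (NonUnitalStarAlgHom.norm_apply_le π a) (NonUnitalStarAlgHom.norm_apply_le ρ b)
    (norm_nonneg _) (norm_nonneg _))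

end TensorRep

end FellBundle

theorem TensorProduct.inner_self_eq_norm_sq {E F : Type*} [NormedAddCommGroup E]
    [InnerProductSpace ℂ E] [NormedAddCommGroup F] [InnerProductSpace ℂ F] (ζ : E ⊗[ℂ] F) :
    inner ℂ ζ ζ = ((‖ζ‖ ^ 2 : ℝ) : ℂ) := by
  rw [Complex.ofReal_pow]
  exact inner_self_eq_norm_sq_to_K (𝕜 := ℂ) ζ

namespace FellBundle

open StarAlgBundle CStarUnitization

universe u v

variable {G H : Type*} [Group G] [Group H] {A : FellBundle.{u} G} {B : FellBundle.{v} H}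

/-! ## Product functionals on the algebraic tensor product -/

/-- The product of two functionals, as a functional on the unit fiber of the tensor product. -/
def prodState (f : WeakDual ℂ (CStarUnitization A.toBundle.UnitFiber))
    (g : WeakDual ℂ (CStarUnitization B.toBundle.UnitFiber)) : (A.tensor B).UnitFiber →ₗ[ℂ] ℂ :=
  tensorFunctional f g ∘ₗ (unitEquiv A.toBundle B.toBundle).toLinearMap

variable {f : WeakDual ℂ (CStarUnitization A.toBundle.UnitFiber)}
  {g : WeakDual ℂ (CStarUnitization B.toBundle.UnitFiber)}

theorem prodState_utm (a : A.toBundle.UnitFiber) (b : B.toBundle.UnitFiber) :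
    prodState f g (utm a b) = f (inr a) * g (inr b) := rfl

section States

variable (hf : f ∈ states (CStarUnitization A.toBundle.UnitFiber))
  (hg : g ∈ states (CStarUnitization B.toBundle.UnitFiber))
include hf hg

/-- `J` is the tensor product of the GNS maps of `f` on `A_t` and `g` on `B_s`. It turns the form
`(f ⊗ g)(x*y)` into a Hilbert space inner product and the action of the unit fiber into some `π ⊗
ρ`, whose norm the spatial norm controls by definition. -/
theorem exists_tensor_gns (t : G × H) :
    ∃ (E : Type u) (_ : NormedAddCommGroup E) (_ : InnerProductSpace ℂ E) (_ : CompleteSpace E)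
      (F : Type v) (_ : NormedAddCommGroup F) (_ : InnerProductSpace ℂ F) (_ : CompleteSpace F)
      (π : A.toBundle.UnitFiber →⋆ₙₐ[ℂ] (E →L[ℂ] E))
      (ρ : B.toBundle.UnitFiber →⋆ₙₐ[ℂ] (F →L[ℂ] F)) (J : (A.tensor B).fiber t →ₗ[ℂ] E ⊗[ℂ] F),
      (∀ x y, inner ℂ (J x) (J y) = prodState f g ((A.tensor B).ip x y)) ∧
      ∀ z x, tensorRep π ρ z (J x) = J ((A.tensor B).lact z x) := by
  obtain ⟨E, _, _, _, π, i, hi, hπ⟩ := A.exists_gns t.1 hf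
  obtain ⟨F, _, _, _, ρ, j, hj, hρ⟩ := B.exists_gns t.2 hg
  let J : (A.tensor B).fiber t →ₗ[ℂ] E ⊗[ℂ] F := TensorProduct.map i j
  have hJ : ∀ a b, J (tm a b) = i a ⊗ₜ j b := fun a b => rfl
  refine ⟨E, _, _, ‹_›, F, _, _, ‹_›, π, ρ, J, fun x y => ?_, fun z x => ?_⟩
  · induction x using A.tensor_induction B with
    | h0 => rw [map_zero, ip_zero_left, inner_zero_left, map_zero]
    | h2 x x' h h' => rw [map_add, ip_add_left, inner_add_left, map_add, h, h']
    | h1 a b =>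
      induction y using A.tensor_induction B with
      | h0 => rw [map_zero, ip_zero_right, inner_zero_right, map_zero]
      | h2 y y' h h' => rw [map_add, ip_add_right, inner_add_right, map_add, h, h']
      | h1 a' b' => rw [hJ, hJ, TensorProduct.inner_tmul, hi, hj, ip_tm, prodState_utm]
  · induction x using A.tensor_induction B with
    | h0 =>
      rw [map_zero, map_zero]
      exact ((congrArg J (map_zero (lactL t z))).trans (map_zero J)).symm
    | h2 x x' h h' =>
      rw [map_add, map_add, h, h', ← map_add]
      exact congrArg J (map_add (lactL t z) x x').symm
    | h1 a b =>
      induction z using unit_induction with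
      | h0 =>
        rw [map_zero, zero_apply]
        exact ((congrArg J (LinearMap.map_zero₂ (lactL t) (tm a b))).trans (map_zero J)).symm
      | h2 z z' h h' => rw [map_add, add_apply, h, h', lact_add, map_add]
      | h1 c d => rw [lact_utm_tm, hJ, hJ, tensorRep_utm_tmul, hπ, hρ]

theorem prodState_ip_self_nonneg {t : G × H} (x : (A.tensor B).fiber t) :
    0 ≤ prodState f g ((A.tensor B).ip x x) := by
  obtain ⟨E, _, _, _, F, _, _, _, π, ρ, J, hJ, hT⟩ := exists_tensor_gns hf hg t
  rw [← hJ, TensorProduct.inner_self_eq_norm_sq]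
  exact_mod_cast sq_nonneg ‖J x‖

theorem prodState_star_mul_self_nonneg (x : (A.tensor B).UnitFiber) :
    0 ≤ prodState f g (star x * x) := by
  rw [← ip_unit]
  exact prodState_ip_self_nonneg hf hg (t := 1) x

theorem prodState_ip_eq_zero {t : G × H} {x : (A.tensor B).fiber t}
    (h : prodState f g ((A.tensor B).ip x x) = 0) (y : (A.tensor B).fiber t) :
    prodState f g ((A.tensor B).ip y x) = 0 := by
  obtain ⟨E, _, _, _, F, _, _, _, π, ρ, J, hJ, hT⟩ := exists_tensor_gns hf hg t
  rw [← hJ] at h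
  have h0 : J x = 0 := inner_self_eq_zero (𝕜 := ℂ) |>.mp h
  rw [← hJ, h0, inner_zero_right]

end States

/-- If `⟨x, x⟩` is nonzero, its positive multiple of norm one has value `1` in some state. -/
theorem eq_zero_of_forall_state {t : G} {x : A.toBundle.fiber t}
    (h : ∀ f ∈ states (CStarUnitization A.toBundle.UnitFiber),
      f (inr (A.toBundle.ip x x)) = 0) : x = 0 := by
  refine A.eq_zero_of_ip_self_eq_zero ?_
  by_contra hx
  set c := A.toBundle.ip x x with hc
  obtain ⟨d, hd⟩ := A.exists_ip_self_eq x
  have hn : 0 < ‖c‖ := norm_pos_iff.mpr hx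
  set r : ℂ := (((√‖c‖)⁻¹ : ℝ) : ℂ) with hr
  have hr2 : conj r * r = ((‖c‖⁻¹ : ℝ) : ℂ) := by
    rw [hr, Complex.conj_ofReal, ← Complex.ofReal_mul, ← mul_inv, Real.mul_self_sqrt hn.le]
  have h1 : inr (((‖c‖⁻¹ : ℝ) : ℂ) • c) = star (inr (r • d)) * inr (r • d) := by
    rw [← map_star, ← map_mul, star_smul, smul_mul_smul_comm, RCLike.star_def, hr2, ← hd]
  have h2 : ‖inr (((‖c‖⁻¹ : ℝ) : ℂ) • c)‖ = 1 := by
    rw [norm_inr, norm_smul, Complex.norm_real, Real.norm_of_nonneg (inv_nonneg.mpr hn.le),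
      inv_mul_cancel₀ hn.ne']
  have : Nontrivial (CStarUnitization A.toBundle.UnitFiber) :=
    ⟨inr (((‖c‖⁻¹ : ℝ) : ℂ) • c), 0, fun h0 => by rw [h0, norm_zero] at h2; exact zero_ne_one h2⟩
  obtain ⟨k, hk, hk1⟩ := exists_state_apply_eq_norm ⟨_, h1⟩ h2
  rw [map_smul, map_smul, h k hk, smul_zero] at hk1
  exact zero_ne_one hk1

/-- Product states separate the points of the algebraic tensor product. -/
theorem eq_zero_of_forall_prodState {t : G × H} {x : (A.tensor B).fiber t}
    (h : ∀ f ∈ states (CStarUnitization A.toBundle.UnitFiber),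
      ∀ g ∈ states (CStarUnitization B.toBundle.UnitFiber),
      prodState f g ((A.tensor B).ip x x) = 0) : x = 0 := by
  -- In the expansion `x = Σ e_i ⊗ b_i` over a basis of `A_t`, it suffices to show `g(⟨b_i, b_i⟩) =
  -- 0` for every state `g`.
  let e := Module.Basis.ofVectorSpace ℂ (A.toBundle.fiber t.1)
  obtain ⟨b, hb⟩ : ∃ b : _ →₀ B.toBundle.fiber t.2,
      ∑ i ∈ b.support, tm (t := t) (e i) (b i) = x := by
    obtain ⟨b, hb⟩ := TensorProduct.eq_repr_basis_left e x
    exact ⟨b, hb⟩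
  suffices hb0 : b = 0 by rw [← hb, hb0]; rfl
  refine Finsupp.ext fun i => eq_zero_of_forall_state fun g hg => ?_
  have key : ∑ i' ∈ b.support, g (inr (B.toBundle.ip (b i) (b i'))) • e i' = 0 := by
    refine eq_zero_of_forall_state fun f hf => ?_
    set y := ∑ i' ∈ b.support, g (inr (B.toBundle.ip (b i) (b i'))) • e i' with hy
    -- A null vector is orthogonal to everything. Pairing `x` with `y ⊗ b_i` gives `0 = Σ f(⟨y,
    -- e_i'⟩) g(⟨b_i, b_i'⟩) = f(⟨y, y⟩)`, so `y = 0`, and its coefficients vanish by independence.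
    have h1 := prodState_ip_eq_zero hf hg (h f hf g hg) (tm y (b i))
    rw [← hb, ip_sum_right, map_sum] at h1
    conv_lhs => rw [hy, ip_sum_right, map_sum, map_sum]
    rw [← h1]
    refine Finset.sum_congr rfl fun i' _ => ?_
    rw [ip_tm, prodState_utm, ip_smul_right, map_smul, map_smul, smul_eq_mul, mul_comm]
  by_cases hi : i ∈ b.support
  · exact linearIndependent_iff'.mp e.linearIndependent b.support _ key i hi
  · rw [Finsupp.notMem_support_iff.mp hi, ip_zero_right, map_zero, map_zero]

/-! ## The minimal norm -/

section MinNorm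

variable (A B)

/-- A bound that does not depend on the representations is required, because the real supremum of an
unbounded set has the default value `0`. -/
theorem exists_norm_tensorRep_le (x : (A.tensor B).UnitFiber) :
    ∃ C : ℝ, ∀ (E : Type u) (_ : NormedAddCommGroup E) (_ : InnerProductSpace ℂ E)
      (_ : CompleteSpace E) (F : Type v) (_ : NormedAddCommGroup F) (_ : InnerProductSpace ℂ F)
      (_ : CompleteSpace F) (π : A.toBundle.UnitFiber →⋆ₙₐ[ℂ] (E →L[ℂ] E))
      (ρ : B.toBundle.UnitFiber →⋆ₙₐ[ℂ] (F →L[ℂ] F)), ‖tensorRep π ρ x‖ ≤ C := by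
  induction x using unit_induction with
  | h0 =>
    refine ⟨0, fun E _ _ _ F _ _ _ π ρ => ?_⟩
    rw [map_zero, ContinuousLinearMap.opNorm_zero]
  | h1 a b => exact ⟨‖a‖ * ‖b‖, fun E _ _ _ F _ _ _ π ρ => norm_tensorRep_utm_le π ρ a b⟩
  | h2 x y hx hy =>
    obtain ⟨C, hC⟩ := hx
    obtain ⟨C', hC'⟩ := hy
    refine ⟨C + C', fun E _ _ _ F _ _ _ π ρ => ?_⟩
    rw [map_add]
    exact (ContinuousLinearMap.opNorm_add_le _ _).trans
      (add_le_add (hC E _ _ _ F _ _ _ π ρ) (hC' E _ _ _ F _ _ _ π ρ))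

variable {A B}

theorem norm_tensorRep_le_minNorm {E : Type u} [NormedAddCommGroup E] [InnerProductSpace ℂ E]
    [CompleteSpace E] {F : Type v} [NormedAddCommGroup F] [InnerProductSpace ℂ F]
    [CompleteSpace F] (π : A.toBundle.UnitFiber →⋆ₙₐ[ℂ] (E →L[ℂ] E))
    (ρ : B.toBundle.UnitFiber →⋆ₙₐ[ℂ] (F →L[ℂ] F)) (x : (A.tensor B).UnitFiber) :
    ‖tensorRep π ρ x‖ ≤ A.toBundle.minNorm B.toBundle x := by
  obtain ⟨C, hC⟩ := A.exists_norm_tensorRep_le B x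
  refine le_csSup ⟨C, ?_⟩ ⟨E, _, _, ‹_›, F, _, _, ‹_›, π, ρ, rfl⟩
  rintro _ ⟨E, _, _, _, F, _, _, _, π, ρ, rfl⟩
  exact hC E _ _ _ F _ _ _ π ρ

theorem minNorm_le {x : (A.tensor B).UnitFiber} {c : ℝ} (hc : 0 ≤ c)
    (h : ∀ (E : Type u) (_ : NormedAddCommGroup E) (_ : InnerProductSpace ℂ E)
      (_ : CompleteSpace E) (F : Type v) (_ : NormedAddCommGroup F) (_ : InnerProductSpace ℂ F)
      (_ : CompleteSpace F) (π : A.toBundle.UnitFiber →⋆ₙₐ[ℂ] (E →L[ℂ] E))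
      (ρ : B.toBundle.UnitFiber →⋆ₙₐ[ℂ] (F →L[ℂ] F)), ‖tensorRep π ρ x‖ ≤ c) :
    A.toBundle.minNorm B.toBundle x ≤ c := by
  refine Real.sSup_le ?_ hc
  rintro _ ⟨E, _, _, _, F, _, _, _, π, ρ, rfl⟩
  exact h E _ _ _ F _ _ _ π ρ

theorem minNorm_nonneg (x : (A.tensor B).UnitFiber) : 0 ≤ A.toBundle.minNorm B.toBundle x := by
  refine Real.sSup_nonneg ?_
  rintro _ ⟨E, _, _, _, F, _, _, _, π, ρ, rfl⟩
  exact norm_tensorRep_nonneg π ρ x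

variable (A B) in
/-- The minimal norm as a seminorm. -/
def minSeminorm : Seminorm ℂ (A.tensor B).UnitFiber :=
  Seminorm.ofSMulLE (A.toBundle.minNorm B.toBundle)
    (le_antisymm (minNorm_le le_rfl fun E _ _ _ F _ _ _ π ρ => by
      rw [map_zero, ContinuousLinearMap.opNorm_zero]) (minNorm_nonneg _))
    (fun x y => minNorm_le (add_nonneg (minNorm_nonneg x) (minNorm_nonneg y))
      fun E _ _ _ F _ _ _ π ρ => by
        rw [map_add]
        exact (ContinuousLinearMap.opNorm_add_le _ _).trans (add_le_add
          (norm_tensorRep_le_minNorm π ρ x) (norm_tensorRep_le_minNorm π ρ y)))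
    (fun c x => minNorm_le (mul_nonneg (norm_nonneg c) (minNorm_nonneg x))
      fun E _ _ _ F _ _ _ π ρ => by
        rw [map_smul]
        exact (ContinuousLinearMap.opNorm_smul_le _ _).trans (mul_le_mul_of_nonneg_left
          (norm_tensorRep_le_minNorm π ρ x) (norm_nonneg c)))

theorem minSeminorm_apply (x : (A.tensor B).UnitFiber) :
    A.minSeminorm B x = A.toBundle.minNorm B.toBundle x := rfl

variable (A B) in
theorem isCStarSeminorm_minSeminorm : (A.tensor B).IsCStarSeminorm (A.minSeminorm B) where
  mul_le x y := minNorm_le (mul_nonneg (minNorm_nonneg x) (minNorm_nonneg y))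
    fun E _ _ _ F _ _ _ π ρ => (norm_tensorRep_mul_le π ρ x y).trans
      (mul_le_mul (norm_tensorRep_le_minNorm π ρ x) (norm_tensorRep_le_minNorm π ρ y)
        (norm_tensorRep_nonneg π ρ y) (minNorm_nonneg x))
  star_mul_self x := by
    refine le_antisymm (minNorm_le (sq_nonneg _) fun E _ _ _ F _ _ _ π ρ => ?_) ?_
    · rw [norm_tensorRep_star_mul_self]
      exact pow_le_pow_left₀ (norm_tensorRep_nonneg π ρ x) (norm_tensorRep_le_minNorm π ρ x) 2
    · refine (Real.le_sqrt (minNorm_nonneg x) (minNorm_nonneg _)).mp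
        (minNorm_le (Real.sqrt_nonneg _) fun E _ _ _ F _ _ _ π ρ =>
          Real.le_sqrt_of_sq_le ?_)
      rw [← norm_tensorRep_star_mul_self]
      exact norm_tensorRep_le_minNorm π ρ _

section States

variable (hf : f ∈ states (CStarUnitization A.toBundle.UnitFiber))
  (hg : g ∈ states (CStarUnitization B.toBundle.UnitFiber))
include hf hg

theorem prodState_ip_lact_le {t : G × H} (z : (A.tensor B).UnitFiber) (y : (A.tensor B).fiber t) :
    (prodState f g ((A.tensor B).ip ((A.tensor B).lact z y) ((A.tensor B).lact z y))).re ≤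
      A.minSeminorm B z ^ 2 * (prodState f g ((A.tensor B).ip y y)).re := by
  obtain ⟨E, _, _, _, F, _, _, _, π, ρ, J, hJ, hT⟩ := exists_tensor_gns hf hg t
  have h1 : ∀ x, (prodState f g ((A.tensor B).ip x x)).re = ‖J x‖ ^ 2 := fun x => by
    rw [← hJ, TensorProduct.inner_self_eq_norm_sq, Complex.ofReal_re]
  rw [h1, h1, ← hT, ← mul_pow]
  refine pow_le_pow_left₀ (norm_nonneg _) ?_ 2
  exact ((tensorRep π ρ z).le_opNorm _).trans
    (mul_le_mul_of_nonneg_right (norm_tensorRep_le_minNorm π ρ z) (norm_nonneg _))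

theorem prodState_ip_lact_right_le {t : G × H} (z : (A.tensor B).UnitFiber)
    (y : (A.tensor B).fiber t) :
    (prodState f g ((A.tensor B).ip y ((A.tensor B).lact z y))).re ≤
      A.minSeminorm B z * (prodState f g ((A.tensor B).ip y y)).re := by
  obtain ⟨E, _, _, _, F, _, _, _, π, ρ, J, hJ, hT⟩ := exists_tensor_gns hf hg t
  have h1 : (prodState f g ((A.tensor B).ip y y)).re = ‖J y‖ ^ 2 := by
    rw [← hJ, TensorProduct.inner_self_eq_norm_sq, Complex.ofReal_re]
  rw [h1, ← hJ, ← hT]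
  refine (Complex.re_le_norm _).trans ((norm_inner_le_norm (𝕜 := ℂ) (E := E ⊗[ℂ] F) _ _).trans ?_)
  have h2 := ((tensorRep π ρ z).le_opNorm (J y)).trans
    (mul_le_mul_of_nonneg_right (norm_tensorRep_le_minNorm π ρ z) (norm_nonneg _))
  rw [minSeminorm_apply]
  nlinarith [norm_nonneg (J y)]

end States

/-- If `x` has spatial norm `0`, every product state vanishes on `(xw)*(xw)`, so `xw = 0` for all
`w`. In particular `xx* = 0`, and product states also separate `x*` from `0`. -/
theorem eq_zero_of_minSeminorm_eq_zero (x : (A.tensor B).UnitFiber)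
    (hx : A.minSeminorm B x = 0) : x = 0 := by
  have h1 : ∀ w : (A.tensor B).UnitFiber, x * w = 0 := by
    intro w
    refine eq_zero_of_forall_prodState (t := 1) fun f hf g hg => ?_
    have h2 := prodState_ip_lact_le hf hg (t := 1) x w
    rw [hx, zero_pow two_ne_zero, zero_mul] at h2
    have h3 := Complex.nonneg_iff.mp (prodState_ip_self_nonneg hf hg (t := 1) (x * w))
    exact Complex.ext (le_antisymm h2 h3.1) h3.2.symm
  have h2 : star x = 0 := by
    refine eq_zero_of_forall_prodState (t := 1) fun f hf g hg => ?_
    refine (congrArg (prodState f g) (ip_unit _ (star x) (star x))).trans ?_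
    rw [star_star, h1, map_zero]
  rw [← star_star x, h2, star_zero]

end MinNorm

end FellBundle

/-! ## Quadratic forms on tensor products of Hilbert spaces -/

/-- Polarization with `q(z) = ⟨z, Tz⟩`: for `y` a multiple of `Tz` with `‖y‖ = ‖z‖`, one has
`4‖z‖‖Tz‖ = q(z + y) - q(z - y) ≤ c‖z + y‖² ≤ 4c‖z‖²`. Invariance of `W` is what allows testing on
`z + y`; no completeness is used. -/
theorem norm_apply_le_of_re_inner_le {Z : Type*} [NormedAddCommGroup Z] [InnerProductSpace ℂ Z]
    (T : Z →ₗ[ℂ] Z) (W : Submodule ℂ Z) (hTW : ∀ z ∈ W, T z ∈ W)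
    (hsymm : ∀ z w, inner ℂ (T z) w = inner ℂ z (T w)) (hpos : ∀ z, 0 ≤ (inner ℂ z (T z)).re)
    {c : ℝ} (hc : ∀ z ∈ W, (inner ℂ z (T z)).re ≤ c * ‖z‖ ^ 2) {z : Z} (hz : z ∈ W) :
    ‖T z‖ ≤ c * ‖z‖ := by
  rcases eq_or_ne z 0 with rfl | hz0
  · simp
  rcases eq_or_ne (T z) 0 with h0 | h0
  · have h1 := hc z hz
    rw [h0, inner_zero_right, Complex.zero_re] at h1
    have h2 : 0 < ‖z‖ := norm_pos_iff.mpr hz0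
    rw [h0, norm_zero]
    have h3 : 0 ≤ (c * ‖z‖) * ‖z‖ := by nlinarith
    exact nonneg_of_mul_nonneg_left h3 h2
  have hn : 0 < ‖z‖ := norm_pos_iff.mpr hz0
  have hm : 0 < ‖T z‖ := norm_pos_iff.mpr h0
  set y : Z := ((‖z‖ / ‖T z‖ : ℝ) : ℂ) • T z with hy
  have hyn : ‖y‖ = ‖z‖ := by
    rw [hy, norm_smul, Complex.norm_real, Real.norm_of_nonneg (by positivity),
      div_mul_cancel₀ _ hm.ne']
  have hyW : y ∈ W := W.smul_mem _ (hTW z hz)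
  have h1 : (inner ℂ y (T z)).re = ‖z‖ * ‖T z‖ := by
    have h2 : (inner ℂ (T z) (T z)).re = ‖T z‖ ^ 2 := inner_self_eq_norm_sq (𝕜 := ℂ) (T z)
    rw [hy, inner_smul_left, Complex.conj_ofReal, Complex.re_ofReal_mul, h2]
    field_simp
  have h2 : (inner ℂ z (T y)).re = (inner ℂ y (T z)).re := by
    rw [← hsymm, ← inner_conj_symm]
    exact Complex.conj_re _
  have h3 := hc (z + y) (W.add_mem hz hyW)
  have h4 := hpos (z - y)
  have h5 : (inner ℂ (z + y) (T (z + y))).re - (inner ℂ (z - y) (T (z - y))).re =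
      4 * (‖z‖ * ‖T z‖) := by
    simp only [map_add, map_sub, inner_add_left, inner_add_right, inner_sub_left, inner_sub_right,
      Complex.add_re, Complex.sub_re]
    rw [h2, h1]
    ring
  have h6 : ‖z + y‖ ^ 2 ≤ 4 * ‖z‖ ^ 2 := by
    have := norm_add_le z y
    rw [hyn] at this
    nlinarith [norm_nonneg (z + y)]
  have h8 := hpos z
  have h9 := hc z hz
  have h10 : 0 ≤ c := by
    have : 0 ≤ c * ‖z‖ ^ 2 := h8.trans h9
    exact nonneg_of_mul_nonneg_left this (by positivity)
  have h7 : ‖T z‖ * ‖z‖ ≤ (c * ‖z‖) * ‖z‖ := by nlinarith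
  exact le_of_mul_le_mul_right h7 hn

theorem Submodule.map₂_induction {R M N P : Type*} [CommSemiring R] [AddCommMonoid M]
    [AddCommMonoid N] [AddCommMonoid P] [Module R M] [Module R N] [Module R P]
    {f : M →ₗ[R] N →ₗ[R] P} {K : Submodule R M} {L : Submodule R N} {q : P → Prop} {z : P}
    (hz : z ∈ Submodule.map₂ f K L) (hm : ∀ k ∈ K, ∀ l ∈ L, q (f k l))
    (ha : ∀ x y, q x → q y → q (x + y)) : q z := by
  refine Submodule.iSup_induction (motive := q) _ hz (fun k x hx => ?_) ?_ ha
  · obtain ⟨l, hl, rfl⟩ := hx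
    exact hm k k.2 l hl
  · have := hm 0 K.zero_mem 0 L.zero_mem
    rwa [map_zero] at this

/-! ### Splitting a representation into cyclic pieces -/

section Decomposition

variable {E F Z R : Type*} [NormedAddCommGroup E] [InnerProductSpace ℂ E] [CompleteSpace E]
  [NormedAddCommGroup F] [InnerProductSpace ℂ F] [NormedAddCommGroup Z] [InnerProductSpace ℂ Z]
  [NonUnitalRing R] [StarRing R] [Module ℂ R]

/-- The cyclic subspace generated by a vector. -/
def cyclicSubspace (π : R →⋆ₙₐ[ℂ] (E →L[ℂ] E)) (ξ : E) : Submodule ℂ E :=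
  Submodule.map (((ContinuousLinearMap.apply ℂ E ξ : (E →L[ℂ] E) →L[ℂ] E) :
    (E →L[ℂ] E) →ₗ[ℂ] E) ∘ₗ (π : R →ₗ[ℂ] (E →L[ℂ] E))) ⊤

theorem mem_cyclicSubspace {π : R →⋆ₙₐ[ℂ] (E →L[ℂ] E)} {ξ ω : E} :
    ω ∈ cyclicSubspace π ξ ↔ ∃ a, π a ξ = ω := by
  simp [cyclicSubspace]

/-- A subspace is invariant under a representation. -/
def IsRepInvariant (π : R →⋆ₙₐ[ℂ] (E →L[ℂ] E)) (K : Submodule ℂ E) : Prop :=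
  ∀ a, ∀ ξ ∈ K, π a ξ ∈ K

variable {π : R →⋆ₙₐ[ℂ] (E →L[ℂ] E)}

theorem isRepInvariant_cyclicSubspace (ξ : E) : IsRepInvariant π (cyclicSubspace π ξ) := by
  intro a ω hω
  obtain ⟨b, rfl⟩ := mem_cyclicSubspace.mp hω
  exact mem_cyclicSubspace.mpr ⟨a * b, by rw [map_mul]; rfl⟩

theorem IsRepInvariant.sup {K K' : Submodule ℂ E} (hK : IsRepInvariant π K) (hK' : IsRepInvariant π K') :
    IsRepInvariant π (K ⊔ K') := by
  intro a ξ hξ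
  obtain ⟨k, hk, k', hk', rfl⟩ := Submodule.mem_sup.mp hξ
  rw [map_add]
  exact Submodule.add_mem_sup (hK a k hk) (hK' a k' hk')

theorem IsRepInvariant.iSup {ι : Type*} {K : ι → Submodule ℂ E} (hK : ∀ i, IsRepInvariant π (K i)) :
    IsRepInvariant π (⨆ i, K i) := by
  intro a
  change (⨆ i, K i) ≤ (⨆ i, K i).comap (π a : E →ₗ[ℂ] E)
  exact iSup_le fun i ξ hξ => Submodule.mem_iSup_of_mem i (hK i a ξ hξ)

theorem IsRepInvariant.closure {K : Submodule ℂ E} (hK : IsRepInvariant π K) :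
    IsRepInvariant π K.topologicalClosure := fun a _ hξ =>
  map_mem_closure (π a).continuous hξ fun ω hω => hK a ω hω

/-- Gram–Schmidt for cyclic subspaces. The part `ω` of a new vector orthogonal to `K` generates a
cyclic subspace orthogonal to `K`, so the tensor products with `L` are orthogonal and `T`-invariant,
and the quadratic bound is additive over them. The bilinear map `t` is abstract so that the argument
serves both tensor factors. -/
theorem exists_invariant_of_forall_cyclic (t : E →ₗ[ℂ] F →ₗ[ℂ] Z)
    (ht : ∀ a b c d, inner ℂ (t a b) (t c d) = inner ℂ a c * inner ℂ b d)
    (htc : ∀ b, Continuous fun a => t a b) (T : Z →L[ℂ] Z) (L : Submodule ℂ F)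
    (hT : ∀ K, IsRepInvariant π K → ∀ z ∈ Submodule.map₂ t K L, T z ∈ Submodule.map₂ t K L)
    {c : ℝ} (hc : ∀ ξ, ∀ z ∈ Submodule.map₂ t (cyclicSubspace π ξ) L,
      (inner ℂ z (T z)).re ≤ c * ‖z‖ ^ 2) (S : Finset E) :
    ∃ K : Submodule ℂ E, IsClosed (K : Set E) ∧ IsRepInvariant π K ∧
      (∀ ξ ∈ S, cyclicSubspace π ξ ≤ K) ∧
      ∀ z ∈ Submodule.map₂ t K L, (inner ℂ z (T z)).re ≤ c * ‖z‖ ^ 2 := by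
  classical
  induction S using Finset.induction_on with
  | empty =>
    refine ⟨⊥, isClosed_singleton, fun a ξ hξ => ?_, by simp, fun z hz => ?_⟩
    · rw [(Submodule.mem_bot ℂ).mp hξ, map_zero]; exact Submodule.zero_mem _
    · rw [Submodule.map₂_bot_left, Submodule.mem_bot] at hz
      simp [hz]
  | insert ξ S hξ ih =>
    obtain ⟨K, hKc, hKi, hKS, hKq⟩ := ih
    have : CompleteSpace K := hKc.completeSpace_coe
    set ω := ξ - K.starProjection ξ with hω
    have hωK : ω ∈ Kᗮ := K.sub_starProjection_mem_orthogonal ξ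
    have horth : ∀ k ∈ K, ∀ l ∈ cyclicSubspace π ω, inner ℂ k l = 0 := by
      intro k hk l hl
      obtain ⟨a, rfl⟩ := mem_cyclicSubspace.mp hl
      rw [← ContinuousLinearMap.adjoint_inner_left, ← ContinuousLinearMap.star_eq_adjoint,
        ← map_star]
      exact hωK _ (hKi _ k hk)
    have horth2 : ∀ z ∈ Submodule.map₂ t K L, ∀ w ∈ Submodule.map₂ t (cyclicSubspace π ω) L,
        inner ℂ z w = 0 := by
      intro z hz w hw
      refine Submodule.map₂_induction (q := fun z => inner ℂ z w = 0) hz (fun k hk l hl => ?_) fun z z' h h' => by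
        rw [inner_add_left, h, h', add_zero]
      refine Submodule.map₂_induction (q := fun w => inner ℂ (t k l) w = 0) hw (fun k' hk' l' hl' => ?_) fun w w' h h' => by
        rw [inner_add_right, h, h', add_zero]
      rw [ht, horth k hk k' hk', zero_mul]
    have hinv := hKi.sup (isRepInvariant_cyclicSubspace (π := π) ω)
    have hq : ∀ z ∈ Submodule.map₂ t (K ⊔ cyclicSubspace π ω) L,
        (inner ℂ z (T z)).re ≤ c * ‖z‖ ^ 2 := by
      intro z hz
      rw [Submodule.map₂_sup_left] at hz
      obtain ⟨z₁, h₁, z₂, h₂, rfl⟩ := Submodule.mem_sup.mp hz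
      have e1 := horth2 _ h₁ _ (hT _ (isRepInvariant_cyclicSubspace ω) _ h₂)
      have e2 := horth2 _ (hT _ hKi _ h₁) _ h₂
      have e2' : inner ℂ z₂ (T z₁) = 0 := by rw [← inner_conj_symm, e2, map_zero]
      have e3 := horth2 _ h₁ _ h₂
      have e4 : ‖z₁ + z₂‖ ^ 2 = ‖z₁‖ ^ 2 + ‖z₂‖ ^ 2 := by
        have := norm_add_sq (𝕜 := ℂ) z₁ z₂
        rw [e3] at this
        simpa using this
      rw [map_add, inner_add_left, inner_add_right, inner_add_right, e1, e2', e4, add_zero,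
        zero_add, Complex.add_re]
      have := hKq _ h₁
      have := hc _ _ h₂
      linarith
    -- The closure is taken so that the next orthogonal projection exists; the bound survives by
    -- continuity in the first factor.
    refine ⟨(K ⊔ cyclicSubspace π ω).topologicalClosure, Submodule.isClosed_topologicalClosure _,
      hinv.closure, ?_, fun z hz => ?_⟩
    · intro ξ' hξ'
      rcases Finset.mem_insert.mp hξ' with rfl | h
      · intro l hl
        obtain ⟨a, rfl⟩ := mem_cyclicSubspace.mp hl
        refine Submodule.le_topologicalClosure _ ?_
        have : π a ξ' = π a (K.starProjection ξ') + π a ω := by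
          rw [← map_add, hω, add_sub_cancel]
        rw [this]
        exact Submodule.add_mem_sup (hKi _ _ (K.starProjection_apply_mem ξ'))
          (mem_cyclicSubspace.mpr ⟨a, rfl⟩)
      · exact (hKS ξ' h).trans (le_sup_left.trans (Submodule.le_topologicalClosure _))
    · have h1 : z ∈ (Submodule.map₂ t (K ⊔ cyclicSubspace π ω) L).topologicalClosure := by
        refine (Submodule.map₂_le.mpr fun k hk l hl => ?_ :
          Submodule.map₂ t (K ⊔ cyclicSubspace π ω).topologicalClosure L ≤ _) hz
        exact map_mem_closure (f := fun a => t a l) (htc l) hk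
          fun k' hk' => Submodule.apply_mem_map₂ t hk' hl
      have h2 : IsClosed {z : Z | (inner ℂ z (T z)).re ≤ c * ‖z‖ ^ 2} :=
        isClosed_le (by fun_prop) (by fun_prop)
      exact closure_minimal (fun z hz => hq z hz) h2 h1

/-- A vector of the tensor product with the sum of all cyclic subspaces involves only finitely many
of them. -/
theorem re_inner_le_of_forall_cyclic (t : E →ₗ[ℂ] F →ₗ[ℂ] Z)
    (ht : ∀ a b c d, inner ℂ (t a b) (t c d) = inner ℂ a c * inner ℂ b d)
    (htc : ∀ b, Continuous fun a => t a b) (T : Z →L[ℂ] Z) (L : Submodule ℂ F)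
    (hT : ∀ K, IsRepInvariant π K → ∀ z ∈ Submodule.map₂ t K L, T z ∈ Submodule.map₂ t K L)
    {c : ℝ} (hc : ∀ ξ, ∀ z ∈ Submodule.map₂ t (cyclicSubspace π ξ) L,
      (inner ℂ z (T z)).re ≤ c * ‖z‖ ^ 2) {z : Z}
    (hz : z ∈ Submodule.map₂ t (⨆ ξ, cyclicSubspace π ξ) L) :
    (inner ℂ z (T z)).re ≤ c * ‖z‖ ^ 2 := by
  rw [Submodule.map₂_iSup_left, Submodule.mem_iSup_iff_exists_finset] at hz
  obtain ⟨S, hS⟩ := hz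
  obtain ⟨K, -, -, hKS, hK⟩ := exists_invariant_of_forall_cyclic t ht htc T L hT hc S
  refine hK z ?_
  exact (iSup₂_le fun ξ hξ => Submodule.map₂_le_map₂_left (hKS ξ hξ) :
    ⨆ ξ ∈ S, Submodule.map₂ t (cyclicSubspace π ξ) L ≤ _) hS

end Decomposition

/-! ## Vector states -/

section VectorState

variable {E : Type*} [NormedAddCommGroup E] [InnerProductSpace ℂ E] [CompleteSpace E]

/-- The functional on the bounded operators given by a vector. -/
def vectorState (ξ : E) : WeakDual ℂ (E →L[ℂ] E) :=
  StrongDual.toWeakDual ((innerSL ℂ ξ).comp (ContinuousLinearMap.apply ℂ E ξ))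

omit [CompleteSpace E] in
theorem vectorState_apply (ξ : E) (T : E →L[ℂ] E) : vectorState ξ T = inner ℂ ξ (T ξ) := rfl

theorem vectorState_mem {ξ : E} (hξ : ‖ξ‖ = 1) : vectorState ξ ∈ states (E →L[ℂ] E) := by
  refine ⟨?_, fun T => ?_⟩
  · rw [vectorState_apply, one_apply_eq_self, inner_self_eq_norm_sq_to_K, hξ]
    simp
  · rw [vectorState_apply, mul_apply_eq_comp, ContinuousLinearMap.star_eq_adjoint,
      ContinuousLinearMap.adjoint_inner_right, inner_self_eq_norm_sq_to_K]
    exact pow_nonneg (Complex.zero_le_real.mpr (norm_nonneg (T ξ))) 2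

end VectorState

theorem re_inner_real_smul_apply {Z : Type*} [NormedAddCommGroup Z] [InnerProductSpace ℂ Z]
    (T : Z →L[ℂ] Z) (r : ℝ) (z : Z) :
    (inner ℂ ((r : ℂ) • z) (T ((r : ℂ) • z))).re = r ^ 2 * (inner ℂ z (T z)).re := by
  rw [map_smul, inner_smul_left, inner_smul_right, Complex.conj_ofReal, ← mul_assoc,
    ← Complex.ofReal_mul, Complex.re_ofReal_mul, sq]

namespace FellBundle

open StarAlgBundle CStarUnitization

universe u v

variable {G H : Type*} [Group G] [Group H] {A : FellBundle.{u} G} {B : FellBundle.{v} H}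

/-! ## The minimal norm and the product states -/

section TensorRep

variable {E F : Type*}
  [NormedAddCommGroup E] [InnerProductSpace ℂ E] [CompleteSpace E]
  [NormedAddCommGroup F] [InnerProductSpace ℂ F] [CompleteSpace F]
  (π : A.toBundle.UnitFiber →⋆ₙₐ[ℂ] (E →L[ℂ] E)) (ρ : B.toBundle.UnitFiber →⋆ₙₐ[ℂ] (F →L[ℂ] F))

theorem prodState_vectorState (ξ : E) (η : F) (x : (A.tensor B).UnitFiber) :
    prodState (WeakDual.pullback (lift π) (vectorState ξ))
      (WeakDual.pullback (lift ρ) (vectorState η)) x =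
      inner ℂ (ξ ⊗ₜ[ℂ] η) (tensorRep π ρ x (ξ ⊗ₜ[ℂ] η)) := by
  induction x using unit_induction with
  | h0 => rw [map_zero, map_zero, zero_apply, inner_zero_right]
  | h2 x y hx hy => rw [map_add, map_add, add_apply, inner_add_right, hx, hy]
  | h1 a b =>
    rw [prodState_utm, tensorRep_utm_tmul, TensorProduct.inner_tmul, WeakDual.pullback_apply,
      WeakDual.pullback_apply, lift_inr, lift_inr, vectorState_apply, vectorState_apply]

theorem tensorRep_mem_map₂ {K : Submodule ℂ E} {L : Submodule ℂ F} (hK : IsRepInvariant π K)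
    (hL : IsRepInvariant ρ L) (x : (A.tensor B).UnitFiber) {ζ : E ⊗[ℂ] F}
    (hζ : ζ ∈ Submodule.map₂ (TensorProduct.mk ℂ E F) K L) :
    tensorRep π ρ x ζ ∈ Submodule.map₂ (TensorProduct.mk ℂ E F) K L := by
  induction x using unit_induction with
  | h0 => rw [map_zero, zero_apply]; exact Submodule.zero_mem _
  | h2 x y hx hy => rw [map_add, add_apply]; exact Submodule.add_mem _ hx hy
  | h1 a b =>
    refine Submodule.map₂_induction (q := fun ζ => tensorRep π ρ (utm a b) ζ ∈
      Submodule.map₂ (TensorProduct.mk ℂ E F) K L) hζ (fun k hk l hl => ?_) fun z w h h' => by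
        rw [map_add]; exact Submodule.add_mem _ h h'
    exact Submodule.apply_mem_map₂ _ (hK a k hk) (hL b l hl)

/-- The tensor product of the essential subspaces of two representations. -/
def essentialTensor : Submodule ℂ (E ⊗[ℂ] F) :=
  Submodule.map₂ (TensorProduct.mk ℂ E F) (⨆ ξ, cyclicSubspace π ξ) (⨆ η, cyclicSubspace ρ η)

theorem tensorRep_mem_essentialTensor (x : (A.tensor B).UnitFiber) (ζ : E ⊗[ℂ] F) :
    tensorRep π ρ x ζ ∈ essentialTensor π ρ := by
  induction x using unit_induction with
  | h0 => rw [map_zero, zero_apply]; exact Submodule.zero_mem _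
  | h2 x y hx hy => rw [map_add, add_apply]; exact Submodule.add_mem _ hx hy
  | h1 a b =>
    induction ζ using TensorProduct.induction_on with
    | zero => rw [map_zero]; exact Submodule.zero_mem _
    | add z w h h' => rw [map_add]; exact Submodule.add_mem _ h h'
    | tmul ξ η =>
      exact Submodule.apply_mem_map₂ _
        (Submodule.mem_iSup_of_mem ξ (mem_cyclicSubspace.mpr ⟨a, rfl⟩))
        (Submodule.mem_iSup_of_mem η (mem_cyclicSubspace.mpr ⟨b, rfl⟩))

theorem exists_tensorRep_eq_of_mem_map₂ {ξ : E} {η : F} {ζ : E ⊗[ℂ] F}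
    (hζ : ζ ∈ Submodule.map₂ (TensorProduct.mk ℂ E F) (cyclicSubspace π ξ)
      (cyclicSubspace ρ η)) : ∃ w, ζ = tensorRep π ρ w (ξ ⊗ₜ η) := by
  refine Submodule.map₂_induction (q := fun ζ => ∃ w, ζ = tensorRep π ρ w (ξ ⊗ₜ η)) hζ
    (fun k hk l hl => ?_) ?_
  · obtain ⟨a, rfl⟩ := mem_cyclicSubspace.mp hk
    obtain ⟨b, rfl⟩ := mem_cyclicSubspace.mp hl
    exact ⟨utm a b, rfl⟩
  · rintro z z' ⟨w, rfl⟩ ⟨w', rfl⟩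
    exact ⟨w + w', by rw [map_add, add_apply]⟩

variable {u : (A.tensor B).UnitFiber} {c : ℝ}
  (hu : ∀ f ∈ states (CStarUnitization A.toBundle.UnitFiber),
    ∀ g ∈ states (CStarUnitization B.toBundle.UnitFiber), ∀ w,
    (prodState f g (star w * (u * w))).re ≤ c * (prodState f g (star w * w)).re)
include hu

/-- Here `ζ = (π ⊗ ρ)(w)(ξ ⊗ η)`, and up to normalization the vector states of `ξ` and `η` turn `⟨ζ,
(π ⊗ ρ)(u)ζ⟩` into `(f ⊗ g)(w*uw)`, to which the hypothesis applies. -/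
theorem re_inner_tensorRep_le_of_mem_cyclic (ξ : E) (η : F) {ζ : E ⊗[ℂ] F}
    (hζ : ζ ∈ Submodule.map₂ (TensorProduct.mk ℂ E F) (cyclicSubspace π ξ)
      (cyclicSubspace ρ η)) :
    (inner ℂ ζ (tensorRep π ρ u ζ)).re ≤ c * ‖ζ‖ ^ 2 := by
  obtain ⟨w, rfl⟩ := exists_tensorRep_eq_of_mem_map₂ π ρ hζ
  rcases eq_or_ne ξ 0 with rfl | hξ
  · simp
  rcases eq_or_ne η 0 with rfl | hη
  · simp
  have hξn : (‖ξ‖ : ℂ) ≠ 0 := by simpa using hξ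
  have hηn : (‖η‖ : ℂ) ≠ 0 := by simpa using hη
  set ξ' : E := ((‖ξ‖ : ℂ))⁻¹ • ξ with hξ'
  set η' : F := ((‖η‖ : ℂ))⁻¹ • η with hη'
  have h1 : ‖ξ'‖ = 1 := by rw [hξ']; exact norm_smul_inv_norm hξ
  have h2 : ‖η'‖ = 1 := by rw [hη']; exact norm_smul_inv_norm hη
  have h3 := hu _ (pullback_mem_states (lift π) (vectorState_mem h1)) _
    (pullback_mem_states (lift ρ) (vectorState_mem h2)) w
  set ω := tensorRep π ρ w (ξ' ⊗ₜ η') with hω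
  have h4 : ∀ y, inner ℂ (ξ' ⊗ₜ[ℂ] η') (tensorRep π ρ (star w * (y * w)) (ξ' ⊗ₜ[ℂ] η')) =
      inner ℂ ω (tensorRep π ρ y ω) := by
    intro y
    rw [hω, inner_tensorRep_left, tensorRep_mul, tensorRep_mul]
    rfl
  have h5 : (inner ℂ (ξ' ⊗ₜ[ℂ] η') (tensorRep π ρ (star w * w) (ξ' ⊗ₜ[ℂ] η'))).re = ‖ω‖ ^ 2 :=
    (norm_tensorRep_apply_sq π ρ w _).symm
  rw [prodState_vectorState, prodState_vectorState, h4, h5] at h3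
  have h6 : tensorRep π ρ w (ξ ⊗ₜ η) = ((‖ξ‖ * ‖η‖ : ℝ) : ℂ) • ω := by
    rw [hω, ← map_smul, hξ', hη', TensorProduct.smul_tmul_smul, smul_smul]
    have : ((‖ξ‖ * ‖η‖ : ℝ) : ℂ) * ((‖ξ‖ : ℂ)⁻¹ * (‖η‖ : ℂ)⁻¹) = 1 := by
      push_cast
      field_simp
    rw [this, one_smul]
  have h7 := re_inner_real_smul_apply (tensorRep π ρ u) (‖ξ‖ * ‖η‖) ω
  rw [h6]
  refine h7.trans_le ?_
  rw [norm_smul, Complex.norm_real, mul_pow, Real.norm_of_nonneg (by positivity)]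
  have h8 := mul_le_mul_of_nonneg_left h3 (sq_nonneg (‖ξ‖ * ‖η‖))
  linarith

/-- The splitting into cyclic pieces is done twice: in `E` with a cyclic subspace of `F` held fixed,
then in `F` through the flipped tensor map. -/
theorem re_inner_tensorRep_le {ζ : E ⊗[ℂ] F} (hζ : ζ ∈ essentialTensor π ρ) :
    (inner ℂ ζ (tensorRep π ρ u ζ)).re ≤ c * ‖ζ‖ ^ 2 := by
  have h1 : ∀ η, ∀ ζ ∈ Submodule.map₂ (TensorProduct.mk ℂ E F) (⨆ ξ, cyclicSubspace π ξ)
      (cyclicSubspace ρ η), (inner ℂ ζ (tensorRep π ρ u ζ)).re ≤ c * ‖ζ‖ ^ 2 := fun η ζ hζ =>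
    re_inner_le_of_forall_cyclic (TensorProduct.mk ℂ E F) (fun a b c d => rfl)
      (fun b => TensorProduct.continuous_tmul.comp (Continuous.prodMk_left b)) (tensorRep π ρ u)
      (cyclicSubspace ρ η)
      (fun K hK z hz => tensorRep_mem_map₂ π ρ hK (isRepInvariant_cyclicSubspace η) u hz)
      (fun ξ z hz => re_inner_tensorRep_le_of_mem_cyclic π ρ hu ξ η hz) hζ
  have h2 : IsRepInvariant π (⨆ ξ, cyclicSubspace π ξ) :=
    IsRepInvariant.iSup fun ξ => isRepInvariant_cyclicSubspace ξ
  rw [essentialTensor, ← Submodule.map₂_flip] at hζ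
  refine re_inner_le_of_forall_cyclic (π := ρ) (TensorProduct.mk ℂ E F).flip
    (fun a b c d => mul_comm _ _)
    (fun b => TensorProduct.continuous_tmul.comp (Continuous.prodMk_right b)) (tensorRep π ρ u)
    (⨆ ξ, cyclicSubspace π ξ) (fun K hK z hz => ?_) (fun η z hz => ?_) hζ
  · rw [Submodule.map₂_flip] at hz ⊢
    exact tensorRep_mem_map₂ π ρ h2 hK u hz
  · rw [Submodule.map₂_flip] at hz
    exact h1 η z hz

/-- The quadratic bound on the essential subspace is an operator bound there, because `u` acts as a
positive operator. It extends to all vectors since the range lies in the essential subspace. -/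
theorem norm_tensorRep_le_of_forall_prodState (huS : u ∈ sumSq (A.tensor B).UnitFiber)
    (hc : 0 ≤ c) : ‖tensorRep π ρ u‖ ≤ c := by
  have hsa := sumSq_star_eq huS
  have hsymm : ∀ z w, inner ℂ (tensorRep π ρ u z) w = inner ℂ z (tensorRep π ρ u w) := by
    intro z w
    rw [inner_tensorRep_left, hsa]
  have hpos : ∀ z, 0 ≤ (inner ℂ z (tensorRep π ρ u z)).re := by
    intro z
    clear hu hsymm hsa
    induction huS using AddSubmonoid.closure_induction with
    | mem x hx =>
      obtain ⟨s, rfl⟩ := hx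
      exact (sq_nonneg _).trans_eq (norm_tensorRep_apply_sq π ρ s z)
    | zero => rw [map_zero, zero_apply, inner_zero_right, Complex.zero_re]
    | add x y _ _ hx hy =>
      rw [map_add, add_apply, inner_add_right, Complex.add_re]
      exact add_nonneg hx hy
  have key : ∀ ω ∈ essentialTensor π ρ, ‖tensorRep π ρ u ω‖ ≤ c * ‖ω‖ := fun ω hω =>
    norm_apply_le_of_re_inner_le (tensorRep π ρ u : E ⊗[ℂ] F →ₗ[ℂ] E ⊗[ℂ] F)
      (essentialTensor π ρ) (fun z _ => tensorRep_mem_essentialTensor π ρ u z) hsymm hpos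
      (fun z hz => re_inner_tensorRep_le π ρ hu hz) hω
  refine ContinuousLinearMap.opNorm_le_bound _ hc fun ζ => ?_
  have h1 := key _ (tensorRep_mem_essentialTensor π ρ u ζ)
  -- With `T = (π ⊗ ρ)(u)` symmetric, `‖Tζ‖² = ⟨ζ, T(Tζ)⟩ ≤ ‖ζ‖ · c‖Tζ‖`.
  have h2 : ‖tensorRep π ρ u ζ‖ ^ 2 ≤ ‖ζ‖ * ‖tensorRep π ρ u (tensorRep π ρ u ζ)‖ := by
    have h3 : ‖tensorRep π ρ u ζ‖ ^ 2 =
        (inner ℂ ζ (tensorRep π ρ u (tensorRep π ρ u ζ))).re := by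
      rw [norm_tensorRep_apply_sq, hsa, tensorRep_mul]
      rfl
    rw [h3]
    exact (Complex.re_le_norm _).trans (norm_inner_le_norm (𝕜 := ℂ) (E := E ⊗[ℂ] F) _ _)
  rcases (norm_nonneg (tensorRep π ρ u ζ)).eq_or_lt with h | h
  · rw [← h]; positivity
  · have h4 : ‖tensorRep π ρ u ζ‖ * ‖tensorRep π ρ u ζ‖ ≤ c * ‖ζ‖ * ‖tensorRep π ρ u ζ‖ := by
      nlinarith [norm_nonneg ζ]
    exact le_of_mul_le_mul_right h4 h

end TensorRep

/-- The criterion through which all upper bounds on the spatial norm of positive elements are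
obtained: product states, compressed by arbitrary `w`, see the norms in all representations `π ⊗ ρ`.
-/
theorem minSeminorm_le_of_forall_prodState {u : (A.tensor B).UnitFiber}
    (huS : u ∈ sumSq (A.tensor B).UnitFiber) {c : ℝ} (hc : 0 ≤ c)
    (hu : ∀ f ∈ states (CStarUnitization A.toBundle.UnitFiber),
      ∀ g ∈ states (CStarUnitization B.toBundle.UnitFiber), ∀ w,
      (prodState f g (star w * (u * w))).re ≤ c * (prodState f g (star w * w)).re) :
    A.minSeminorm B u ≤ c :=
  minNorm_le hc fun _ _ _ _ _ _ _ _ π ρ => norm_tensorRep_le_of_forall_prodState π ρ hu huS hc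

/-! ## The minimal norm on the tensor product of the bundles -/

variable (A B)

theorem eq_zero_of_tensor_ip_self_eq_zero {t : G × H} (x : (A.tensor B).fiber t)
    (hx : (A.tensor B).ip x x = 0) : x = 0 :=
  eq_zero_of_forall_prodState fun f _ g _ => by rw [hx, map_zero]

/-- By the criterion this is tested in product states: `w*⟨zy, zy⟩w` is the inner square of `z(yw)`,
bounded by `‖z‖²` times `w*⟨y, y⟩w`, and that by `‖z‖²‖⟨y, y⟩‖` times `w*w`. -/
theorem minSeminorm_ip_lact_le {t : G × H} (z : (A.tensor B).UnitFiber)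
    (y : (A.tensor B).fiber t) :
    A.minSeminorm B ((A.tensor B).ip ((A.tensor B).lact z y) ((A.tensor B).lact z y)) ≤
      A.minSeminorm B z ^ 2 * A.minSeminorm B ((A.tensor B).ip y y) := by
  refine minSeminorm_le_of_forall_prodState (A.tensor_ip_self_mem_sumSq B _)
    (mul_nonneg (sq_nonneg _) (apply_nonneg _ _)) fun f hf g hg w => ?_
  have h1 := prodState_ip_lact_le hf hg z ((A.tensor B).ract y w)
  rw [lact_ract, ip_ract_left, ip_ract_left, ip_ract_right, ip_ract_right] at h1
  refine h1.trans ?_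
  rw [_root_.mul_assoc]
  refine mul_le_mul_of_nonneg_left ?_ (sq_nonneg _)
  have h2 := prodState_ip_lact_right_le hf hg (t := 1) ((A.tensor B).ip y y) w
  have h3 := (A.tensor B).ip_unit w w
  have h4 := (A.tensor B).ip_unit w ((A.tensor B).ip y y * w)
  rw [← h3, ← h4]
  exact h2

theorem minSeminorm_ipSeminorm_lact_le {t : G × H} (z : (A.tensor B).UnitFiber)
    (y : (A.tensor B).fiber t) :
    (A.isCStarSeminorm_minSeminorm B).ipSeminorm eq_zero_of_minSeminorm_eq_zero
      (A.tensor_ip_self_mem_sumSq B) t ((A.tensor B).lact z y) ≤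
      A.minSeminorm B z * (A.isCStarSeminorm_minSeminorm B).ipSeminorm
        eq_zero_of_minSeminorm_eq_zero (A.tensor_ip_self_mem_sumSq B) t y := by
  refine le_of_sq_le_sq ?_ (mul_nonneg (apply_nonneg _ _) (apply_nonneg _ _))
  rw [mul_pow, IsCStarSeminorm.ipSeminorm_sq, IsCStarSeminorm.ipSeminorm_sq]
  exact A.minSeminorm_ip_lact_le B z y

/-- The minimal tensor product norm. -/
def minCStarNorm : CStarNorm (A.tensor B) :=
  (A.isCStarSeminorm_minSeminorm B).extend eq_zero_of_minSeminorm_eq_zero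
    (A.tensor_ip_self_mem_sumSq B) (A.eq_zero_of_tensor_ip_self_eq_zero B)
    (A.minSeminorm_ipSeminorm_lact_le B)

theorem minCStarNorm_seminorm_one (x : (A.tensor B).UnitFiber) :
    (A.minCStarNorm B).seminorm 1 x = A.toBundle.minNorm B.toBundle x :=
  IsCStarSeminorm.extend_seminorm_one _ _ _ _ (A.minSeminorm_ipSeminorm_lact_le B) x

/-! ## The maximal norm -/

/-- The maximum of a `C*`-seminorm and the minimal norm is a `C*`-norm, so bounds proved for norms
hold for seminorms. -/
theorem cstarSeminorm_le_of_forall_cstarNorm {x : (A.tensor B).UnitFiber} {C : ℝ}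
    (h : ∀ p : Seminorm ℂ (A.tensor B).UnitFiber, (A.tensor B).IsCStarSeminorm p →
      (∀ x, p x = 0 → x = 0) → p x ≤ C)
    {p : Seminorm ℂ (A.tensor B).UnitFiber} (hp : (A.tensor B).IsCStarSeminorm p) : p x ≤ C := by
  set q := p ⊔ A.minSeminorm B with hq
  have hqa : ∀ y, q y = max (p y) (A.minSeminorm B y) := fun y => rfl
  have hm := A.isCStarSeminorm_minSeminorm B
  refine (le_max_left _ _ : p x ≤ q x).trans (h q ⟨fun y z => ?_, fun y => ?_⟩ fun y hy => ?_)
  · rw [hqa, hqa, hqa]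
    exact max_le ((hp.mul_le y z).trans (mul_le_mul (le_max_left _ _) (le_max_left _ _)
      (apply_nonneg _ _) (le_max_of_le_left (apply_nonneg _ _))))
      ((hm.mul_le y z).trans (mul_le_mul (le_max_right _ _) (le_max_right _ _)
      (apply_nonneg _ _) (le_max_of_le_left (apply_nonneg _ _))))
  · rw [hqa, hqa, hp.star_mul_self, hm.star_mul_self]
    exact ((pow_left_monotoneOn (n := 2)).map_max (apply_nonneg p y)
      (apply_nonneg (A.minSeminorm B) y)).symm
  · refine eq_zero_of_minSeminorm_eq_zero y (le_antisymm ?_ (apply_nonneg _ _))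
    rw [← hy, hqa]
    exact le_max_right _ _

theorem exists_cstarSeminorm_le (x : (A.tensor B).UnitFiber) :
    ∃ C : ℝ, ∀ p : Seminorm ℂ (A.tensor B).UnitFiber, (A.tensor B).IsCStarSeminorm p →
      p x ≤ C := by
  induction x using unit_induction with
  | h0 => exact ⟨0, fun p _ => (map_zero p).le⟩
  | h1 a b =>
    exact ⟨‖a‖ * ‖b‖, fun p hp => A.cstarSeminorm_le_of_forall_cstarNorm B
      (fun q hq hq0 => A.cstarNorm_utm_le B hq hq0 a b) hp⟩
  | h2 x y hx hy =>
    obtain ⟨C, hC⟩ := hx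
    obtain ⟨C', hC'⟩ := hy
    exact ⟨C + C', fun p hp => (map_add_le_add p x y).trans (add_le_add (hC p hp) (hC' p hp))⟩

variable {A B}

theorem cstarSeminorm_le_maxNorm {p : Seminorm ℂ (A.tensor B).UnitFiber}
    (hp : (A.tensor B).IsCStarSeminorm p) (x : (A.tensor B).UnitFiber) :
    p x ≤ A.toBundle.maxNorm B.toBundle x := by
  obtain ⟨C, hC⟩ := A.exists_cstarSeminorm_le B x
  refine le_csSup ⟨C, ?_⟩ ⟨p, hp, rfl⟩
  rintro _ ⟨q, hq, rfl⟩
  exact hC q hq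

theorem maxNorm_le {x : (A.tensor B).UnitFiber} {c : ℝ} (hc : 0 ≤ c)
    (h : ∀ p : Seminorm ℂ (A.tensor B).UnitFiber, (A.tensor B).IsCStarSeminorm p → p x ≤ c) :
    A.toBundle.maxNorm B.toBundle x ≤ c := by
  refine Real.sSup_le ?_ hc
  rintro _ ⟨p, hp, rfl⟩
  exact h p hp

theorem maxNorm_nonneg (x : (A.tensor B).UnitFiber) : 0 ≤ A.toBundle.maxNorm B.toBundle x := by
  refine Real.sSup_nonneg ?_
  rintro _ ⟨p, hp, rfl⟩
  exact apply_nonneg p x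

variable (A B) in
/-- The maximal norm as a seminorm. -/
def maxSeminorm : Seminorm ℂ (A.tensor B).UnitFiber :=
  Seminorm.ofSMulLE (A.toBundle.maxNorm B.toBundle)
    (le_antisymm (maxNorm_le le_rfl fun p _ => (map_zero p).le) (maxNorm_nonneg _))
    (fun x y => maxNorm_le (add_nonneg (maxNorm_nonneg x) (maxNorm_nonneg y)) fun p hp =>
      (map_add_le_add p x y).trans
        (add_le_add (cstarSeminorm_le_maxNorm hp x) (cstarSeminorm_le_maxNorm hp y)))
    (fun c x => maxNorm_le (mul_nonneg (norm_nonneg c) (maxNorm_nonneg x)) fun p hp =>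
      (map_smul_eq_mul p c x).trans_le
        (mul_le_mul_of_nonneg_left (cstarSeminorm_le_maxNorm hp x) (norm_nonneg c)))

variable (A B) in
theorem isCStarSeminorm_maxSeminorm : (A.tensor B).IsCStarSeminorm (A.maxSeminorm B) where
  mul_le x y := maxNorm_le (mul_nonneg (maxNorm_nonneg x) (maxNorm_nonneg y)) fun p hp =>
    (hp.mul_le x y).trans (mul_le_mul (cstarSeminorm_le_maxNorm hp x)
      (cstarSeminorm_le_maxNorm hp y) (apply_nonneg p y) (maxNorm_nonneg x))
  star_mul_self x := by
    refine le_antisymm (maxNorm_le (sq_nonneg _) fun p hp => ?_) ?_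
    · rw [hp.star_mul_self]
      exact pow_le_pow_left₀ (apply_nonneg p x) (cstarSeminorm_le_maxNorm hp x) 2
    · refine (Real.le_sqrt (maxNorm_nonneg x) (maxNorm_nonneg _)).mp
        (maxNorm_le (Real.sqrt_nonneg _) fun p hp => Real.le_sqrt_of_sq_le ?_)
      rw [← hp.star_mul_self]
      exact cstarSeminorm_le_maxNorm hp _

theorem eq_zero_of_maxSeminorm_eq_zero (x : (A.tensor B).UnitFiber)
    (hx : A.maxSeminorm B x = 0) : x = 0 :=
  eq_zero_of_minSeminorm_eq_zero x (le_antisymm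
    ((cstarSeminorm_le_maxNorm (A.isCStarSeminorm_minSeminorm B) x).trans_eq hx)
    (apply_nonneg _ _))

end FellBundle

/-! ## The norm of the unit fiber acting on a fiber -/

namespace StarAlgBundle.IsCStarSeminorm

universe w

variable {K : Type*} [Group K] {D : StarAlgBundle.{w} K}
  {p : Seminorm ℂ D.UnitFiber} (hp : D.IsCStarSeminorm p) (hp0 : ∀ x, p x = 0 → x = 0)
  (hS : ∀ {t : K} (x : D.fiber t), D.ip x x ∈ sumSq D.UnitFiber) {t : K}

/-- The bounds for the operator given by an element of the unit fiber on another fiber. -/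
def actionBounds (t : K) (z : D.UnitFiber) : Set ℝ :=
  {c | 0 ≤ c ∧ ∀ y : D.fiber t,
    hp.ipSeminorm hp0 hS t (D.lact z y) ≤ c * hp.ipSeminorm hp0 hS t y}

theorem sInf_actionBounds_le {z : D.UnitFiber} {c : ℝ} (hc : 0 ≤ c)
    (h : ∀ y : D.fiber t, hp.ipSeminorm hp0 hS t (D.lact z y) ≤ c * hp.ipSeminorm hp0 hS t y) :
    sInf (hp.actionBounds hp0 hS t z) ≤ c :=
  csInf_le ⟨0, fun _ h => h.1⟩ ⟨hc, h⟩

theorem sInf_actionBounds_nonneg (z : D.UnitFiber) : 0 ≤ sInf (hp.actionBounds hp0 hS t z) :=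
  Real.sInf_nonneg fun _ h => h.1

theorem le_sInf_actionBounds_mul {z : D.UnitFiber} (hz : (hp.actionBounds hp0 hS t z).Nonempty)
    (y : D.fiber t) : hp.ipSeminorm hp0 hS t (D.lact z y) ≤
      sInf (hp.actionBounds hp0 hS t z) * hp.ipSeminorm hp0 hS t y := by
  rcases (apply_nonneg (hp.ipSeminorm hp0 hS t) y).eq_or_lt with h | h
  · obtain ⟨c, -, hc⟩ := hz
    have := hc y
    rw [← h, mul_zero] at this
    rw [← h, mul_zero]
    exact this
  · rw [← div_le_iff₀ h]
    exact le_csInf hz fun c hc => (div_le_iff₀ h).mpr (hc.2 y)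

variable (hb : ∀ z : D.UnitFiber, (hp.actionBounds hp0 hS t z).Nonempty)

/-- The operator seminorm of the unit fiber acting on another fiber. -/
def actionSeminorm : Seminorm ℂ D.UnitFiber :=
  Seminorm.ofSMulLE (fun z => sInf (hp.actionBounds hp0 hS t z))
    (le_antisymm (sInf_actionBounds_le hp hp0 hS le_rfl fun y => by
      have : D.lact 0 y = 0 := LinearMap.map_zero₂ (lactL t) y
      rw [this, map_zero, zero_mul]) (sInf_actionBounds_nonneg hp hp0 hS _))
    (fun x z => sInf_actionBounds_le hp hp0 hS (add_nonneg (sInf_actionBounds_nonneg hp hp0 hS x)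
      (sInf_actionBounds_nonneg hp hp0 hS z)) fun y => by
        rw [lact_add, add_mul]
        exact (map_add_le_add _ _ _).trans (add_le_add
          (le_sInf_actionBounds_mul hp hp0 hS (hb x) y)
          (le_sInf_actionBounds_mul hp hp0 hS (hb z) y)))
    (fun c z => sInf_actionBounds_le hp hp0 hS
      (mul_nonneg (norm_nonneg c) (sInf_actionBounds_nonneg hp hp0 hS z)) fun y => by
        rw [lact_smul, map_smul_eq_mul, _root_.mul_assoc]
        exact mul_le_mul_of_nonneg_left (le_sInf_actionBounds_mul hp hp0 hS (hb z) y)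
          (norm_nonneg c))

theorem ipSeminorm_lact_le_actionSeminorm (z : D.UnitFiber) (y : D.fiber t) :
    hp.ipSeminorm hp0 hS t (D.lact z y) ≤
      hp.actionSeminorm hp0 hS hb z * hp.ipSeminorm hp0 hS t y :=
  le_sInf_actionBounds_mul hp hp0 hS (hb z) y

/-- The usual proof for operators with adjoints: `‖zy‖² = ‖⟨y, z*zy⟩‖ ≤ ‖y‖ ‖z*zy‖` by
Cauchy–Schwarz. -/
theorem isCStarSeminorm_actionSeminorm : D.IsCStarSeminorm (hp.actionSeminorm hp0 hS hb) := by
  have hmul : ∀ x z, hp.actionSeminorm hp0 hS hb (x * z) ≤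
      hp.actionSeminorm hp0 hS hb x * hp.actionSeminorm hp0 hS hb z := fun x z =>
    sInf_actionBounds_le hp hp0 hS (mul_nonneg (apply_nonneg _ _) (apply_nonneg _ _)) fun y => by
      rw [lact_mul, _root_.mul_assoc]
      exact (hp.ipSeminorm_lact_le_actionSeminorm hp0 hS hb x _).trans
        (mul_le_mul_of_nonneg_left (hp.ipSeminorm_lact_le_actionSeminorm hp0 hS hb z y)
          (apply_nonneg _ _))
  have hsq : ∀ z, hp.actionSeminorm hp0 hS hb z ^ 2 ≤
      hp.actionSeminorm hp0 hS hb (star z * z) := by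
    intro z
    have h0 : 0 ≤ hp.actionSeminorm hp0 hS hb (star z * z) := apply_nonneg _ _
    refine (Real.le_sqrt (apply_nonneg _ _) h0).mp
      (sInf_actionBounds_le hp hp0 hS (Real.sqrt_nonneg _) fun y => ?_)
    refine le_of_sq_le_sq ?_ (mul_nonneg (Real.sqrt_nonneg _) (apply_nonneg _ _))
    rw [mul_pow, Real.sq_sqrt h0, ipSeminorm_sq, ip_lact_left, ← lact_mul]
    refine (hp.norm_ip_le hp0 hS _ _).trans ?_
    have h1 := hp.ipSeminorm_lact_le_actionSeminorm hp0 hS hb (star z * z) y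
    have h2 : 0 ≤ hp.ipSeminorm hp0 hS t y := apply_nonneg _ _
    rw [← hp.ipSeminorm_apply hp0 hS, ← hp.ipSeminorm_apply hp0 hS]
    nlinarith
  have hstar : ∀ z, hp.actionSeminorm hp0 hS hb z ≤ hp.actionSeminorm hp0 hS hb (star z) := by
    intro z
    rcases (apply_nonneg (hp.actionSeminorm hp0 hS hb) z).eq_or_lt with h | h
    · rw [← h]; exact apply_nonneg _ _
    · have h1 := (hsq z).trans (hmul _ _)
      rw [sq] at h1
      exact le_of_mul_le_mul_right h1 h
  refine ⟨hmul, fun z => le_antisymm ?_ (hsq z)⟩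
  have h2 := hstar (star z)
  rw [star_star] at h2
  rw [sq]
  exact (hmul _ _).trans (mul_le_mul_of_nonneg_right h2 (apply_nonneg _ _))

end StarAlgBundle.IsCStarSeminorm

namespace FellBundle

open StarAlgBundle

universe u v

variable {G H : Type*} [Group G] [Group H] (A : FellBundle.{u} G) (B : FellBundle.{v} H)

theorem actionBounds_nonempty {p : Seminorm ℂ (A.tensor B).UnitFiber}
    (hp : (A.tensor B).IsCStarSeminorm p) (hp0 : ∀ x, p x = 0 → x = 0) (t : G × H)
    (z : (A.tensor B).UnitFiber) :
    (hp.actionBounds hp0 (A.tensor_ip_self_mem_sumSq B) t z).Nonempty := by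
  induction z using unit_induction with
  | h0 =>
    refine ⟨0, le_rfl, fun y => ?_⟩
    have : (A.tensor B).lact 0 y = 0 := LinearMap.map_zero₂ (lactL t) y
    rw [this, map_zero, zero_mul]
  | h1 a b => exact ⟨‖a‖ * ‖b‖, by positivity, A.ipSeminorm_lact_utm_le B hp hp0 a b⟩
  | h2 x z hx hz =>
    obtain ⟨c, hc, hc'⟩ := hx
    obtain ⟨d, hd, hd'⟩ := hz
    refine ⟨c + d, add_nonneg hc hd, fun y => ?_⟩
    rw [lact_add, add_mul]
    exact (map_add_le_add _ _ _).trans (add_le_add (hc' y) (hd' y))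

/-- The operator seminorm on the fiber is one of the `C*`-seminorms in the supremum that defines the
maximal norm. -/
theorem maxSeminorm_ipSeminorm_lact_le {t : G × H} (z : (A.tensor B).UnitFiber)
    (y : (A.tensor B).fiber t) :
    (A.isCStarSeminorm_maxSeminorm B).ipSeminorm eq_zero_of_maxSeminorm_eq_zero
      (A.tensor_ip_self_mem_sumSq B) t ((A.tensor B).lact z y) ≤
      A.maxSeminorm B z * (A.isCStarSeminorm_maxSeminorm B).ipSeminorm
        eq_zero_of_maxSeminorm_eq_zero (A.tensor_ip_self_mem_sumSq B) t y := by
  have hb := A.actionBounds_nonempty B (A.isCStarSeminorm_maxSeminorm B)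
    eq_zero_of_maxSeminorm_eq_zero t
  exact (IsCStarSeminorm.ipSeminorm_lact_le_actionSeminorm _ _ _ hb z y).trans
    (mul_le_mul_of_nonneg_right (cstarSeminorm_le_maxNorm
      (IsCStarSeminorm.isCStarSeminorm_actionSeminorm _ _ _ hb) z) (apply_nonneg _ _))

/-- The maximal tensor product norm. -/
def maxCStarNorm : CStarNorm (A.tensor B) :=
  (A.isCStarSeminorm_maxSeminorm B).extend eq_zero_of_maxSeminorm_eq_zero
    (A.tensor_ip_self_mem_sumSq B) (A.eq_zero_of_tensor_ip_self_eq_zero B)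
    (A.maxSeminorm_ipSeminorm_lact_le B)

theorem maxCStarNorm_seminorm_one (x : (A.tensor B).UnitFiber) :
    (A.maxCStarNorm B).seminorm 1 x = A.toBundle.maxNorm B.toBundle x :=
  IsCStarSeminorm.extend_seminorm_one _ _ _ _ (A.maxSeminorm_ipSeminorm_lact_le B) x

end FellBundle

open scoped MultiplierAlgebra

/-! ## Actions by multipliers of the completion -/

/-- The relation `(xm)y = x(my)` makes the difference of the right parts annihilate everything from
the left, its own adjoint included. -/
theorem DoubleCentralizer.ext_of_fst {C : Type*} [NonUnitalCStarAlgebra C] {m n : 𝓜(ℂ, C)}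
    (h : ∀ x, m.fst x = n.fst x) : m = n := by
  refine DoubleCentralizer.ext ℂ C m n (Prod.ext (ContinuousLinearMap.ext h)
    (ContinuousLinearMap.ext fun x => ?_))
  have h1 : (m.snd x - n.snd x) * star (m.snd x - n.snd x) = 0 := by
    rw [sub_mul, m.central, n.central, h, sub_self]
  exact sub_eq_zero.mp (CStarRing.mul_star_self_eq_zero_iff _ |>.mp h1)

namespace CStarNorm

open StarAlgBundle

variable {K : Type*} [Group K] {D : StarAlgBundle K} (N : CStarNorm D) {R : Type*}
  [NonUnitalCStarAlgebra R] {L : R →ₗ[ℂ] D.fiber 1 →ₗ[ℂ] D.fiber 1} (hL : IsAdjointable L)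
  (hb : ∀ a x, N.seminorm 1 (L a x) ≤ ‖a‖ * N.seminorm 1 x)

/-- The extension of an adjointable action on the unit fiber to its completion. -/
def actionCompl (hb : ∀ a x, N.seminorm 1 (L a x) ≤ ‖a‖ * N.seminorm 1 x) (a : R) :
    N.complBundle.UnitFiber →L[ℂ] N.complBundle.UnitFiber :=
  (LinearMap.mkContinuous (L a : N.Fiber 1 →ₗ[ℂ] N.Fiber 1) ‖a‖ (hb a) :
    N.Fiber 1 →L[ℂ] N.Fiber 1).completion

theorem actionCompl_unitHom (a : R) (x : D.UnitFiber) :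
    N.actionCompl hb a (N.unitHom x) = N.unitHom (L a x : D.fiber 1) :=
  ContinuousLinearMap.completion_apply_coe _ _

theorem unit_induction {p : N.complBundle.UnitFiber → Prop} (x : N.complBundle.UnitFiber)
    (hp : IsClosed {x | p x}) (h : ∀ x, p (N.unitHom x)) : p x :=
  N.induction₁ (t := 1) x hp h

include hL in
theorem star_actionCompl_star_mul (a : R) (x y : N.complBundle.UnitFiber) :
    star (N.actionCompl hb (star a) (star x)) * y = x * N.actionCompl hb a y := by
  refine N.unit_induction (p := fun x => star (N.actionCompl hb (star a) (star x)) * y =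
    x * N.actionCompl hb a y) x (isClosed_eq (by fun_prop) (by fun_prop)) fun x => ?_
  refine N.unit_induction (p := fun y => star (N.actionCompl hb (star a)
    (star (N.unitHom x))) * y = N.unitHom x * N.actionCompl hb a y) y
    (isClosed_eq (by fun_prop) (by fun_prop)) fun y => ?_
  have e1 : star (N.actionCompl hb (star a) (star (N.unitHom x))) =
      N.unitHom (star (L (star a) (star x : D.UnitFiber) : D.UnitFiber)) := by
    rw [← map_star N.unitHom x]
    exact (congrArg star (N.actionCompl_unitHom hb _ _)).trans (map_star N.unitHom _).symm
  rw [e1]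
  refine ((map_mul N.unitHom _ _).symm.trans ?_).trans ((map_mul N.unitHom x _).trans
    (congrArg (N.unitHom x * ·) (N.actionCompl_unitHom hb a y).symm))
  have h := hL.ip_left (star a) (star x : D.UnitFiber) y
  rw [star_star] at h
  have h1 := (D.ip_unit (L (star a) (star x : D.UnitFiber)) y).symm.trans
    (h.trans (D.ip_unit (star x) (L a y)))
  rw [star_star] at h1
  exact congrArg N.unitHom h1

/-- An adjointable action on the unit fiber gives multipliers of its completion. -/
def multiplier (a : R) : 𝓜(ℂ, N.complBundle.UnitFiber) where
  fst := N.actionCompl hb a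
  snd :=
    { toFun := fun x => star (N.actionCompl hb (star a) (star x))
      map_add' := fun x y => by rw [star_add, map_add, star_add]
      map_smul' := fun c x => by
        rw [star_smul, map_smul, star_smul, star_star, RingHom.id_apply]
      cont := by fun_prop }
  central x y := N.star_actionCompl_star_mul hL hb a x y

theorem multiplier_fst_unitHom (a : R) (x : D.UnitFiber) :
    (N.multiplier hL hb a).fst (N.unitHom x) = N.unitHom (L a x : D.fiber 1) :=
  N.actionCompl_unitHom hb a x

theorem multiplier_ext {m n : 𝓜(ℂ, N.complBundle.UnitFiber)}
    (h : ∀ x, m.fst (N.unitHom x) = n.fst (N.unitHom x)) : m = n :=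
  DoubleCentralizer.ext_of_fst fun x =>
    N.unit_induction x (isClosed_eq m.fst.continuous n.fst.continuous) h

/-- The `*`-homomorphism into the multiplier algebra given by an adjointable action. -/
def multiplierHom : R →⋆ₙₐ[ℂ] 𝓜(ℂ, N.complBundle.UnitFiber) where
  toFun := N.multiplier hL hb
  map_smul' c a := N.multiplier_ext fun x => by
    rw [DoubleCentralizer.smul_fst, smul_apply, multiplier_fst_unitHom, multiplier_fst_unitHom]
    exact (congrArg N.unitHom (LinearMap.congr_fun (map_smul L c a) x)).trans
      (map_smul N.unitHom c _)
  map_zero' := N.multiplier_ext fun x => by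
    rw [DoubleCentralizer.zero_fst, zero_apply, multiplier_fst_unitHom, map_zero L]
    exact map_zero N.unitHom
  map_add' a b := N.multiplier_ext fun x => by
    rw [DoubleCentralizer.add_fst, add_apply, multiplier_fst_unitHom, multiplier_fst_unitHom,
      multiplier_fst_unitHom, map_add L]
    exact map_add N.unitHom _ _
  map_mul' a b := N.multiplier_ext fun x => by
    rw [DoubleCentralizer.mul_fst, mul_apply_eq_comp, multiplier_fst_unitHom,
      multiplier_fst_unitHom]
    exact (congrArg N.unitHom (hL.map_mul a b x)).trans (N.actionCompl_unitHom hb a _).symm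
  map_star' a := N.multiplier_ext fun x => by
    rw [DoubleCentralizer.star_fst]
    change N.actionCompl hb (star a) (N.unitHom x) =
      star (star (N.actionCompl hb (star a) (star (star (N.unitHom x)))))
    rw [star_star, star_star]

theorem multiplierHom_fst_unitHom (a : R) (x : D.UnitFiber) :
    (N.multiplierHom hL hb a).fst (N.unitHom x) = N.unitHom (L a x : D.fiber 1) :=
  N.actionCompl_unitHom hb a x

end CStarNorm

namespace FellBundle

open StarAlgBundle CStarUnitization

universe u v

variable {G H : Type*} [Group G] [Group H] {A : FellBundle.{u} G} {B : FellBundle.{v} H}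

/-! ## The minimal norm is minimal -/

theorem isCStarSeminorm_seminorm_one {K : Type*} [Group K] {D : StarAlgBundle K}
    (N : BundleNorm D) : D.IsCStarSeminorm (N.seminorm 1) where
  mul_le x y := N.mul_le (mul_one 1) x y
  star_mul_self x := by
    have h1 : star x * x = D.invMulSelf x := D.invMulSelf_eq inv_one (mul_one 1) x
    rw [h1]
    exact N.invMulSelf (t := 1) x

theorem utm_eq_zero {a : A.toBundle.UnitFiber} {b : B.toBundle.UnitFiber}
    (h : utm a b = 0) : a = 0 ∨ b = 0 := by
  by_contra! hab
  obtain ⟨f, hf⟩ : ∃ f : Module.Dual ℂ A.toBundle.UnitFiber, f a ≠ 0 := by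
    by_contra! h0
    exact hab.1 ((Module.forall_dual_apply_eq_zero_iff ℂ a).mp h0)
  obtain ⟨g, hg⟩ : ∃ g : Module.Dual ℂ B.toBundle.UnitFiber, g b ≠ 0 := by
    by_contra! h0
    exact hab.2 ((Module.forall_dual_apply_eq_zero_iff ℂ b).mp h0)
  have h1 := congrArg (fun w => TensorProduct.lid ℂ ℂ (TensorProduct.map f g
    (unitEquiv A.toBundle B.toBundle w))) h
  simp only [unitEquiv_utm, TensorProduct.map_tmul, TensorProduct.lid_tmul, map_zero,
    smul_eq_mul] at h1
  exact mul_ne_zero hf hg h1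

variable (α : CStarNorm (A.tensor B))

theorem seminorm_lactLeft_le (a : A.toBundle.UnitFiber) (x : (A.tensor B).fiber 1) :
    α.seminorm 1 (A.lactLeft B 1 a x) ≤ ‖a‖ * α.seminorm 1 x := by
  have h := (A.isAdjointable_lactLeft B 1).ipSeminorm_le
    (isCStarSeminorm_seminorm_one α.toBundleNorm) (fun x => α.eq_zero x)
    (A.tensor_ip_self_mem_sumSq B) a x
  have h1 := fun x => IsCStarSeminorm.ipSeminorm_unit
    (isCStarSeminorm_seminorm_one α.toBundleNorm) (fun x => α.eq_zero x)
    (A.tensor_ip_self_mem_sumSq B) x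
  exact (h1 _).symm.trans_le (h.trans_eq (congrArg (‖a‖ * ·) (h1 x)))

theorem seminorm_lactRight_le (b : B.toBundle.UnitFiber) (x : (A.tensor B).fiber 1) :
    α.seminorm 1 (A.lactRight B 1 b x) ≤ ‖b‖ * α.seminorm 1 x := by
  have h := (A.isAdjointable_lactRight B 1).ipSeminorm_le
    (isCStarSeminorm_seminorm_one α.toBundleNorm) (fun x => α.eq_zero x)
    (A.tensor_ip_self_mem_sumSq B) b x
  have h1 := fun x => IsCStarSeminorm.ipSeminorm_unit
    (isCStarSeminorm_seminorm_one α.toBundleNorm) (fun x => α.eq_zero x)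
    (A.tensor_ip_self_mem_sumSq B) x
  exact (h1 _).symm.trans_le (h.trans_eq (congrArg (‖b‖ * ·) (h1 x)))

/-- The action of the unit fiber of the left factor by multipliers. -/
def multLeft : A.toBundle.UnitFiber →⋆ₙₐ[ℂ] 𝓜(ℂ, α.complBundle.UnitFiber) :=
  α.multiplierHom (A.isAdjointable_lactLeft B 1) (seminorm_lactLeft_le α)

/-- The action of the unit fiber of the right factor by multipliers. -/
def multRight : B.toBundle.UnitFiber →⋆ₙₐ[ℂ] 𝓜(ℂ, α.complBundle.UnitFiber) :=
  α.multiplierHom (A.isAdjointable_lactRight B 1) (seminorm_lactRight_le α)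

theorem multLeft_mul_multRight_fst (a : A.toBundle.UnitFiber) (b : B.toBundle.UnitFiber)
    (x : (A.tensor B).UnitFiber) :
    (multLeft α a * multRight α b).fst (α.unitHom x) = α.unitHom (utm a b * x) := by
  rw [DoubleCentralizer.mul_fst, mul_apply_eq_comp, multLeft, multRight,
    CStarNorm.multiplierHom_fst_unitHom]
  refine (α.multiplierHom_fst_unitHom (A.isAdjointable_lactLeft B 1) (seminorm_lactLeft_le α)
    a _).trans ?_
  exact congrArg α.unitHom (A.lact_utm B (t := 1) a b x).symm

theorem lactLeft_lactRight {t : G × H} (a : A.toBundle.UnitFiber) (b : B.toBundle.UnitFiber)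
    (x : (A.tensor B).fiber t) :
    A.lactLeft B t a (A.lactRight B t b x) = A.lactRight B t b (A.lactLeft B t a x) := by
  induction x using A.tensor_induction B with
  | h0 => simp
  | h1 x y => rfl
  | h2 x y hx hy => simp only [map_add, hx, hy]

theorem commute_multLeft_multRight (a : A.toBundle.UnitFiber) (b : B.toBundle.UnitFiber) :
    Commute (multLeft α a) (multRight α b) := by
  refine α.multiplier_ext fun x => ?_
  rw [multLeft_mul_multRight_fst, DoubleCentralizer.mul_fst, mul_apply_eq_comp, multLeft,
    multRight, CStarNorm.multiplierHom_fst_unitHom]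
  refine Eq.trans ?_ (α.multiplierHom_fst_unitHom (A.isAdjointable_lactRight B 1)
    (seminorm_lactRight_le α) b _).symm
  exact congrArg α.unitHom ((A.lact_utm B (t := 1) a b x).trans (lactLeft_lactRight a b _))

theorem unitHom_injective {x : (A.tensor B).UnitFiber} (hx : α.unitHom x = 0) : x = 0 := by
  refine α.eq_zero (t := 1) x ?_
  rw [← α.norm_unitHom x, hx, norm_zero]

/-- The product of the two multipliers is multiplication by `a ⊗ b`. If it is zero, so is `(a ⊗ b)(a
⊗ b)*`, hence `a ⊗ b`, hence `a` or `b`. -/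
theorem eq_zero_of_multLeft_mul_multRight (a : A.toBundle.UnitFiber) (b : B.toBundle.UnitFiber)
    (h : multLeft α a * multRight α b = 0) : a = 0 ∨ b = 0 := by
  have h1 : ∀ x, utm a b * x = 0 := by
    intro x
    apply unitHom_injective α
    rw [← multLeft_mul_multRight_fst, h, DoubleCentralizer.zero_fst, zero_apply]
  refine utm_eq_zero (unitHom_injective α ?_)
  have h2 := congrArg α.unitHom (h1 (star (utm a b)))
  rw [map_mul, map_star, map_zero] at h2
  exact CStarRing.mul_star_self_eq_zero_iff _ |>.mp h2

theorem productMap_fst (x y : (A.tensor B).UnitFiber) :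
    (productMap (multLeft α) (multRight α) (unitEquiv A.toBundle B.toBundle x)).fst
      (α.unitHom y) = α.unitHom (x * y) := by
  induction x using StarAlgBundle.unit_induction with
  | h0 => rw [map_zero, map_zero, zero_mul, map_zero, DoubleCentralizer.zero_fst, zero_apply]
  | h1 a b => rw [unitEquiv_utm, productMap_tmul, multLeft_mul_multRight_fst]
  | h2 x x' hx hx' =>
    rw [map_add, map_add, DoubleCentralizer.add_fst, add_apply, hx, hx', add_mul, map_add]

/-- Takesaki's bound for the multiplier algebra of the completed unit fiber. Multipliers are used
because, without units, `A_e` and `B_e` need not lie in that completion. The multiplier of `x` is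
left multiplication by `x`, of norm at most `α(x)`. -/
theorem norm_prodState_le {f : WeakDual ℂ (CStarUnitization A.toBundle.UnitFiber)}
    {g : WeakDual ℂ (CStarUnitization B.toBundle.UnitFiber)}
    (hf : f ∈ states (CStarUnitization A.toBundle.UnitFiber))
    (hg : g ∈ states (CStarUnitization B.toBundle.UnitFiber)) (x : (A.tensor B).UnitFiber) :
    ‖prodState f g x‖ ≤ α.seminorm 1 x := by
  refine (norm_tensorFunctional_le (commute_multLeft_multRight α)
    (eq_zero_of_multLeft_mul_multRight α) hf hg (unitEquiv A.toBundle B.toBundle x)).trans ?_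
  rw [← DoubleCentralizer.norm_fst]
  refine ContinuousLinearMap.opNorm_le_bound _ (apply_nonneg (α.seminorm 1) x) fun c => ?_
  refine α.unit_induction (p := fun c => ‖(productMap (multLeft α) (multRight α)
    (unitEquiv A.toBundle B.toBundle x)).fst c‖ ≤ α.seminorm 1 x * ‖c‖) c
    (isClosed_le (by fun_prop) (by fun_prop)) fun y => ?_
  rw [productMap_fst, map_mul]
  exact (norm_mul_le _ _).trans_eq (congrArg (· * _) (α.norm_unitHom x))

/-- The extension of a product state to the completion of the unit fiber. -/
theorem exists_extend_prodState {f : WeakDual ℂ (CStarUnitization A.toBundle.UnitFiber)}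
    {g : WeakDual ℂ (CStarUnitization B.toBundle.UnitFiber)}
    (hf : f ∈ states (CStarUnitization A.toBundle.UnitFiber))
    (hg : g ∈ states (CStarUnitization B.toBundle.UnitFiber)) :
    ∃ Φ : α.complBundle.UnitFiber →L[ℂ] ℂ, (∀ x, Φ (α.unitHom x) = prodState f g x) ∧
      ∀ c, 0 ≤ (Φ (star c * c)).re := by
  let φ : α.Fiber 1 →L[ℂ] ℂ := LinearMap.mkContinuous
    (prodState f g : α.Fiber 1 →ₗ[ℂ] ℂ) 1 fun x => by
      rw [one_mul]
      exact norm_prodState_le α hf hg x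
  let Φ : α.complBundle.UnitFiber →L[ℂ] ℂ :=
    φ.extend (UniformSpace.Completion.toComplL : α.Fiber 1 →L[ℂ] α.Compl 1)
  have hΦ : ∀ x, Φ (α.unitHom x) = prodState f g x := fun x =>
    φ.extend_eq (e := UniformSpace.Completion.toComplL) UniformSpace.Completion.denseRange_coe
      (UniformSpace.Completion.isUniformInducing_coe _) x
  refine ⟨Φ, hΦ, fun c => ?_⟩
  refine α.unit_induction (p := fun c => 0 ≤ (Φ (star c * c)).re) c
    (isClosed_le (by fun_prop) (by fun_prop)) fun x => ?_
  rw [← map_star, ← map_mul, hΦ]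
  exact (Complex.nonneg_iff.mp (prodState_star_mul_self_nonneg hf hg x)).1

/-- The minimal norm is the smallest `C*`-norm. -/
theorem minSeminorm_le_seminorm_one (x : (A.tensor B).UnitFiber) :
    A.minSeminorm B x ≤ α.seminorm 1 x := by
  have h0 : 0 ≤ α.seminorm 1 x := apply_nonneg _ _
  have h1 : A.minSeminorm B (star x * x) ≤ α.seminorm 1 x ^ 2 := by
    -- In the `C*`-completion for `α`, `w*(x*x)w ≤ ‖x*x‖ w*w`, and the extended product state is
    -- positive there. The `C*`-identity then passes from `x*x` to `x`.
    refine minSeminorm_le_of_forall_prodState (star_mul_self_mem_sumSq x) (sq_nonneg _)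
      fun f hf g hg w => ?_
    obtain ⟨Φ, hΦ, hpos⟩ := exists_extend_prodState α hf hg
    have h2 : ‖α.unitHom (star x * x)‖ ≤ α.seminorm 1 x ^ 2 := by
      rw [α.norm_unitHom]
      exact ((isCStarSeminorm_seminorm_one α.toBundleNorm).star_mul_self x).le
    have h3 := smul_sub_conj_mem_sumSq
      (by rw [← map_star, (IsSelfAdjoint.star_mul_self x).star_eq]) h2 (α.unitHom w)
    obtain ⟨d, hd⟩ := exists_star_mul_self_of_mem_sumSq h3
    have h4 := hpos d
    rw [← hd, map_sub, map_smul, ← map_star, ← map_mul, ← map_mul, ← map_mul, hΦ, hΦ, smul_eq_mul,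
      Complex.sub_re, Complex.re_ofReal_mul] at h4
    exact sub_nonneg.mp h4
  rw [(A.isCStarSeminorm_minSeminorm B).star_mul_self] at h1
  exact le_of_sq_le_sq h1 h0

end FellBundle

/-! ## Morphisms between completions -/

/-- For `k = f(b)` with `f(r) = m/max(m, |r|) - 1`, the expression is `(1 + k)b(1 + k)`, the
function `r(m/max(m, |r|))²` of `b`, of modulus at most `m`. As `f` vanishes on `[-m, m]`, which
contains the spectrum of `φ(b)`, `φ(k) = 0`. -/
theorem NonUnitalStarAlgHom.exists_truncation {C C' : Type*} [NonUnitalCStarAlgebra C]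
    [NonUnitalCStarAlgebra C'] (φ : C →⋆ₙₐ[ℂ] C') {b : C} (hb : IsSelfAdjoint b) {m : ℝ}
    (hm : 0 < m) (hφ : ‖φ b‖ ≤ m) :
    ∃ k, star k = k ∧ φ k = 0 ∧ ‖b + b * k + k * b + k * (b * k)‖ ≤ m := by
  let f : ℝ → ℝ := fun r => m / max m |r| - 1
  have hpos : ∀ r, 0 < max m |r| := fun r => lt_max_of_lt_left hm
  have hf : Continuous f := by
    refine (Continuous.div continuous_const (by fun_prop) fun r => (hpos r).ne').sub
      continuous_const
  have hf0 : f 0 = 0 := by simp [f, hm.le, hm.ne']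
  have hφb : IsSelfAdjoint (φ b) := hb.map φ
  refine ⟨cfcₙ f b, (cfcₙ_predicate f b : IsSelfAdjoint (cfcₙ f b)).star_eq, ?_, ?_⟩
  · rw [NonUnitalStarAlgHomClass.map_cfcₙ (S := ℂ) φ f b hf.continuousOn hf0 (AddMonoidHomClass.continuous_of_bound φ 1 fun x =>
      (NonUnitalStarAlgHom.norm_apply_le φ x).trans_eq (one_mul _).symm) hb hφb]
    rw [cfcₙ_congr (g := fun _ => 0), cfcₙ_const_zero]
    intro r hr
    have h1 := norm_apply_le_norm_cfcₙ (id : ℝ → ℝ) (φ b) hr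
    rw [cfcₙ_id ℝ (φ b)] at h1
    have h2 : |r| ≤ m := h1.trans hφ
    simp [f, h2, hm.ne']
  · have h1 : b + b * cfcₙ f b + cfcₙ f b * b + cfcₙ f b * (b * cfcₙ f b) =
        cfcₙ (fun r => r + r * f r + f r * r + f r * (r * f r)) b := by
      have hc := hf.continuousOn (s := quasispectrum ℝ b)
      have h0 := cfcₙ_id' ℝ b
      have e1 := cfcₙ_mul (fun r : ℝ => r) f b continuousOn_id rfl hc hf0
      have e2 := cfcₙ_mul f (fun r : ℝ => r) b hc hf0 continuousOn_id rfl
      have c1 : ContinuousOn (fun r => r * f r) (quasispectrum ℝ b) := continuousOn_id.mul hc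
      have c2 : ContinuousOn (fun r => f r * r) (quasispectrum ℝ b) := hc.mul continuousOn_id
      have e3 := cfcₙ_mul f (fun r => r * f r) b hc hf0 c1 (zero_mul _)
      rw [h0] at e1 e2
      rw [e1] at e3
      have e4 := cfcₙ_add (fun r : ℝ => r) (fun r => r * f r) b continuousOn_id rfl c1 (zero_mul _)
      have e5 := cfcₙ_add (fun r : ℝ => r + r * f r) (fun r => f r * r) b
        (continuousOn_id.add c1) (by simp) c2 (mul_zero _)
      have e6 := cfcₙ_add (fun r : ℝ => r + r * f r + f r * r) (fun r => f r * (r * f r)) b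
        ((continuousOn_id.add c1).add c2) (by simp) (hc.mul c1) (by simp)
      rw [e6, e5, e4, e3, e2, e1, h0]
    rw [h1]
    refine norm_cfcₙ_le fun r _ => ?_
    have h2 : r + r * f r + f r * r + f r * (r * f r) = r * (m / max m |r|) ^ 2 := by
      simp only [f]; ring
    rw [h2, Real.norm_eq_abs, abs_mul, abs_of_nonneg (sq_nonneg (m / max m |r|)), div_pow, ← mul_div_assoc,
      div_le_iff₀ (pow_pos (hpos r) 2)]
    have h3 := le_max_left m |r|
    have h4 := le_max_right m |r|
    calc |r| * m ^ 2 = m * (m * |r|) := by ring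
      _ ≤ m * (max m |r| * max m |r|) := by gcongr
      _ = m * max m |r| ^ 2 := by ring

namespace CStarNorm

open StarAlgBundle

variable {K : Type*} [Group K] {D : StarAlgBundle K} {N N' : CStarNorm D}

theorem seminorm_le (h : ∀ x, N'.seminorm 1 x ≤ N.seminorm 1 x) {t : K} (x : D.fiber t) :
    N'.seminorm t x ≤ N.seminorm t x := by
  refine le_of_sq_le_sq ?_ (apply_nonneg _ _)
  rw [← N.invMulSelf, ← N'.invMulSelf]
  exact h _

variable (h : ∀ x, N'.seminorm 1 x ≤ N.seminorm 1 x)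

/-- The extension of the identity map of a fiber to the completions for two comparable norms. -/
def complMap (h : ∀ x, N'.seminorm 1 x ≤ N.seminorm 1 x) (t : K) :
    N.Compl t →L[ℂ] N'.Compl t :=
  (LinearMap.mkContinuous ((N'.toFiber t).toLinearMap ∘ₗ (N.toFiber t).symm.toLinearMap) 1
    (fun _ => (seminorm_le h _).trans_eq (one_mul _).symm) :
      N.Fiber t →L[ℂ] N'.Fiber t).completion

theorem complMap_toCompl (t : K) (x : D.fiber t) :
    complMap h t (N.toCompl t x) = N'.toCompl t x :=
  ContinuousLinearMap.completion_apply_coe _ _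

theorem norm_complMap_le {t : K} (y : N.Compl t) : ‖complMap h t y‖ ≤ ‖y‖ := by
  refine N.induction₁ (p := fun y => ‖complMap h t y‖ ≤ ‖y‖) y
    (isClosed_le (by fun_prop) (by fun_prop)) fun x => ?_
  rw [complMap_toCompl, N.norm_toCompl, N'.norm_toCompl]
  exact seminorm_le h x

theorem complMap_mul {s t r : K} (e : s * t = r) (x : N.Compl s) (y : N.Compl t) :
    complMap h r (N.mulC e x y) = N'.mulC e (complMap h s x) (complMap h t y) := by
  refine N.induction₂ (p := fun x y => complMap h r (N.mulC e x y) =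
    N'.mulC e (complMap h s x) (complMap h t y)) x y (isClosed_eq (by fun_prop) (by fun_prop))
    fun x y => ?_
  simp only [N.mulC_toCompl, N'.mulC_toCompl, complMap_toCompl]

theorem complMap_inv {s t : K} (e : s⁻¹ = t) (x : N.Compl s) :
    complMap h t (N.invC e x) = N'.invC e (complMap h s x) := by
  refine N.induction₁ (p := fun x => complMap h t (N.invC e x) = N'.invC e (complMap h s x)) x
    (isClosed_eq (by fun_prop) (by fun_prop)) fun x => ?_
  simp only [N.invC_toCompl, N'.invC_toCompl, complMap_toCompl]

/-- The `*`-homomorphism between the completions of the unit fiber for two comparable norms. -/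
def complUnitHom (h : ∀ x, N'.seminorm 1 x ≤ N.seminorm 1 x) :
    N.complBundle.UnitFiber →⋆ₙₐ[ℂ] N'.complBundle.UnitFiber where
  toFun := complMap h 1
  map_smul' := map_smul (complMap h 1)
  map_zero' := map_zero (complMap h 1)
  map_add' := map_add (complMap h 1)
  map_mul' := complMap_mul h (mul_one 1)
  map_star' := complMap_inv h inv_one

theorem complMap_ip {t : K} (x y : N.complBundle.fiber t) :
    complUnitHom h (N.complBundle.ip x y) =
      N'.complBundle.ip (t := t) (complMap h t x) (complMap h t y) :=
  (complMap_mul h (inv_mul_cancel t) _ _).trans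
    (congrArg (fun z => N'.mulC (inv_mul_cancel t) z (complMap h t y)) (complMap_inv h rfl x))

theorem complMap_ract {t : K} (x : N.complBundle.fiber t) (k : N.complBundle.UnitFiber) :
    complMap h t (N.complBundle.ract x k) =
      N'.complBundle.ract (t := t) (complMap h t x) (complUnitHom h k) :=
  complMap_mul h (mul_one t) _ _

/-- `z = y(1 + k)` with `k` from the truncation of `⟨y, y⟩` at the squared norm of the image. Since
`k` maps to zero, `z` and `y` have the same image, and `⟨z, z⟩ = (1 + k)⟨y, y⟩(1 + k)` has been cut
down to the required norm. -/
theorem exists_complMap_eq {t : K} (y : N.Compl t) :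
    ∃ z, complMap h t z = complMap h t y ∧ ‖z‖ ≤ ‖complMap h t y‖ := by
  rcases eq_or_ne (complMap h t y) 0 with h0 | h0
  · exact ⟨0, by rw [map_zero, h0], by rw [norm_zero]; exact norm_nonneg _⟩
  let C := N.complBundle
  let y' : C.fiber t := y
  have hb : IsSelfAdjoint (C.ip y' y') := C.star_ip y' y'
  have hφ : ‖complUnitHom h (C.ip y' y')‖ ≤ ‖complMap h t y‖ ^ 2 := by
    rw [complMap_ip]
    exact (N'.complNorm.invMulSelf (t := t) (complMap h t y)).le
  obtain ⟨k, hk, hk0, hkn⟩ := (complUnitHom h).exists_truncation hb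
    (pow_pos (norm_pos_iff.mpr h0) 2) hφ
  refine ⟨(y' + C.ract y' k : C.fiber t), ?_, ?_⟩
  · have h1 := complMap_ract h y' k
    rw [hk0] at h1
    refine ((map_add (complMap h t) y' (C.ract y' k)).trans
      (congrArg (complMap h t y + ·) (h1.trans ?_))).trans (add_zero _)
    exact map_zero (N'.complBundle.mul (mul_one t) (complMap h t y))
  · have h1 : C.ip (y' + C.ract y' k) (y' + C.ract y' k) = C.ip y' y' + C.ip y' y' * k +
        k * C.ip y' y' + k * (C.ip y' y' * k) := by
      rw [ip_add_left, ip_add_right, ip_add_right, ip_ract_left, ip_ract_left, ip_ract_right, hk]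
      abel
    have h2 := N.complNorm.invMulSelf (t := t) (y' + C.ract y' k : C.fiber t)
    rw [← h1] at hkn
    exact le_of_sq_le_sq (h2.symm.trans_le hkn) (norm_nonneg _)

/-- The range is dense, as it contains the original fiber, and preimages without increase of norm
allow limits of images to be lifted by completeness. -/
theorem complMap_surjective (t : K) : Function.Surjective (complMap h t) := by
  let f : NormedAddGroupHom (N.Compl t) (N'.Compl t) :=
    (complMap h t : N.Compl t →+ N'.Compl t).mkNormedAddGroupHom 1 fun y =>
      (norm_complMap_le h y).trans_eq (one_mul _).symm
  have h1 : f.SurjectiveOnWith f.range 1 := by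
    rintro _ ⟨y, rfl⟩
    obtain ⟨z, hz, hn⟩ := exists_complMap_eq h y
    exact ⟨z, hz, hn.trans_eq (one_mul _).symm⟩
  have h2 := controlled_closure_of_complete one_pos one_pos h1
  intro x
  have h3 : x ∈ f.range.topologicalClosure := by
    refine closure_mono ?_ (N'.denseRange_toCompl t x)
    rintro _ ⟨w, rfl⟩
    exact ⟨N.toCompl t w, complMap_toCompl h t w⟩
  obtain ⟨z, hz, -⟩ := h2 x h3
  exact ⟨z, hz⟩

/-- The morphism between the completions for two comparable norms that extends the identity. -/
def complHom (h : ∀ x, N'.seminorm 1 x ≤ N.seminorm 1 x) :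
    FellBundle.Hom N.completion N'.completion where
  toFun t := (complMap h t).toLinearMap
  map_mul := complMap_mul h
  map_inv := complMap_inv h
  continuous t := by
    let f : N.completion.cstarNorm.Fiber t →+ N'.completion.cstarNorm.Fiber t :=
      AddMonoidHom.mk' (complMap h t : N.Compl t → N'.Compl t) (map_add (complMap h t))
    exact AddMonoidHomClass.continuous_of_bound f 1 fun y =>
      (norm_complMap_le h y).trans_eq (one_mul _).symm

theorem exists_surjective_hom (h : ∀ x, N'.seminorm 1 x ≤ N.seminorm 1 x) :
    ∃ φ : FellBundle.Hom N.completion N'.completion,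
      (∀ t x, φ.toFun t (N.toCompl t x) = N'.toCompl t x) ∧
      ∀ t, Function.Surjective (φ.toFun t) :=
  ⟨complHom h, complMap_toCompl h, complMap_surjective h⟩

end CStarNorm

end

/-! ### The maximal and minimal tensor products of Fell bundles -/

theorem mainTheorem8 {G H : Type*} [Group G] [Group H] (A : FellBundle G) (B : FellBundle H) :
    ∃ μ ν : CStarNorm (A.toBundle.tensor B.toBundle),
      (∀ x, μ.seminorm 1 x = A.toBundle.maxNorm B.toBundle x) ∧
      (∀ x, ν.seminorm 1 x = A.toBundle.minNorm B.toBundle x) ∧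
      ∀ α : CStarNorm (A.toBundle.tensor B.toBundle),
        (∃ φ : FellBundle.Hom μ.completion α.completion,
          (∀ t x, φ.toFun t (μ.toCompl t x) = α.toCompl t x) ∧
          ∀ t, Function.Surjective (φ.toFun t)) ∧
        (∃ ψ : FellBundle.Hom α.completion ν.completion,
          (∀ t x, ψ.toFun t (α.toCompl t x) = ν.toCompl t x) ∧
          ∀ t, Function.Surjective (ψ.toFun t)) := by
  refine ⟨A.maxCStarNorm B, A.minCStarNorm B, A.maxCStarNorm_seminorm_one B,
    A.minCStarNorm_seminorm_one B, fun α => ⟨CStarNorm.exists_surjective_hom fun x => ?_,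
      CStarNorm.exists_surjective_hom fun x => ?_⟩⟩
  · exact (FellBundle.cstarSeminorm_le_maxNorm
      (FellBundle.isCStarSeminorm_seminorm_one α.toBundleNorm) x).trans_eq
      (A.maxCStarNorm_seminorm_one B x).symm
  · exact ((A.minCStarNorm_seminorm_one B x).trans (FellBundle.minSeminorm_apply x).symm).trans_le
      (FellBundle.minSeminorm_le_seminorm_one α x)
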